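/- Let $\Gamma$ be a bipartite distance-regular graph with vertex set $X$, path-length distance $\partial$, diameter $D\ge 4$, valency $k\ge 3$ and intersection numbers $p^h_{ij}=|\{z\in X:\partial(x,z)=i,\ \partial(z,y)=j\}|$ (where $\partial(x,y)=h$). Write $b_i=p^i_{1,i+1}$ and $k_2=p^0_{22}$. Let $\theta_0>\theta_1>\cdots>\theta_D$ be the distinct eigenvalues of the adjacency matrix $A$, and let $d=\lfloor D/2\rfloor$. Fix $x\in X$. Let $V=\mathbb C^X$ be the standard module with its Hermitian inner product, let $E_i^*$ $(0\le i\le D)$ be the diagonal matrix whose $(y,y)$ entry is $1$ if $\partial(x,y)=i$ and $0$ otherwise, let $A_2$ be the $0/1$ matrix whose $(y,z)$ entry is $1$ exactly when $\partial(y,z)=2$, and let $T=T(x)$ be the algebra of complex matrices generated by $A,E_0^*,\ldots,E_D^*$. A $T$-module is a subspace $W\subseteq V$ with $TW\subseteq W$. The endpoint of an irreducible $T$-module $W$ is $\min\{i: E_i^*W\ne 0\}$, and $W$ is thin if $\dim E_i^*W\le 1$ for all $i$. If $W$ is a thin irreducible $T$-module with endpoint $2$, its local eigenvalue is the eigenvalue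 of $E_2^*A_2E_2^*$ on the one-dimensional space $E_2^*W$. The local eigenvalues $\eta_1,\ldots,\eta_{k_2}$ of $\Gamma$ with respect to $x$ are the eigenvalues, with multiplicity, of the graph on $\{y:\partial(x,y)=2\}$ in which $y,z$ are adjacent when $\partial(y,z)=2$; they can be, and are, ordered so that $\eta_1=p^2_{22}$ and $\eta_i=b_3-1$ for $2\le i\le k$. Let $V_0$ be the unique irreducible $T$-module with endpoint $0$, let $Y$ be the span of the irreducible $T$-modules with endpoint $1$, let $U$ be the orthogonal complement of $E_2^*V_0+E_2^*Y$ in $E_2^*V$, and for real $\eta$ let $U_\eta=\{v\in U: E_2^*A_2E_2^*v=\eta v\}$. Let $n\in\{1,d\}$ if $D$ is odd and $n=1$ if $D$ is even, and put $$\eta=\tilde\theta_n=-1-\frac{b_2b_3}{\theta_n^2-b_2}$$ (the denominator is nonzero). Then the following three numbers are equal: (i) $\mu_\eta$, the multiplicity with which a thin irreducible $T$-module $W$ with endpoint $2$ and local eigenvalue $\eta$ appears in $V$, that is, the number of summands isomorphic to $W$ in an orthogonal direct sum decomposition of $V$ into irreducible $T$-modules (with $\mu_\eta=0$ if no such $W$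 exists); (ii) $\dim U_\eta$; (iii) $\mathrm{mult}_\eta$, the number of times $\eta$ appears among $\eta_{k+1},\ldots,\eta_{k_2}$. -/

import Mathlib

noncomputable section

namespace Subconstituent

open Matrix

variable {X : Type*} [Fintype X] [DecidableEq X]

/-- `G` is distance-regular with intersection numbers `p h i j` (usually written `p^h_{ij}`), for
`0 ≤ h, i, j ≤ D`, where `D` is the diameter: it is connected, and for all vertices `x, y` at
distance `h` there are exactly `p h i j` vertices `z` with `∂(x,z) = i` and `∂(z,y) = j`. -/
structure IsDistanceRegularWith (G : SimpleGraph X) (p : ℕ → ℕ → ℕ → ℕ) : Prop where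
  connected : G.Connected
  card_eq : ∀ h i j : ℕ, h ≤ G.diam → i ≤ G.diam → j ≤ G.diam → ∀ x y : X, G.dist x y = h →
    (Finset.univ.filter fun z : X => G.dist x z = i ∧ G.dist z y = j).card = p h i j

/-- The distance matrix `A_i`, with entries in `R`. -/
def distMatrix (R : Type*) [Zero R] [One R] (G : SimpleGraph X) (i : ℕ) : Matrix X X R :=
  Matrix.of fun y z => if G.dist y z = i then 1 else 0

/-- The distinct eigenvalues of the adjacency matrix `A = A_1`, in decreasing order:
`eigenvalue G i` is `θ_i`, where `θ_0 > θ_1 > ⋯`. The value `0` is used for `i` out of range. -/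
def eigenvalue (G : SimpleGraph X) (i : ℕ) : ℝ :=
  ((distMatrix ℝ G 1).charpoly.roots.toFinset.sort (· ≥ ·)).getD i 0

/-- The scalar `-1 - b₂ b₃ / (z² - b₂)`, where `b_i = p^i_{1,i+1}`, for `z² ≠ b₂`. -/
def tilde (p : ℕ → ℕ → ℕ → ℕ) (z : ℝ) : ℝ :=
  -1 - (p 2 1 3 : ℝ) * (p 3 1 4 : ℝ) / (z ^ 2 - (p 2 1 3 : ℝ))

/-- The dual idempotent `E*_i` with respect to `x`. -/
def dualIdempotent (G : SimpleGraph X) (x : X) (i : ℕ) : Matrix X X ℂ :=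
  Matrix.diagonal fun y => if G.dist x y = i then 1 else 0

/-- The Bose-Mesner algebra `M`, generated by the adjacency matrix. -/
def boseMesner (G : SimpleGraph X) : Subalgebra ℂ (Matrix X X ℂ) :=
  Algebra.adjoin ℂ {distMatrix ℂ G 1}

/-- The dual Bose-Mesner algebra `M*`, generated by `E*_0, …, E*_D`. -/
def dualBoseMesner (G : SimpleGraph X) (x : X) : Subalgebra ℂ (Matrix X X ℂ) :=
  Algebra.adjoin ℂ {B | ∃ i ≤ G.diam, B = dualIdempotent G x i}

/-- The subconstituent (Terwilliger) algebra `T(x)`, generated by `M` and `M*`. -/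
def subconstituentAlgebra (G : SimpleGraph X) (x : X) : Subalgebra ℂ (Matrix X X ℂ) :=
  boseMesner G ⊔ dualBoseMesner G x

/-- The image `B W` of a subspace `W` of the standard module `ℂ^X` under a matrix `B`. -/
def image (B : Matrix X X ℂ) (W : Submodule ℂ (X → ℂ)) : Submodule ℂ (X → ℂ) :=
  W.map B.mulVecLin

/-- A `T`-module is a subspace `W` of the standard module with `B W ⊆ W` for all `B ∈ T`. -/
def IsTModule (G : SimpleGraph X) (x : X) (W : Submodule ℂ (X → ℂ)) : Prop :=
  ∀ B ∈ subconstituentAlgebra G x, ∀ w ∈ W, B *ᵥ w ∈ W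

/-- Irreducible `T`-modules. -/
def IsIrreducibleTModule (G : SimpleGraph X) (x : X) (W : Submodule ℂ (X → ℂ)) : Prop :=
  IsTModule G x W ∧ W ≠ ⊥ ∧ ∀ W' ≤ W, IsTModule G x W' → W' = ⊥ ∨ W' = W

/-- Isomorphism of `T`-modules: an isomorphism of vector spaces `σ : W → W'` such that
`σ (B w) = B (σ w)` for all `B ∈ T` and `w ∈ W`. -/
def TIsomorphic (G : SimpleGraph X) (x : X) (W W' : Submodule ℂ (X → ℂ)) : Prop :=
  ∃ σ : W ≃ₗ[ℂ] W', ∀ B ∈ subconstituentAlgebra G x, ∀ w w₁ : W,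
    (w₁ : X → ℂ) = B *ᵥ (w : X → ℂ) → (σ w₁ : X → ℂ) = B *ᵥ (σ w : X → ℂ)

/-- The endpoint of `W`: the least `i` with `0 ≤ i ≤ D` and `E*_i W ≠ 0`. -/
def endpoint (G : SimpleGraph X) (x : X) (W : Submodule ℂ (X → ℂ)) : ℕ :=
  sInf {i | i ≤ G.diam ∧ image (dualIdempotent G x i) W ≠ ⊥}

/-- `W` is thin: `dim E*_i W ≤ 1` for `0 ≤ i ≤ D`. -/
def IsThin (G : SimpleGraph X) (x : X) (W : Submodule ℂ (X → ℂ)) : Prop :=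
  ∀ i ≤ G.diam, Module.finrank ℂ (image (dualIdempotent G x i) W) ≤ 1

/-- The matrix `E*_2 A_2 E*_2`. -/
def localMatrix (G : SimpleGraph X) (x : X) : Matrix X X ℂ :=
  dualIdempotent G x 2 * distMatrix ℂ G 2 * dualIdempotent G x 2

/-- `W` is a thin irreducible `T`-module with endpoint 2 and local eigenvalue `η`, that is,
`E*_2 A_2 E*_2` acts on the one-dimensional space `E*_2 W` as the scalar `η`. -/
structure IsThinWithLocalEigenvalue (G : SimpleGraph X) (x : X) (η : ℝ)
    (W : Submodule ℂ (X → ℂ)) : Prop where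
  irreducible : IsIrreducibleTModule G x W
  thin : IsThin G x W
  endpoint_eq : endpoint G x W = 2
  local_eigenvalue : ∀ w ∈ image (dualIdempotent G x 2) W, localMatrix G x *ᵥ w = (η : ℂ) • w

/-- The Hermitian inner product on the standard module. -/
def hermitian (u v : X → ℂ) : ℂ := u ⬝ᵥ star v

/-- `W_1, …, W_m` are irreducible `T`-modules whose orthogonal direct sum is the standard
module. -/
structure IsOrthogonalDecomposition (G : SimpleGraph X) (x : X) {m : ℕ}
    (W : Fin m → Submodule ℂ (X → ℂ)) : Prop where
  irreducible : ∀ i, IsIrreducibleTModule G x (W i)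
  orthogonal : ∀ i j, i ≠ j → ∀ u ∈ W i, ∀ v ∈ W j, hermitian u v = 0
  direct_sum : DirectSum.IsInternal W

open Classical in
/-- `μ` is the multiplicity with which `W` appears in the standard module: the standard module is
an orthogonal direct sum of irreducible `T`-modules, and in every such decomposition exactly `μ`
of the summands are isomorphic to `W`. -/
def IsMultiplicity (G : SimpleGraph X) (x : X) (W : Submodule ℂ (X → ℂ)) (μ : ℕ) : Prop :=
  (∃ (m : ℕ) (Z : Fin m → Submodule ℂ (X → ℂ)), IsOrthogonalDecomposition G x Z) ∧
  ∀ (m : ℕ) (Z : Fin m → Submodule ℂ (X → ℂ)), IsOrthogonalDecomposition G x Z →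
    (Finset.univ.filter fun i => TIsomorphic G x (Z i) W).card = μ

/-- `μ` is the scalar `μ_η`: the multiplicity in the standard module of any thin irreducible
`T`-module with endpoint 2 and local eigenvalue `η`, and `0` if there is no such module. -/
def IsMu (G : SimpleGraph X) (x : X) (η : ℝ) (μ : ℕ) : Prop :=
  (∀ W, IsThinWithLocalEigenvalue G x η W → IsMultiplicity G x W μ) ∧
  ((¬ ∃ W, IsThinWithLocalEigenvalue G x η W) → μ = 0)

/-- The span of the irreducible `T`-modules with endpoint `i`. For `i = 0` there is only one such
module (for `G` distance-regular), and the span is that module `V_0`. -/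
def endpointSpan (G : SimpleGraph X) (x : X) (i : ℕ) : Submodule ℂ (X → ℂ) :=
  sSup {W | IsIrreducibleTModule G x W ∧ endpoint G x W = i}

/-- The space `U`: the orthogonal complement of `E*_2 V_0 + E*_2 Y` in `E*_2 V`, where `Y` is the
span of the irreducible `T`-modules with endpoint 1. -/
def spaceU (G : SimpleGraph X) (x : X) : Submodule ℂ (X → ℂ) where
  carrier := {v | v ∈ image (dualIdempotent G x 2) ⊤ ∧
    ∀ w ∈ image (dualIdempotent G x 2) (endpointSpan G x 0) ⊔
      image (dualIdempotent G x 2) (endpointSpan G x 1), hermitian v w = 0}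
  add_mem' := by
    rintro u v ⟨hu, hu'⟩ ⟨hv, hv'⟩
    refine ⟨add_mem hu hv, fun w hw => ?_⟩
    have h1 : u ⬝ᵥ star w = 0 := hu' w hw
    have h2 : v ⬝ᵥ star w = 0 := hv' w hw
    simp [hermitian, add_dotProduct, h1, h2]
  zero_mem' := ⟨zero_mem _, fun w _ => by simp [hermitian]⟩
  smul_mem' := by
    rintro c v ⟨hv, hv'⟩
    refine ⟨Submodule.smul_mem _ c hv, fun w hw => ?_⟩
    have h1 : v ⬝ᵥ star w = 0 := hv' w hw
    simp [hermitian, smul_dotProduct, h1]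

/-- The space `U_η` of all `v ∈ U` with `E*_2 A_2 E*_2 v = η v`. -/
def eigenspaceU (G : SimpleGraph X) (x : X) (η : ℝ) : Submodule ℂ (X → ℂ) :=
  spaceU G x ⊓ Module.End.eigenspace (localMatrix G x).mulVecLin (η : ℂ)

/-- The graph `Γ_2^2(x)`: the vertices are the `y` with `∂(x,y) = 2`, and `y, z` are adjacent
when `∂(y,z) = 2`. -/
def localGraph (G : SimpleGraph X) (x : X) : SimpleGraph {y : X // G.dist x y = 2} where
  Adj y z := G.dist (y : X) (z : X) = 2
  symm := ⟨fun y z h => by rw [SimpleGraph.dist_comm]; exact h⟩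
  loopless := ⟨fun y h => by simp at h⟩

open Classical in
/-- The multiset of eigenvalues of the adjacency matrix of `Γ_2^2(x)`, with multiplicities. -/
def localSpectrum (G : SimpleGraph X) (x : X) : Multiset ℝ :=
  ((localGraph G x).adjMatrix ℝ).charpoly.roots

/-- `e 1, …, e k₂` lists the local eigenvalues in such a way that `e 1 = p^2_{22}` and
`e i = b₃ - 1` for `2 ≤ i ≤ k`. Here `k = p^0_{11}`, `k₂ = p^0_{22}` and `b₃ = p^3_{14}`. -/
structure IsLocalOrdering (G : SimpleGraph X) (x : X) (p : ℕ → ℕ → ℕ → ℕ) (e : ℕ → ℝ) : Prop where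
  eigenvalues : (Finset.Icc 1 (p 0 2 2)).val.map e = localSpectrum G x
  first : e 1 = (p 2 2 2 : ℝ)
  second : ∀ i, 2 ≤ i → i ≤ p 0 1 1 → e i = (p 3 1 4 : ℝ) - 1

/-- `m` is `mult_η`: orderings `η_1, …, η_{k₂}` of the local eigenvalues as above exist, and in
each of them `η` appears exactly `m` times among `η_{k+1}, …, η_{k₂}`. -/
def IsMult (G : SimpleGraph X) (x : X) (p : ℕ → ℕ → ℕ → ℕ) (η : ℝ) (m : ℕ) : Prop :=
  (∃ e, IsLocalOrdering G x p e) ∧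
  ∀ e, IsLocalOrdering G x p e →
    ((Finset.Icc (p 0 1 1 + 1) (p 0 2 2)).filter fun i => e i = η).card = m

end Subconstituent

end

/-!
Let `u` be the cosine sequence of `θ_n` and let `F` be the matrix with entries `u (∂ y z)`. It is a
polynomial in `A`, and `F²` is a multiple of `F`. A vector `v` of `U_η` lives on the second layer
and has `E*_1 A v = 0`; since `1 + η u 2 - (1 + η) u 4 = 0` for `η = tilde θ_n`, also `F v` vanishes
on the second layer. So `⟨v, F v⟩ = 0`, whence `F v = 0`. Together with `∑ y, v y = 0` this relates,
at each vertex `y`, the sums of `v` over the vertices of the second layer at the possible distances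
from `y`, and makes the layer components of the module generated by `v` at most one-dimensional.
The relation can be solved because `u j ≠ u (j + 2)`, which holds since `θ_n ^ 2` is extremal among
the squares of the eigenvalues. So every nonzero `v` in `U_η` generates a thin irreducible module
with endpoint `2`, and an orthogonal decomposition of `V` has `dim U_η` summands of this kind.

The map `E*_1 A` takes the `η`-eigenspace of `E*_2 A_2 E*_2` on `E*_2 V` to `E*_1 V`, with kernel
`U_η`. The image contains the constants exactly when `η = p²₂₂` and the vectors of sum zero exactly
when `η = b₃ - 1`, and it is spanned by these: they account for `η_1, …, η_k`.
-/

noncomputable section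

namespace Subconstituent

open Matrix
open scoped Finset

/-! ### Distances and intersection numbers -/

section Distance

variable {X : Type*} {G : SimpleGraph X} {p : ℕ → ℕ → ℕ → ℕ}

lemma even_dist_add_dist_add_dist (hc : G.Connected) (hbip : G.IsBipartite) (x y z : X) :
    Even (G.dist x y + G.dist y z + G.dist x z) := by
  let C : G.Coloring Bool := SimpleGraph.Colorable.toColoring hbip (by simp)
  have even_dist_iff (u v : X) : Even (G.dist u v) ↔ (C u ↔ C v) := by
    obtain ⟨q, hq⟩ := hc.exists_walk_length_eq_dist u v
    rw [← hq]
    exact C.even_length_iff_congr q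
  rw [Nat.even_add, Nat.even_add, even_dist_iff, even_dist_iff, even_dist_iff]
  tauto

lemma dist_le_diam [Finite X] (hc : G.Connected) (x y : X) : G.dist x y ≤ G.diam := by
  have := hc.nonempty
  exact SimpleGraph.dist_le_diam (SimpleGraph.connected_iff_ediam_ne_top.1 hc)

lemma dist_eq_succ_or_succ_eq_of_dist_eq_one (hc : G.Connected) (hbip : G.IsBipartite) {y w : X}
    (h : G.dist y w = 1) (z : X) :
    G.dist w z = G.dist y z + 1 ∨ G.dist w z + 1 = G.dist y z := by
  have hparity := even_dist_add_dist_add_dist hc hbip y w z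
  have hyz := hc.dist_triangle (u := y) (v := w) (w := z)
  have hwz := hc.dist_triangle (u := w) (v := y) (w := z)
  rw [SimpleGraph.dist_comm (u := w) (v := y)] at hwz
  rw [h] at *
  obtain ⟨r, hr⟩ := hparity
  omega

lemma exists_dist_eq_one_and_dist_eq (hc : G.Connected) {y z : X} {h : ℕ}
    (hyz : G.dist y z = h + 1) : ∃ w, G.dist y w = 1 ∧ G.dist w z = h := by
  obtain ⟨q, hq⟩ := hc.exists_walk_length_eq_dist y z
  cases q with
  | nil => simp at hyz
  | @cons _ w _ hadj q =>
    have hyw := SimpleGraph.dist_eq_one_iff_adj.2 hadj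
    refine ⟨w, hyw, ?_⟩
    have hle := SimpleGraph.dist_le q
    have htri := hc.dist_triangle (u := y) (v := w) (w := z)
    rw [SimpleGraph.Walk.length_cons] at hq
    omega

lemma exists_pair_dist_eq [Finite X] (hc : G.Connected) {h : ℕ} (hh : h ≤ G.diam) :
    ∃ y z : X, G.dist y z = h := by
  have := hc.nonempty
  induction hh using Nat.decreasingInduction with
  | self => exact G.exists_dist_eq_diam
  | of_succ h _ ih =>
    obtain ⟨y, z, hyz⟩ := ih
    obtain ⟨w, -, hw⟩ := exists_dist_eq_one_and_dist_eq hc hyz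
    exact ⟨w, z, hw⟩

/-- The intersection number `b_i = p^i_{1,i+1}`, extended by `b_i = 0` for `i ≥ D`. -/
def bNum (G : SimpleGraph X) (p : ℕ → ℕ → ℕ → ℕ) (i : ℕ) : ℕ :=
  if i < G.diam then p i 1 (i + 1) else 0

/-- The intersection number `c_i = p^i_{1,i-1}`, extended by `c_0 = 0` and `c_i = 0` for
`i > D`. -/
def cNum (G : SimpleGraph X) (p : ℕ → ℕ → ℕ → ℕ) (i : ℕ) : ℕ :=
  if 1 ≤ i ∧ i ≤ G.diam then p i 1 (i - 1) else 0

lemma cNum_zero : cNum G p 0 = 0 := by simp [cNum]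

lemma cNum_eq_zero_of_diam_lt {i : ℕ} (hi : G.diam < i) : cNum G p i = 0 :=
  if_neg fun h => by omega

lemma bNum_eq_zero_of_diam_le {i : ℕ} (hi : G.diam ≤ i) : bNum G p i = 0 :=
  if_neg (by omega)

variable [Fintype X]

lemma exists_dist_eq (hG : IsDistanceRegularWith G p) (x : X) {h : ℕ} (hh : h ≤ G.diam) :
    ∃ y, G.dist x y = h := by
  obtain ⟨y, z, hyz⟩ := exists_pair_dist_eq hG.connected hh
  have hy := hG.card_eq 0 h h (Nat.zero_le _) hh hh y y (by simp)
  have hx := hG.card_eq 0 h h (Nat.zero_le _) hh hh x x (by simp)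
  have hpos : 0 < p 0 h h := by
    rw [← hy]
    exact Finset.card_pos.2 ⟨z, by simp [hyz, G.dist_comm (u := z)]⟩
  rw [← hx] at hpos
  obtain ⟨w, hw⟩ := Finset.card_pos.1 hpos
  exact ⟨w, (Finset.mem_filter.1 hw).2.1⟩

lemma card_dist_eq (hG : IsDistanceRegularWith G p) {h : ℕ} (hh : h ≤ G.diam) (y : X) :
    #{w | G.dist y w = h} = p 0 h h := by
  rw [← hG.card_eq 0 h h (Nat.zero_le _) hh hh y y (by simp)]
  congr 1
  ext w
  simp [G.dist_comm (u := w)]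

lemma card_neighbors_farther (hG : IsDistanceRegularWith G p) (y z : X) :
    #{w | G.dist y w = 1 ∧ G.dist w z = G.dist y z + 1} = bNum G p (G.dist y z) := by
  unfold bNum
  split_ifs with h
  · exact hG.card_eq _ _ _ h.le (by omega) h y z rfl
  · rw [Finset.card_eq_zero, Finset.filter_eq_empty_iff]
    rintro w - ⟨-, hw⟩
    have := dist_le_diam hG.connected w z
    omega

lemma card_neighbors_closer (hG : IsDistanceRegularWith G p) (y z : X) :
    #{w | G.dist y w = 1 ∧ G.dist w z + 1 = G.dist y z} = cNum G p (G.dist y z) := by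
  have hd := dist_le_diam hG.connected y z
  unfold cNum
  split_ifs with h
  · rw [← hG.card_eq _ _ _ h.2 (by omega) ((Nat.sub_le _ _).trans hd) y z rfl]
    congr 1
    ext w
    simp only [Finset.mem_filter, Finset.mem_univ, true_and]
    omega
  · rw [Finset.card_eq_zero, Finset.filter_eq_empty_iff]
    rintro w - ⟨-, hw⟩
    omega

lemma bNum_pos (hG : IsDistanceRegularWith G p) {i : ℕ} (hi : i < G.diam) : 0 < bNum G p i := by
  obtain ⟨z, w, hw⟩ := exists_pair_dist_eq hG.connected (h := i + 1) hi
  obtain ⟨y, hy, hyw⟩ := exists_dist_eq_one_and_dist_eq hG.connected hw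
  rw [← hyw, ← card_neighbors_farther hG]
  refine Finset.card_pos.2 ⟨z, ?_⟩
  simp only [Finset.mem_filter, Finset.mem_univ, true_and]
  rw [G.dist_comm (u := y) (v := z)]
  exact ⟨hy, by omega⟩

lemma cNum_succ_pos (hG : IsDistanceRegularWith G p) {i : ℕ} (hi : i < G.diam) :
    0 < cNum G p (i + 1) := by
  obtain ⟨z, w, hw⟩ := exists_pair_dist_eq hG.connected (h := i + 1) hi
  obtain ⟨y, hy, hyw⟩ := exists_dist_eq_one_and_dist_eq hG.connected hw
  rw [← hw, ← card_neighbors_closer hG]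
  refine Finset.card_pos.2 ⟨y, ?_⟩
  simp only [Finset.mem_filter, Finset.mem_univ, true_and]
  exact ⟨hy, by omega⟩

lemma cNum_one (hG : IsDistanceRegularWith G p) (hD : 1 ≤ G.diam) : cNum G p 1 = 1 := by
  obtain ⟨y, z, hyz⟩ := exists_pair_dist_eq hG.connected hD
  have hcard := card_neighbors_closer hG y z
  rw [hyz] at hcard
  rw [← hcard, Finset.card_eq_one]
  refine ⟨z, ?_⟩
  ext w
  simp only [Finset.mem_filter, Finset.mem_univ, true_and, Finset.mem_singleton]
  constructor
  · rintro ⟨-, h⟩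
    exact hG.connected.dist_eq_zero_iff.1 (by omega)
  · rintro rfl
    exact ⟨hyz, by simp⟩

end Distance

/-! ### Functions of the distance -/

section Radial

variable {X R : Type*} {G : SimpleGraph X} {p : ℕ → ℕ → ℕ → ℕ}

/-- The matrix whose `(y, z)` entry is `g (∂(y, z))`. -/
def radial (G : SimpleGraph X) (g : ℕ → R) : Matrix X X R :=
  Matrix.of fun y z => g (G.dist y z)

lemma radial_apply (g : ℕ → R) (y z : X) : radial G g y z = g (G.dist y z) := rfl

lemma distMatrix_eq_radial [Zero R] [One R] (i : ℕ) :
    distMatrix R G i = radial G (fun j => if j = i then 1 else 0) := rfl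

variable [CommSemiring R]

/-- The linear map sending `g` to the vector whose value at `y` is `g (∂(x, y))`. -/
def sphericalMap (R : Type*) [CommSemiring R] (G : SimpleGraph X) (x : X) :
    (ℕ → R) →ₗ[R] (X → R) :=
  LinearMap.funLeft R R (G.dist x)

lemma sphericalMap_apply (x : X) (g : ℕ → R) (y : X) :
    sphericalMap R G x g y = g (G.dist x y) := rfl

/-- If a function on `X` is given by `g` in terms of the distance to a fixed vertex, then its sum
over the neighbours of a vertex at distance `i` is `neighborSum G p g i`. -/
def neighborSum (G : SimpleGraph X) (p : ℕ → ℕ → ℕ → ℕ) : (ℕ → R) →ₗ[R] (ℕ → R) where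
  toFun g i := cNum G p i * g (i - 1) + bNum G p i * g (i + 1)
  map_add' f g := by
    ext i
    simp only [Pi.add_apply]
    ring
  map_smul' a g := by
    ext i
    simp only [Pi.smul_apply, smul_eq_mul, RingHom.id_apply]
    ring

lemma neighborSum_apply (g : ℕ → R) (i : ℕ) :
    neighborSum G p g i = cNum G p i * g (i - 1) + bNum G p i * g (i + 1) := rfl

lemma neighborSum_congr {f g : ℕ → R} (h : ∀ i ≤ G.diam, f i = g i) :
    neighborSum G p f = neighborSum G p g := by
  ext i
  rw [neighborSum_apply, neighborSum_apply]
  congr 1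
  · by_cases hi : i ≤ G.diam
    · rw [h _ (by omega)]
    · simp [cNum_eq_zero_of_diam_lt (lt_of_not_ge hi)]
  · by_cases hi : i < G.diam
    · rw [h _ hi]
    · simp [bNum_eq_zero_of_diam_le (le_of_not_gt hi)]

variable [Fintype X]

lemma distMatrix_mulVec_apply (i : ℕ) (v : X → R) (y : X) :
    (distMatrix R G i *ᵥ v) y = ∑ z with G.dist y z = i, v z := by
  simp [mulVec, dotProduct, distMatrix, Finset.sum_filter]

lemma sum_neighbors_eq_add (hc : G.Connected) (hbip : G.IsBipartite) (f : X → R) (y z : X) :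
    ∑ w with G.dist y w = 1, f w =
      ∑ w with G.dist y w = 1 ∧ G.dist w z + 1 = G.dist y z, f w +
        ∑ w with G.dist y w = 1 ∧ G.dist w z = G.dist y z + 1, f w := by
  rw [← Finset.sum_filter_add_sum_filter_not _ (fun w => G.dist w z + 1 = G.dist y z),
    Finset.filter_filter, Finset.filter_filter]
  have hfarther : ({w | G.dist y w = 1 ∧ ¬ G.dist w z + 1 = G.dist y z} : Finset X) =
      ({w | G.dist y w = 1 ∧ G.dist w z = G.dist y z + 1} : Finset X) := by
    refine Finset.filter_congr fun w _ => and_congr_right fun h => ?_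
    rcases dist_eq_succ_or_succ_eq_of_dist_eq_one hc hbip h z with h' | h' <;> omega
  rw [hfarther]

lemma sum_neighbors (hG : IsDistanceRegularWith G p) (hbip : G.IsBipartite) (g : ℕ → R) (y z : X) :
    ∑ w with G.dist y w = 1, g (G.dist w z) = neighborSum G p g (G.dist y z) := by
  rw [sum_neighbors_eq_add hG.connected hbip _ y z, neighborSum_apply,
    ← card_neighbors_farther hG, ← card_neighbors_closer hG, ← nsmul_eq_mul, ← nsmul_eq_mul]
  congr 1 <;> refine Finset.sum_eq_card_nsmul fun w hw => congrArg g ?_ <;>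
    have := (Finset.mem_filter.1 hw).2.2 <;> omega

lemma distMatrix_one_mul_radial (hG : IsDistanceRegularWith G p) (hbip : G.IsBipartite)
    (g : ℕ → R) : distMatrix R G 1 * radial G g = radial G (neighborSum G p g) := by
  ext y z
  rw [radial_apply, ← sum_neighbors hG hbip, mul_apply, Finset.sum_filter]
  simp [distMatrix, radial_apply]

lemma distMatrix_one_mulVec_sphericalMap (hG : IsDistanceRegularWith G p) (hbip : G.IsBipartite)
    (x : X) (g : ℕ → R) :
    distMatrix R G 1 *ᵥ sphericalMap R G x g = sphericalMap R G x (neighborSum G p g) := by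
  ext y
  rw [distMatrix_mulVec_apply, sphericalMap_apply, G.dist_comm (u := x), ← sum_neighbors hG hbip]
  exact Finset.sum_congr rfl fun w _ => by rw [sphericalMap_apply, G.dist_comm]

lemma bNum_add_cNum (hG : IsDistanceRegularWith G p) (hbip : G.IsBipartite) (hD : 1 ≤ G.diam)
    {i : ℕ} (hi : i ≤ G.diam) : cNum G p i + bNum G p i = p 0 1 1 := by
  obtain ⟨y, z, rfl⟩ := exists_pair_dist_eq hG.connected hi
  have hsum := sum_neighbors (R := ℕ) hG hbip (fun _ => 1) y z
  rw [neighborSum_apply, Finset.sum_const, card_dist_eq hG hD] at hsum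
  simpa using hsum.symm

end Radial

/-! ### Real symmetric matrices -/

section Symmetric

open Polynomial

variable {X : Type*} [Fintype X]

lemma mulVec_dotProduct_of_isSymm {R : Type*} [CommSemiring R] {A : Matrix X X R} (hA : A.IsSymm)
    (f g : X → R) : (A *ᵥ f) ⬝ᵥ g = f ⬝ᵥ (A *ᵥ g) := by
  rw [dotProduct_mulVec, ← mulVec_transpose, hA.eq]

variable [DecidableEq X]

lemma aeval_mulVec_of_mulVec_eq_smul {R : Type*} [CommRing R] {A : Matrix X X R} {w : X → R} {s : R}
    (h : A *ᵥ w = s • w) (q : R[X]) : aeval A q *ᵥ w = q.eval s • w := by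
  induction q using Polynomial.induction_on' with
  | add f g hf hg => simp [add_mulVec, hf, hg, add_smul]
  | monomial n a =>
    have hpow : A ^ n *ᵥ w = s ^ n • w := by
      induction n with
      | zero => simp
      | succ n ih => rw [pow_succ, ← mulVec_mulVec, h, mulVec_smul, ih, smul_smul, pow_succ']
    rw [aeval_monomial, ← mulVec_mulVec, hpow, Algebra.algebraMap_eq_smul_one, smul_mulVec,
      one_mulVec, smul_smul, eval_monomial]

variable {A : Matrix X X ℝ}

lemma eigenvectorBasis_ne_zero (hA : A.IsHermitian) (j : X) :
    (⇑(hA.eigenvectorBasis j) : X → ℝ) ≠ 0 := fun h =>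
  hA.eigenvectorBasis.orthonormal.ne_zero j (by ext i; exact congrFun h i)

lemma dotProduct_self_eq_sum_eigenvectorBasis (hA : A.IsHermitian) (f : X → ℝ) :
    f ⬝ᵥ f = ∑ j, (⇑(hA.eigenvectorBasis j) ⬝ᵥ f) ^ 2 := by
  have hparseval := hA.eigenvectorBasis.sum_sq_norm_inner_right (WithLp.toLp 2 f)
  have hinner (j : X) : inner ℝ (hA.eigenvectorBasis j) (WithLp.toLp 2 f) =
      ⇑(hA.eigenvectorBasis j) ⬝ᵥ f := by
    simp [PiLp.inner_apply, dotProduct, mul_comm]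
  simp only [hinner, EuclideanSpace.norm_sq_eq, Real.norm_eq_abs, sq_abs] at hparseval
  rw [hparseval]
  simp [dotProduct, sq]

lemma mulVec_dotProduct_self_eq_sum_eigenvectorBasis (hA : A.IsHermitian) (f : X → ℝ) :
    (A *ᵥ f) ⬝ᵥ (A *ᵥ f) =
      ∑ j, hA.eigenvalues j ^ 2 * (⇑(hA.eigenvectorBasis j) ⬝ᵥ f) ^ 2 := by
  have hsymm : A.IsSymm := by simpa using! hA
  simp only [dotProduct_self_eq_sum_eigenvectorBasis hA (A *ᵥ f),
    ← mulVec_dotProduct_of_isSymm hsymm, hA.mulVec_eigenvectorBasis, smul_dotProduct, smul_eq_mul,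
    mul_pow]

lemma aeval_eq_zero_of_forall_eigenvalue_isRoot (hA : A.IsHermitian) {q : ℝ[X]}
    (hq : ∀ s, ∀ w : X → ℝ, w ≠ 0 → A *ᵥ w = s • w → q.IsRoot s) : aeval A q = 0 := by
  have hbasis (j : X) : aeval A q *ᵥ ⇑(hA.eigenvectorBasis j) = 0 := by
    rw [aeval_mulVec_of_mulVec_eq_smul (hA.mulVec_eigenvectorBasis j),
      hq _ _ (eigenvectorBasis_ne_zero hA j) (hA.mulVec_eigenvectorBasis j), zero_smul]
  ext y z
  have hrow : (aeval A q) y ⬝ᵥ (aeval A q) y = 0 := by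
    rw [dotProduct_self_eq_sum_eigenvectorBasis hA]
    refine Finset.sum_eq_zero fun j _ => ?_
    rw [dotProduct_comm, sq_eq_zero_iff]
    exact congrFun (hbasis j) y
  exact congrFun (dotProduct_self_eq_zero.1 hrow) z

end Symmetric

section Rayleigh

variable {X : Type*} [Fintype X] {A : Matrix X X ℝ}

lemma mulVec_dotProduct_self_le (hA : A.IsHermitian) {t : ℝ} {f : X → ℝ}
    (ht : ∀ s, ∀ w : X → ℝ, A *ᵥ w = s • w → w ⬝ᵥ f ≠ 0 → s ^ 2 ≤ t ^ 2) :
    (A *ᵥ f) ⬝ᵥ (A *ᵥ f) ≤ t ^ 2 * (f ⬝ᵥ f) := by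
  classical
  rw [mulVec_dotProduct_self_eq_sum_eigenvectorBasis hA,
    dotProduct_self_eq_sum_eigenvectorBasis hA f, Finset.mul_sum]
  refine Finset.sum_le_sum fun j _ => ?_
  by_cases hj : ⇑(hA.eigenvectorBasis j) ⬝ᵥ f = 0
  · simp [hj]
  · exact mul_le_mul_of_nonneg_right (ht _ _ (hA.mulVec_eigenvectorBasis j) hj) (sq_nonneg _)

lemma le_mulVec_dotProduct_self (hA : A.IsHermitian) {t : ℝ}
    (ht : ∀ s, ∀ w : X → ℝ, w ≠ 0 → A *ᵥ w = s • w → t ^ 2 ≤ s ^ 2) (f : X → ℝ) :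
    t ^ 2 * (f ⬝ᵥ f) ≤ (A *ᵥ f) ⬝ᵥ (A *ᵥ f) := by
  classical
  rw [mulVec_dotProduct_self_eq_sum_eigenvectorBasis hA,
    dotProduct_self_eq_sum_eigenvectorBasis hA f, Finset.mul_sum]
  exact Finset.sum_le_sum fun j _ => mul_le_mul_of_nonneg_right
    (ht _ _ (eigenvectorBasis_ne_zero hA j) (hA.mulVec_eigenvectorBasis j)) (sq_nonneg _)

end Rayleigh

/-! ### Eigenvalues and cosine sequences -/

section Spectrum

open Polynomial

variable {X : Type*} {G : SimpleGraph X} {p : ℕ → ℕ → ℕ → ℕ}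

lemma distMatrix_isSymm {R : Type*} [Zero R] [One R] (i : ℕ) : (distMatrix R G i).IsSymm := by
  ext y z
  simp [distMatrix, G.dist_comm (u := z)]

lemma distMatrix_zero [DecidableEq X] {R : Type*} [Zero R] [One R] (hc : G.Connected) :
    distMatrix R G 0 = 1 := by
  ext y z
  simp [distMatrix, hc.dist_eq_zero_iff, one_apply]

lemma distMatrix_isHermitian (i : ℕ) : (distMatrix ℝ G i).IsHermitian := by
  simpa using! distMatrix_isSymm i

/-- `u` is the cosine sequence of `θ`: the entries of the vector `u (∂(x, ·))` add up, over the
neighbours of a vertex, to `θ` times its entry there, and `u 0 = 1`. -/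
structure IsCosine (G : SimpleGraph X) (p : ℕ → ℕ → ℕ → ℕ) (θ : ℝ) (u : ℕ → ℝ) : Prop where
  zero : u 0 = 1
  neighborSum_eq : ∀ i ≤ G.diam, neighborSum G p u i = θ * u i

lemma IsCosine.neighborSum_neighborSum_eq {θ : ℝ} {u : ℕ → ℝ} (hu : IsCosine G p θ u)
    {i : ℕ} (hi : i ≤ G.diam) :
    neighborSum G p (neighborSum G p u) i = θ ^ 2 * u i := by
  rw [neighborSum_congr (g := θ • u) hu.neighborSum_eq, map_smul, Pi.smul_apply,
    hu.neighborSum_eq i hi, smul_eq_mul, sq, mul_assoc]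

lemma finrank_range_sphericalMap_le [Finite X] (hc : G.Connected) (x : X) :
    Module.finrank ℝ (LinearMap.range (sphericalMap ℝ G x)) ≤ G.diam + 1 := by
  let q : X → Fin (G.diam + 1) := fun y => ⟨G.dist x y, Nat.lt_succ_of_le (dist_le_diam hc x y)⟩
  have hle : LinearMap.range (sphericalMap ℝ G x) ≤ LinearMap.range (LinearMap.funLeft ℝ ℝ q) := by
    rintro _ ⟨g, rfl⟩
    exact ⟨fun i => g i, rfl⟩
  calc Module.finrank ℝ (LinearMap.range (sphericalMap ℝ G x))
      ≤ Module.finrank ℝ (LinearMap.range (LinearMap.funLeft ℝ ℝ q)) :=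
        Submodule.finrank_mono hle
    _ ≤ Module.finrank ℝ (Fin (G.diam + 1) → ℝ) := LinearMap.finrank_range_le _
    _ = G.diam + 1 := by simp

variable [Fintype X]

lemma eq_zero_of_neighborSum_eq (hG : IsDistanceRegularWith G p) {θ : ℝ} {g : ℕ → ℝ} (h0 : g 0 = 0)
    (h : ∀ i ≤ G.diam, neighborSum G p g i = θ * g i) : ∀ i ≤ G.diam, g i = 0 := by
  intro i
  induction i using Nat.strong_induction_on with
  | _ i ih =>
    intro hi
    rcases i with _ | i
    · exact h0
    have hrec := h i (by omega)
    rw [neighborSum_apply, ih i (by omega) (by omega), ih (i - 1) (by omega) (by omega), mul_zero,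
      mul_zero, zero_add, mul_eq_zero, Nat.cast_eq_zero] at hrec
    exact hrec.resolve_left (bNum_pos hG hi).ne'

namespace IsCosine

variable {θ : ℝ} {u : ℕ → ℝ}

lemma distMatrix_one_mulVec (hu : IsCosine G p θ u) (hG : IsDistanceRegularWith G p)
    (hbip : G.IsBipartite) (x : X) :
    distMatrix ℝ G 1 *ᵥ sphericalMap ℝ G x u = θ • sphericalMap ℝ G x u := by
  rw [distMatrix_one_mulVec_sphericalMap hG hbip]
  ext y
  exact hu.neighborSum_eq _ (dist_le_diam hG.connected x y)

lemma not_both_zero (hu : IsCosine G p θ u) (hG : IsDistanceRegularWith G p) {j : ℕ}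
    (hj : j + 1 ≤ G.diam) : ¬ (u j = 0 ∧ u (j + 1) = 0) := by
  induction j with
  | zero => rintro ⟨h, -⟩; rw [hu.zero] at h; exact one_ne_zero h
  | succ j ih =>
    rintro ⟨h1, h2⟩
    refine ih (by omega) ⟨?_, h1⟩
    have hrec := hu.neighborSum_eq (j + 1) (by omega)
    rw [neighborSum_apply, h1, h2, mul_zero, mul_zero, add_zero, mul_eq_zero, Nat.cast_eq_zero,
      Nat.add_sub_cancel] at hrec
    exact hrec.resolve_left (cNum_succ_pos hG (by omega)).ne'

lemma apply_ne_zero_of_apply_add_two_eq (hu : IsCosine G p θ u) (hG : IsDistanceRegularWith G p)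
    (hθ : θ ≠ 0) {j : ℕ} (hj : j + 2 ≤ G.diam) (h : u j = u (j + 2)) :
    u j ≠ 0 := by
  intro h0
  have hrec := hu.neighborSum_eq (j + 1) (by omega)
  rw [neighborSum_apply, Nat.add_sub_cancel, ← h, h0, mul_zero, mul_zero, add_zero] at hrec
  exact hu.not_both_zero hG (by omega) ⟨h0, (mul_eq_zero.1 hrec.symm).resolve_left hθ⟩

end IsCosine

/-- Let `w` be an eigenvector with `w x ≠ 0`. The functional `⟨w, ·⟩` kills the range of `A - θ`,
but not the vector `e_x`, so `A - θ` is not onto, hence not injective, on the functions of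
`∂(x, ·)`. -/
lemma exists_sphericalMap_eigenvector (hG : IsDistanceRegularWith G p) (hbip : G.IsBipartite)
    {θ : ℝ} {w : X → ℝ} (hw : distMatrix ℝ G 1 *ᵥ w = θ • w) {x : X} (hx : w x ≠ 0) :
    ∃ g, sphericalMap ℝ G x g ≠ 0 ∧
      distMatrix ℝ G 1 *ᵥ sphericalMap ℝ G x g = θ • sphericalMap ℝ G x g := by
  classical
  let S := LinearMap.range (sphericalMap ℝ G x)
  let f : Module.End ℝ (X → ℝ) := (distMatrix ℝ G 1).mulVecLin - θ • 1
  have hf (v : X → ℝ) : f v = distMatrix ℝ G 1 *ᵥ v - θ • v := rfl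
  have hfS : ∀ v ∈ S, f v ∈ S := by
    rintro _ ⟨g, rfl⟩
    exact ⟨neighborSum G p g - θ • g, by
      rw [hf, map_sub, map_smul, distMatrix_one_mulVec_sphericalMap hG hbip]⟩
  have hnot_injective : ¬ Function.Injective (f.restrict hfS) := by
    intro hinj
    have he : (Pi.single x 1 : X → ℝ) ∈ S := ⟨Pi.single 0 1, by
      ext y
      simp [sphericalMap_apply, Pi.single_apply, hG.connected.dist_eq_zero_iff, eq_comm]⟩
    obtain ⟨v, hv⟩ := LinearMap.injective_iff_surjective.1 hinj ⟨_, he⟩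
    have hv' : f v = Pi.single x 1 := congrArg Subtype.val hv
    have horth : w ⬝ᵥ f v = 0 := by
      rw [hf, dotProduct_sub, ← mulVec_dotProduct_of_isSymm (distMatrix_isSymm 1), hw,
        smul_dotProduct, dotProduct_smul, sub_self]
    rw [hv', dotProduct_single_one] at horth
    exact hx horth
  rw [injective_iff_map_eq_zero] at hnot_injective
  push Not at hnot_injective
  obtain ⟨⟨_, g, rfl⟩, hfg, hg⟩ := hnot_injective
  exact ⟨g, fun h => hg (Subtype.ext h), sub_eq_zero.1 (congrArg Subtype.val hfg)⟩

variable [DecidableEq X]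

/-- The finite set of eigenvalues of the adjacency matrix. -/
def eigenvalueSet (G : SimpleGraph X) : Finset ℝ := (distMatrix ℝ G 1).charpoly.roots.toFinset

lemma mem_eigenvalueSet {s : ℝ} :
    s ∈ eigenvalueSet G ↔ ∃ w : X → ℝ, w ≠ 0 ∧ distMatrix ℝ G 1 *ᵥ w = s • w := by
  rw [eigenvalueSet, Multiset.mem_toFinset, mem_roots (charpoly_monic _).ne_zero, IsRoot.def,
    eval_charpoly, ← exists_mulVec_eq_zero_iff]
  refine exists_congr fun w => and_congr_right fun _ => ?_
  rw [sub_mulVec, sub_eq_zero, eq_comm, scalar_apply, ← smul_one_eq_diagonal, smul_mulVec,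
    one_mulVec]

lemma exists_isCosine (hG : IsDistanceRegularWith G p) (hbip : G.IsBipartite) {θ : ℝ}
    (hθ : θ ∈ eigenvalueSet G) : ∃ u, IsCosine G p θ u := by
  obtain ⟨w, hw, hw'⟩ := mem_eigenvalueSet.1 hθ
  obtain ⟨x, hx⟩ := Function.ne_iff.1 hw
  obtain ⟨g, hg, hg'⟩ := exists_sphericalMap_eigenvector hG hbip hw' hx
  have hrec : ∀ i ≤ G.diam, neighborSum G p g i = θ * g i := by
    intro i hi
    obtain ⟨y, rfl⟩ := exists_dist_eq hG x hi
    rw [distMatrix_one_mulVec_sphericalMap hG hbip] at hg'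
    exact congrFun hg' y
  have hg0 : g 0 ≠ 0 := fun h0 => hg <| by
    ext y
    exact eq_zero_of_neighborSum_eq hG h0 hrec _ (dist_le_diam hG.connected x y)
  refine ⟨(g 0)⁻¹ • g, by simp [hg0], fun i hi => ?_⟩
  rw [map_smul, Pi.smul_apply, Pi.smul_apply, hrec i hi, mul_smul_comm]

lemma card_eigenvalueSet_le (hG : IsDistanceRegularWith G p) (hbip : G.IsBipartite) :
    #(eigenvalueSet G) ≤ G.diam + 1 := by
  obtain ⟨x⟩ := hG.connected.nonempty
  choose! u hu using fun θ (hθ : θ ∈ eigenvalueSet G) => exists_isCosine hG hbip hθ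
  let v (θ : eigenvalueSet G) : X → ℝ := sphericalMap ℝ G x (u θ)
  have hv (θ : eigenvalueSet G) :
      Module.End.HasEigenvector (distMatrix ℝ G 1).mulVecLin (θ : ℝ) (v θ) := by
    refine ⟨Module.End.mem_eigenspace_iff.2 ((hu θ θ.2).distMatrix_one_mulVec hG hbip x), ?_⟩
    refine Function.ne_iff.2 ⟨x, ?_⟩
    simp [v, sphericalMap_apply, (hu θ θ.2).zero]
  have hli : LinearIndependent ℝ v :=
    Module.End.eigenvectors_linearIndependent' _ _ Subtype.val_injective v hv
  calc #(eigenvalueSet G) = Module.finrank ℝ (Submodule.span ℝ (Set.range v)) := by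
        rw [finrank_span_eq_card hli, Fintype.card_coe]
    _ ≤ Module.finrank ℝ (LinearMap.range (sphericalMap ℝ G x)) := by
        refine Submodule.finrank_mono (Submodule.span_le.2 ?_)
        rintro _ ⟨θ, rfl⟩
        exact ⟨u θ, rfl⟩
    _ ≤ G.diam + 1 := finrank_range_sphericalMap_le hG.connected x

/-- For vertices `y, z` at distance `n = deg q`, the `(y, z)` entry of `q(A)` counts the walks of
length `n` from `y` to `z`. -/
lemma aeval_distMatrix_one_ne_zero_of_monic (hc : G.Connected) {q : ℝ[X]} (hq : q.Monic)
    (hdeg : q.natDegree ≤ G.diam) : aeval (distMatrix ℝ G 1) q ≠ 0 := by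
  classical
  obtain ⟨y, z, hyz⟩ := exists_pair_dist_eq hc hdeg
  have hadj : distMatrix ℝ G 1 = G.adjMatrix ℝ := by
    ext a b
    simp [distMatrix, SimpleGraph.adjMatrix_apply, SimpleGraph.dist_eq_one_iff_adj]
  have hlower : ∀ i ∈ Finset.range q.natDegree, (q.coeff i • G.adjMatrix ℝ ^ i) y z = 0 := by
    intro i hi
    have hempty : IsEmpty {w : G.Walk y z | w.length = i} := by
      refine ⟨fun ⟨w, hw⟩ => ?_⟩
      have hlt : w.length < G.dist y z := by rw [hw, hyz]; exact Finset.mem_range.1 hi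
      exact hlt.not_ge (SimpleGraph.dist_le w)
    rw [Matrix.smul_apply, SimpleGraph.adjMatrix_pow_apply_eq_card_walk]
    simp
  intro h0
  have hentry := congrFun (congrFun h0 y) z
  rw [aeval_eq_sum_range, hadj, Matrix.sum_apply, Finset.sum_range_succ,
    Finset.sum_eq_zero hlower, zero_add, hq.coeff_natDegree, one_smul,
    SimpleGraph.adjMatrix_pow_apply_eq_card_walk, Matrix.zero_apply, Nat.cast_eq_zero,
    Fintype.card_eq_zero_iff] at hentry
  obtain ⟨w, hw⟩ := hc.exists_walk_length_eq_dist y z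
  exact hentry.false ⟨w, hw.trans hyz⟩

lemma card_eigenvalueSet (hG : IsDistanceRegularWith G p) (hbip : G.IsBipartite) :
    #(eigenvalueSet G) = G.diam + 1 := by
  refine le_antisymm (card_eigenvalueSet_le hG hbip) (not_lt.1 fun hlt => ?_)
  have hmonic : ∀ s ∈ eigenvalueSet G, (Polynomial.X - C s).Monic := fun s _ => monic_X_sub_C s
  refine aeval_distMatrix_one_ne_zero_of_monic hG.connected (monic_prod_of_monic _ _ hmonic) ?_
    (aeval_eq_zero_of_forall_eigenvalue_isRoot (distMatrix_isHermitian 1) fun s w hw h => ?_)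
  · rw [natDegree_prod_of_monic _ _ hmonic]
    simpa using Nat.lt_succ_iff.1 hlt
  · rw [IsRoot.def, eval_prod]
    exact Finset.prod_eq_zero (mem_eigenvalueSet.2 ⟨w, hw, h⟩) (by simp)

end Spectrum

section Valency

variable {X : Type*} {G : SimpleGraph X} {p : ℕ → ℕ → ℕ → ℕ}

/-- The vector with entry `1` at even distance and `-1` at odd distance from `x`. -/
def signVec (G : SimpleGraph X) (x y : X) : ℝ := (-1) ^ G.dist x y

lemma signVec_mul_self (x y : X) : signVec G x y * signVec G x y = 1 := by
  rw [signVec, ← mul_pow, neg_one_mul, neg_neg, one_pow]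

lemma signVec_ne_zero (x y : X) : signVec G x y ≠ 0 :=
  left_ne_zero_of_mul_eq_one (signVec_mul_self x y)

variable [Fintype X]

lemma distMatrix_one_mulVec_signVec_mul (hc : G.Connected) (hbip : G.IsBipartite) (x : X)
    (w : X → ℝ) :
    distMatrix ℝ G 1 *ᵥ (signVec G x * w) = -(signVec G x * (distMatrix ℝ G 1 *ᵥ w)) := by
  ext y
  rw [Pi.neg_apply, Pi.mul_apply, distMatrix_mulVec_apply, distMatrix_mulVec_apply, Finset.mul_sum,
    ← Finset.sum_neg_distrib]
  refine Finset.sum_congr rfl fun z hz => ?_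
  have hdist := dist_eq_succ_or_succ_eq_of_dist_eq_one hc hbip (Finset.mem_filter.1 hz).2 x
  rw [G.dist_comm (u := z), G.dist_comm (u := y)] at hdist
  have hsign : signVec G x z = -signVec G x y := by
    rcases hdist with h | h
    · rw [signVec, signVec, h, pow_succ, mul_neg_one]
    · rw [signVec, signVec, ← h, pow_succ, mul_neg_one, neg_neg]
  rw [Pi.mul_apply, hsign, neg_mul]

lemma distMatrix_one_mulVec_one (hG : IsDistanceRegularWith G p) (hD : 1 ≤ G.diam) :
    distMatrix ℝ G 1 *ᵥ (1 : X → ℝ) = (p 0 1 1 : ℝ) • (1 : X → ℝ) := by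
  ext y
  rw [distMatrix_mulVec_apply]
  simp [card_dist_eq hG hD]

lemma distMatrix_one_mulVec_signVec (hG : IsDistanceRegularWith G p) (hbip : G.IsBipartite)
    (hD : 1 ≤ G.diam) (x : X) :
    distMatrix ℝ G 1 *ᵥ signVec G x = -((p 0 1 1 : ℝ) • signVec G x) := by
  have h := distMatrix_one_mulVec_signVec_mul hG.connected hbip x 1
  rwa [distMatrix_one_mulVec_one hG hD, mul_one, mul_smul_comm, mul_one] at h

lemma lapMatrix_mulVec [DecidableEq X] [DecidableRel G.Adj] (hG : IsDistanceRegularWith G p)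
    (hD : 1 ≤ G.diam) (w : X → ℝ) :
    G.lapMatrix ℝ *ᵥ w = (p 0 1 1 : ℝ) • w - distMatrix ℝ G 1 *ᵥ w := by
  ext y
  have hnbr : G.neighborFinset y = ({z | G.dist y z = 1} : Finset X) := by
    ext z
    simp [SimpleGraph.dist_eq_one_iff_adj]
  rw [SimpleGraph.lapMatrix_mulVec_apply, Pi.sub_apply, distMatrix_mulVec_apply,
    ← SimpleGraph.card_neighborFinset_eq_degree, hnbr, card_dist_eq hG hD]
  simp

lemma apply_eq_apply_of_mulVec_eq_valency_smul (hG : IsDistanceRegularWith G p) (hD : 1 ≤ G.diam)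
    {w : X → ℝ} (hw : distMatrix ℝ G 1 *ᵥ w = (p 0 1 1 : ℝ) • w) (y z : X) : w y = w z := by
  classical
  refine (SimpleGraph.lapMatrix_mulVec_eq_zero_iff_forall_reachable G (x := w)).1 ?_ y z
    (hG.connected y z)
  rw [lapMatrix_mulVec hG hD, hw, sub_self]

lemma dotProduct_eq_zero_of_sq_eq_valency_sq (hG : IsDistanceRegularWith G p)
    (hbip : G.IsBipartite) (hD : 1 ≤ G.diam) {x : X} {f w : X → ℝ} {s : ℝ}
    (hone : 1 ⬝ᵥ f = 0) (hsign : signVec G x ⬝ᵥ f = 0)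
    (hw : distMatrix ℝ G 1 *ᵥ w = s • w) (hs : s ^ 2 = (p 0 1 1 : ℝ) ^ 2) : w ⬝ᵥ f = 0 := by
  rcases sq_eq_sq_iff_eq_or_eq_neg.1 hs with rfl | rfl
  · have hconst : w = w x • (1 : X → ℝ) := by
      ext y
      simpa using apply_eq_apply_of_mulVec_eq_valency_smul hG hD hw y x
    rw [hconst, smul_dotProduct, hone, smul_zero]
  · have hconst := apply_eq_apply_of_mulVec_eq_valency_smul hG hD (w := signVec G x * w) (by
      rw [distMatrix_one_mulVec_signVec_mul hG.connected hbip, hw, mul_smul_comm, neg_smul,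
        neg_neg])
    have hsign_smul : w = w x • signVec G x := by
      ext y
      have hy : signVec G x y * w y = w x := by simpa [signVec] using hconst y x
      rw [Pi.smul_apply, smul_eq_mul, ← hy, mul_right_comm, signVec_mul_self, one_mul]
    rw [hsign_smul, smul_dotProduct, hsign, smul_zero]

variable [DecidableEq X]

lemma neg_mem_eigenvalueSet (hc : G.Connected) (hbip : G.IsBipartite) {s : ℝ}
    (hs : s ∈ eigenvalueSet G) : -s ∈ eigenvalueSet G := by
  obtain ⟨x⟩ := hc.nonempty
  obtain ⟨w, hw, hw'⟩ := mem_eigenvalueSet.1 hs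
  refine mem_eigenvalueSet.2 ⟨signVec G x * w, fun h => hw ?_, ?_⟩
  · ext y
    exact (mul_eq_zero.1 (congrFun h y)).resolve_left (signVec_ne_zero x y)
  · rw [distMatrix_one_mulVec_signVec_mul hc hbip, hw', mul_smul_comm, neg_smul]

lemma le_valency_of_mem_eigenvalueSet (hG : IsDistanceRegularWith G p) (hD : 1 ≤ G.diam) {s : ℝ}
    (hs : s ∈ eigenvalueSet G) : s ≤ p 0 1 1 := by
  classical
  obtain ⟨w, hw, hw'⟩ := mem_eigenvalueSet.1 hs
  have hnonneg := (SimpleGraph.posSemidef_lapMatrix ℝ G).dotProduct_mulVec_nonneg w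
  rw [lapMatrix_mulVec hG hD, hw', ← sub_smul, dotProduct_smul, star_trivial, smul_eq_mul]
    at hnonneg
  have hpos : 0 < w ⬝ᵥ w := by simpa using dotProduct_star_self_pos_iff.2 hw
  exact sub_nonneg.1 (nonneg_of_mul_nonneg_left hnonneg hpos)

lemma valency_mem_eigenvalueSet (hG : IsDistanceRegularWith G p) (hD : 1 ≤ G.diam) :
    (p 0 1 1 : ℝ) ∈ eigenvalueSet G := by
  have := hG.connected.nonempty
  exact mem_eigenvalueSet.2 ⟨1, one_ne_zero, distMatrix_one_mulVec_one hG hD⟩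

end Valency

section Ordering

lemma getD_sort_mem (S : Finset ℝ) {i : ℕ} (hi : i < #S) : (S.sort (· ≥ ·)).getD i 0 ∈ S := by
  rw [← Finset.length_sort (· ≥ ·)] at hi
  rw [List.getD_eq_getElem _ _ hi, ← Finset.mem_sort (· ≥ ·)]
  exact List.getElem_mem hi

lemma card_filter_getD_sort_lt (S : Finset ℝ) {i : ℕ} (hi : i < #S) :
    #{s ∈ S | (S.sort (· ≥ ·)).getD i 0 < s} = i := by
  set l := S.sort (· ≥ ·) with hl
  rw [← Finset.length_sort (· ≥ ·), ← hl] at hi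
  have hanti : StrictAnti l.get := (Finset.sortedGT_sort S).strictAnti_get
  have himage : {s ∈ S | l.getD i 0 < s} = (Finset.Iio (⟨i, hi⟩ : Fin l.length)).image l.get := by
    ext s
    rw [List.getD_eq_getElem _ _ hi, Finset.mem_filter, ← Finset.mem_sort (· ≥ ·), ← hl,
      List.mem_iff_get, Finset.mem_image]
    constructor
    · rintro ⟨⟨a, rfl⟩, ha⟩
      exact ⟨a, Finset.mem_Iio.2 (hanti.lt_iff_gt.1 ha), rfl⟩
    · rintro ⟨a, ha, rfl⟩
      exact ⟨⟨a, rfl⟩, hanti (Finset.mem_Iio.1 ha)⟩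
  rw [himage, Finset.card_image_of_injective _ hanti.injective, Fin.card_Iio]

variable {X : Type*} [Fintype X] [DecidableEq X] {G : SimpleGraph X} {p : ℕ → ℕ → ℕ → ℕ}

lemma eigenvalue_mem (hG : IsDistanceRegularWith G p) (hbip : G.IsBipartite) {i : ℕ}
    (hi : i ≤ G.diam) : eigenvalue G i ∈ eigenvalueSet G :=
  getD_sort_mem (eigenvalueSet G) (by rw [card_eigenvalueSet hG hbip]; omega)

lemma card_filter_eigenvalue_lt (hG : IsDistanceRegularWith G p) (hbip : G.IsBipartite) {i : ℕ}
    (hi : i ≤ G.diam) : #{s ∈ eigenvalueSet G | eigenvalue G i < s} = i :=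
  card_filter_getD_sort_lt (eigenvalueSet G) (by rw [card_eigenvalueSet hG hbip]; omega)

/-- `s ↦ -s` pairs the positive eigenvalues with the negative ones, so the parity of `D` decides
whether `0` is an eigenvalue. -/
lemma diam_add_one_eq (hG : IsDistanceRegularWith G p) (hbip : G.IsBipartite) :
    G.diam + 1 = 2 * #{s ∈ eigenvalueSet G | 0 < s} + if 0 ∈ eigenvalueSet G then 1 else 0 := by
  have hneg : #{s ∈ eigenvalueSet G | s < 0} = #{s ∈ eigenvalueSet G | 0 < s} := by
    refine Finset.card_nbij' Neg.neg Neg.neg ?_ ?_ (fun s _ => neg_neg s) fun s _ => neg_neg s <;>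
      intro s hs <;> rw [Finset.mem_coe, Finset.mem_filter] at * <;>
      exact ⟨neg_mem_eigenvalueSet hG.connected hbip hs.1, by linarith [hs.2]⟩
  have hzero : #{s ∈ eigenvalueSet G | s = 0} = if 0 ∈ eigenvalueSet G then 1 else 0 := by
    rw [Finset.filter_eq']
    split_ifs <;> rfl
  have hnonneg : #{s ∈ eigenvalueSet G | ¬ s < 0} =
      #{s ∈ eigenvalueSet G | 0 < s} + #{s ∈ eigenvalueSet G | s = 0} := by
    rw [← Finset.card_union_of_disjoint, ← Finset.filter_or]
    · exact congrArg _ (Finset.filter_congr fun s _ => by rw [not_lt, le_iff_lt_or_eq, eq_comm])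
    · exact Finset.disjoint_filter.2 fun s _ h => h.ne'
  rw [← card_eigenvalueSet hG hbip, ← Finset.card_filter_add_card_filter_not (fun s => s < 0),
    hneg, hnonneg, hzero]
  ring

lemma card_filter_pos_eigenvalueSet (hG : IsDistanceRegularWith G p) (hbip : G.IsBipartite) :
    #{s ∈ eigenvalueSet G | 0 < s} = (G.diam + 1) / 2 := by
  have h := diam_add_one_eq hG hbip
  split_ifs at h <;> omega

lemma zero_notMem_eigenvalueSet (hG : IsDistanceRegularWith G p) (hbip : G.IsBipartite)
    (hodd : Odd G.diam) : (0 : ℝ) ∉ eigenvalueSet G := by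
  intro h0
  have h := diam_add_one_eq hG hbip
  rw [if_pos h0] at h
  obtain ⟨d, hd⟩ := hodd
  omega

lemma eigenvalue_pos (hG : IsDistanceRegularWith G p) (hbip : G.IsBipartite) {i : ℕ}
    (hi : i < (G.diam + 1) / 2) : 0 < eigenvalue G i := by
  by_contra! hle
  have hcard : #{s ∈ eigenvalueSet G | 0 < s} ≤ #{s ∈ eigenvalueSet G | eigenvalue G i < s} :=
    Finset.card_le_card (Finset.monotone_filter_right _ fun s _ hs => hle.trans_lt hs)
  rw [card_filter_pos_eigenvalueSet hG hbip, card_filter_eigenvalue_lt hG hbip (by omega)] at hcard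
  omega

lemma eigenvalue_one_lt_valency (hG : IsDistanceRegularWith G p) (hbip : G.IsBipartite)
    (hD : 1 ≤ G.diam) : eigenvalue G 1 < p 0 1 1 := by
  have hcard := card_filter_eigenvalue_lt hG hbip hD
  obtain ⟨s, hs⟩ := Finset.card_pos.1 (hcard.symm ▸ Nat.one_pos)
  rw [Finset.mem_filter] at hs
  exact hs.2.trans_le (le_valency_of_mem_eigenvalueSet hG hD hs.1)

lemma le_eigenvalue_one (hG : IsDistanceRegularWith G p) (hbip : G.IsBipartite)
    (hD : 1 ≤ G.diam) {s : ℝ} (hs : s ∈ eigenvalueSet G) (hne : s ≠ p 0 1 1) :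
    s ≤ eigenvalue G 1 := by
  by_contra! hlt
  exact hne (Finset.card_le_one.1 (card_filter_eigenvalue_lt hG hbip hD).le _
    (Finset.mem_filter.2 ⟨hs, hlt⟩) _ (Finset.mem_filter.2
      ⟨valency_mem_eigenvalueSet hG hD, eigenvalue_one_lt_valency hG hbip hD⟩))

lemma sq_le_eigenvalue_one_sq (hG : IsDistanceRegularWith G p) (hbip : G.IsBipartite)
    (hD : 1 ≤ G.diam) {s : ℝ} (hs : s ∈ eigenvalueSet G) (hne : s ^ 2 ≠ (p 0 1 1 : ℝ) ^ 2) :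
    s ^ 2 ≤ eigenvalue G 1 ^ 2 := by
  have hle := le_eigenvalue_one hG hbip hD hs fun h => hne (by rw [h])
  have hneg := le_eigenvalue_one hG hbip hD (neg_mem_eigenvalueSet hG.connected hbip hs)
    fun h => hne (by rw [← h, neg_sq])
  exact sq_le_sq' (by linarith) hle

lemma eigenvalue_half_le (hG : IsDistanceRegularWith G p) (hbip : G.IsBipartite)
    (hodd : Odd G.diam) {s : ℝ} (hs : s ∈ eigenvalueSet G) (hpos : 0 < s) :
    eigenvalue G (G.diam / 2) ≤ s := by
  obtain ⟨d, hd⟩ := hodd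
  set θ := eigenvalue G (G.diam / 2) with hθ
  have hθ_pos : 0 < θ := eigenvalue_pos hG hbip (by omega)
  have hθ_mem : θ ∈ eigenvalueSet G := eigenvalue_mem hG hbip (by omega)
  have hsub : {s ∈ eigenvalueSet G | θ < s} ⊆ {s ∈ eigenvalueSet G | 0 < s}.erase θ := by
    intro r hr
    rw [Finset.mem_filter] at hr
    exact Finset.mem_erase.2 ⟨hr.2.ne', Finset.mem_filter.2 ⟨hr.1, hθ_pos.trans hr.2⟩⟩
  have heq := Finset.eq_of_subset_of_card_le hsub (by
    rw [Finset.card_erase_of_mem (Finset.mem_filter.2 ⟨hθ_mem, hθ_pos⟩),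
      card_filter_pos_eigenvalueSet hG hbip, hθ, card_filter_eigenvalue_lt hG hbip (by omega)]
    omega)
  by_contra! hlt
  have hs' : s ∈ {s ∈ eigenvalueSet G | θ < s} := by
    rw [heq]
    exact Finset.mem_erase.2 ⟨hlt.ne, Finset.mem_filter.2 ⟨hs, hpos⟩⟩
  exact hlt.not_gt (Finset.mem_filter.1 hs').2

lemma eigenvalue_half_sq_le (hG : IsDistanceRegularWith G p) (hbip : G.IsBipartite)
    (hodd : Odd G.diam) {s : ℝ} (hs : s ∈ eigenvalueSet G) :
    eigenvalue G (G.diam / 2) ^ 2 ≤ s ^ 2 := by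
  have hpos : 0 < eigenvalue G (G.diam / 2) :=
    eigenvalue_pos hG hbip (by obtain ⟨d, hd⟩ := hodd; omega)
  have hs0 : s ≠ 0 := fun h => zero_notMem_eigenvalueSet hG hbip hodd (h ▸ hs)
  have habs : |s| ∈ eigenvalueSet G := by
    rcases abs_choice s with h | h <;> rw [h]
    exacts [hs, neg_mem_eigenvalueSet hG.connected hbip hs]
  rw [← sq_abs s]
  exact pow_le_pow_left₀ hpos.le (eigenvalue_half_le hG hbip hodd habs (abs_pos.2 hs0)) 2

end Ordering

/-! ### Extremal cosine sequences -/

section ParityTruncation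

variable {X R : Type*} [CommRing R] {G : SimpleGraph X} {p : ℕ → ℕ → ℕ → ℕ}

/-- The set of the `i ≤ j` with the parity of `j`. The truncation of `g` at `j` is the function
`(parityIic j).indicator g`. -/
def parityIic (j : ℕ) : Set ℕ := {i | i ≤ j ∧ i % 2 = j % 2}

lemma mem_parityIic {i j : ℕ} : i ∈ parityIic j ↔ i ≤ j ∧ i % 2 = j % 2 := Iff.rfl

lemma indicator_parityIic_apply {M : Type*} [Zero M] (f : ℕ → M) (i j : ℕ) :
    (parityIic j).indicator f i = if i ≤ j ∧ i % 2 = j % 2 then f i else 0 := by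
  classical
  rw [Set.indicator_apply]
  exact if_congr mem_parityIic rfl rfl

lemma neighborSum_neighborSum_apply (g : ℕ → R) (i : ℕ) :
    neighborSum G p (neighborSum G p g) i =
      cNum G p i * cNum G p (i - 1) * g (i - 2) +
        (cNum G p i * bNum G p (i - 1) + bNum G p i * cNum G p (i + 1)) * g i +
        bNum G p i * bNum G p (i + 1) * g (i + 2) := by
  rcases i with _ | i
  · simp only [neighborSum_apply, cNum_zero, Nat.cast_zero]
    ring
  · simp only [neighborSum_apply, Nat.add_sub_cancel, show i + 1 - 2 = i - 1 from rfl]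
    ring

lemma neighborSum_neighborSum_indicator (g : ℕ → R) (i j : ℕ) :
    neighborSum G p (neighborSum G p ((parityIic j).indicator g)) i =
      (parityIic j).indicator (neighborSum G p (neighborSum G p g)) i -
        (if i = j then bNum G p j * bNum G p (j + 1) * g (j + 2) else 0) +
        (if i = j + 2 then cNum G p (j + 2) * cNum G p (j + 1) * g j else 0) := by
  simp only [neighborSum_neighborSum_apply, indicator_parityIic_apply]
  by_cases hi : i < 2
  · have hc : (cNum G p i * cNum G p (i - 1) : R) = 0 := by
      interval_cases i <;> simp [cNum_zero]
    rw [hc]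
    by_cases hij : i = j
    · simp (disch := omega) only [if_pos, if_neg]
      rw [hij]
      ring
    by_cases hpar : i ≤ j ∧ i % 2 = j % 2
    · simp (disch := omega) only [if_pos, if_neg]
      ring
    · simp (disch := omega) only [if_neg]
      ring
  obtain ⟨i, rfl⟩ := Nat.exists_eq_add_of_le' (not_lt.1 hi)
  by_cases hij : i = j
  · simp (disch := omega) only [if_pos, if_neg, Nat.add_sub_cancel]
    rw [hij, show j + 2 - 1 = j + 1 from rfl]
    ring
  by_cases hij' : i + 2 = j
  · simp (disch := omega) only [if_pos, if_neg, Nat.add_sub_cancel]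
    rw [← hij']
    ring
  by_cases hpar : i + 2 ≤ j ∧ i % 2 = j % 2
  · simp (disch := omega) only [if_pos, if_neg, Nat.add_sub_cancel]
    ring
  · simp (disch := omega) only [if_neg]
    ring

end ParityTruncation

section Extremal

variable {X : Type*} [Fintype X] {G : SimpleGraph X} {p : ℕ → ℕ → ℕ → ℕ}

lemma valency_pos (hG : IsDistanceRegularWith G p) (hbip : G.IsBipartite) (hD : 1 ≤ G.diam) :
    0 < p 0 1 1 := by
  rw [← bNum_add_cNum hG hbip hD (Nat.zero_le _), cNum_zero, Nat.zero_add]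
  exact bNum_pos hG hD

lemma one_dotProduct_mulVec (hG : IsDistanceRegularWith G p) (hD : 1 ≤ G.diam) (f : X → ℝ) :
    1 ⬝ᵥ (distMatrix ℝ G 1 *ᵥ f) = p 0 1 1 * (1 ⬝ᵥ f) := by
  rw [← mulVec_dotProduct_of_isSymm (distMatrix_isSymm 1), distMatrix_one_mulVec_one hG hD,
    smul_dotProduct, smul_eq_mul]

lemma signVec_dotProduct_mulVec (hG : IsDistanceRegularWith G p) (hbip : G.IsBipartite)
    (hD : 1 ≤ G.diam) (x : X) (f : X → ℝ) :
    signVec G x ⬝ᵥ (distMatrix ℝ G 1 *ᵥ f) = -(p 0 1 1 * (signVec G x ⬝ᵥ f)) := by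
  rw [← mulVec_dotProduct_of_isSymm (distMatrix_isSymm 1),
    distMatrix_one_mulVec_signVec hG hbip hD, neg_dotProduct, smul_dotProduct, smul_eq_mul]

lemma one_dotProduct_signVec (hG : IsDistanceRegularWith G p) (hbip : G.IsBipartite)
    (hD : 1 ≤ G.diam) (x : X) : 1 ⬝ᵥ signVec G x = 0 := by
  have hk : (p 0 1 1 : ℝ) ≠ 0 := mod_cast (valency_pos hG hbip hD).ne'
  have h := one_dotProduct_mulVec hG hD (signVec G x)
  rw [distMatrix_one_mulVec_signVec hG hbip hD, dotProduct_neg, dotProduct_smul, smul_eq_mul,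
    neg_eq_self, mul_eq_zero] at h
  exact h.resolve_left hk

/-- The component of `f` orthogonal to the eigenspaces of the eigenvalues `k` and `-k`, scaled by
`|X|` to avoid denominators. -/
def nonprincipalPart (G : SimpleGraph X) (x : X) (f : X → ℝ) : X → ℝ :=
  (Fintype.card X : ℝ) • f - (1 ⬝ᵥ f) • 1 - (signVec G x ⬝ᵥ f) • signVec G x

lemma one_dotProduct_nonprincipalPart (hG : IsDistanceRegularWith G p) (hbip : G.IsBipartite)
    (hD : 1 ≤ G.diam) (x : X) (f : X → ℝ) : 1 ⬝ᵥ nonprincipalPart G x f = 0 := by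
  simp only [nonprincipalPart, dotProduct_sub, dotProduct_smul, smul_eq_mul,
    one_dotProduct_signVec hG hbip hD, one_dotProduct_one]
  ring

lemma signVec_dotProduct_nonprincipalPart (hG : IsDistanceRegularWith G p)
    (hbip : G.IsBipartite) (hD : 1 ≤ G.diam) (x : X) (f : X → ℝ) :
    signVec G x ⬝ᵥ nonprincipalPart G x f = 0 := by
  have hself : signVec G x ⬝ᵥ signVec G x = Fintype.card X := by
    simp [dotProduct, signVec_mul_self]
  simp only [nonprincipalPart, dotProduct_sub, dotProduct_smul, smul_eq_mul, hself,
    dotProduct_comm (signVec G x) 1, one_dotProduct_signVec hG hbip hD]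
  ring

lemma nonprincipalPart_dotProduct_self (hG : IsDistanceRegularWith G p) (hbip : G.IsBipartite)
    (hD : 1 ≤ G.diam) (x : X) (f : X → ℝ) :
    nonprincipalPart G x f ⬝ᵥ nonprincipalPart G x f =
      Fintype.card X * (Fintype.card X * (f ⬝ᵥ f) - (1 ⬝ᵥ f) ^ 2 - (signVec G x ⬝ᵥ f) ^ 2) := by
  calc nonprincipalPart G x f ⬝ᵥ nonprincipalPart G x f
      = ((Fintype.card X : ℝ) • f) ⬝ᵥ nonprincipalPart G x f := by
        nth_rewrite 1 [nonprincipalPart]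
        rw [sub_dotProduct, sub_dotProduct, smul_dotProduct _ 1, smul_dotProduct _ (signVec G x),
          one_dotProduct_nonprincipalPart hG hbip hD,
          signVec_dotProduct_nonprincipalPart hG hbip hD]
        simp
    _ = _ := by
        simp only [nonprincipalPart, dotProduct_sub, dotProduct_smul, smul_dotProduct, smul_eq_mul,
          dotProduct_comm f 1, dotProduct_comm f (signVec G x)]
        ring

lemma mulVec_nonprincipalPart (hG : IsDistanceRegularWith G p) (hbip : G.IsBipartite)
    (hD : 1 ≤ G.diam) (x : X) (f : X → ℝ) :
    distMatrix ℝ G 1 *ᵥ nonprincipalPart G x f =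
      nonprincipalPart G x (distMatrix ℝ G 1 *ᵥ f) := by
  simp only [nonprincipalPart, mulVec_sub, mulVec_smul, one_dotProduct_mulVec hG hD,
    signVec_dotProduct_mulVec hG hbip hD, distMatrix_one_mulVec_one hG hD,
    distMatrix_one_mulVec_signVec hG hbip hD]
  module

/-- Rayleigh's principle for the part of `f` orthogonal to the eigenspaces of `k` and `-k`. -/
lemma card_mul_mulVec_dotProduct_self_sub_le [DecidableEq X] (hG : IsDistanceRegularWith G p)
    (hbip : G.IsBipartite) (hD : 1 ≤ G.diam) {θ : ℝ}
    (hθ : ∀ s ∈ eigenvalueSet G, s ^ 2 ≠ (p 0 1 1 : ℝ) ^ 2 → s ^ 2 ≤ θ ^ 2) (x : X) (f : X → ℝ) :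
    Fintype.card X * ((distMatrix ℝ G 1 *ᵥ f) ⬝ᵥ (distMatrix ℝ G 1 *ᵥ f) - θ ^ 2 * (f ⬝ᵥ f)) ≤
      ((p 0 1 1 : ℝ) ^ 2 - θ ^ 2) * ((1 ⬝ᵥ f) ^ 2 + (signVec G x ⬝ᵥ f) ^ 2) := by
  have hcard : (0 : ℝ) < Fintype.card X := by
    have := hG.connected.nonempty
    exact_mod_cast Fintype.card_pos
  have hrayleigh := mulVec_dotProduct_self_le (distMatrix_isHermitian 1) (t := θ)
    (f := nonprincipalPart G x f) fun s w hw hwf => by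
      refine hθ s (mem_eigenvalueSet.2 ⟨w, by rintro rfl; simp at hwf, hw⟩) fun hs => hwf ?_
      exact dotProduct_eq_zero_of_sq_eq_valency_sq hG hbip hD
        (one_dotProduct_nonprincipalPart hG hbip hD x f)
        (signVec_dotProduct_nonprincipalPart hG hbip hD x f) hw hs
  rw [mulVec_nonprincipalPart hG hbip hD, nonprincipalPart_dotProduct_self hG hbip hD,
    nonprincipalPart_dotProduct_self hG hbip hD, mul_left_comm, one_dotProduct_mulVec hG hD,
    signVec_dotProduct_mulVec hG hbip hD] at hrayleigh
  linarith [le_of_mul_le_mul_left hrayleigh hcard]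

lemma indicator_mul_self_eq (j : ℕ) (g : ℕ → ℝ) (i : ℕ) :
    (parityIic j).indicator g i * (parityIic j).indicator g i =
      (parityIic j).indicator g i * g i := by
  by_cases hi : i ∈ parityIic j <;> simp [hi]

lemma sphericalMap_indicator_dotProduct (x : X) (j : ℕ) (g : ℕ → ℝ) :
    sphericalMap ℝ G x ((parityIic j).indicator g) ⬝ᵥ sphericalMap ℝ G x g =
      sphericalMap ℝ G x ((parityIic j).indicator g) ⬝ᵥ
        sphericalMap ℝ G x ((parityIic j).indicator g) :=
  Finset.sum_congr rfl fun _ _ => (indicator_mul_self_eq j g _).symm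

lemma mulVec_sphericalMap_indicator_dotProduct_self (hG : IsDistanceRegularWith G p)
    (hbip : G.IsBipartite) (x : X) {j : ℕ} (hj : j ≤ G.diam) (g : ℕ → ℝ) :
    (distMatrix ℝ G 1 *ᵥ sphericalMap ℝ G x ((parityIic j).indicator g)) ⬝ᵥ
        (distMatrix ℝ G 1 *ᵥ sphericalMap ℝ G x ((parityIic j).indicator g)) =
      sphericalMap ℝ G x ((parityIic j).indicator g) ⬝ᵥ
          sphericalMap ℝ G x (neighborSum G p (neighborSum G p g)) -
        p 0 j j * (bNum G p j * bNum G p (j + 1) * (g j * g (j + 2))) := by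
  have hpointwise (i : ℕ) : (parityIic j).indicator g i *
      neighborSum G p (neighborSum G p ((parityIic j).indicator g)) i =
        (parityIic j).indicator g i * neighborSum G p (neighborSum G p g) i -
          if i = j then bNum G p j * bNum G p (j + 1) * (g j * g (j + 2)) else 0 := by
    rw [neighborSum_neighborSum_indicator]
    by_cases hi : i ∈ parityIic j
    · have hne : i ≠ j + 2 := by have := hi.1; omega
      rw [Set.indicator_of_mem hi, Set.indicator_of_mem hi, if_neg hne]
      split_ifs with hij
      · rw [hij]; ring
      · ring
    · have hne : i ≠ j := by rintro rfl; exact hi ⟨le_rfl, rfl⟩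
      rw [Set.indicator_of_notMem hi, zero_mul, zero_mul, if_neg hne, sub_zero]
  rw [mulVec_dotProduct_of_isSymm (distMatrix_isSymm 1),
    distMatrix_one_mulVec_sphericalMap hG hbip, distMatrix_one_mulVec_sphericalMap hG hbip]
  simp only [dotProduct, sphericalMap_apply, hpointwise, Finset.sum_sub_distrib]
  rw [← Finset.sum_filter, Finset.sum_const, card_dist_eq hG hj, nsmul_eq_mul]

lemma card_dist_eq_pos (hG : IsDistanceRegularWith G p) {j : ℕ} (hj : j ≤ G.diam) :
    0 < p 0 j j := by
  obtain ⟨x⟩ := hG.connected.nonempty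
  obtain ⟨y, hy⟩ := exists_dist_eq hG x hj
  rw [← card_dist_eq hG hj x]
  exact Finset.card_pos.2 ⟨y, by simp [hy]⟩

lemma neighborSum_neighborSum_one (hG : IsDistanceRegularWith G p) (hbip : G.IsBipartite)
    (hD : 1 ≤ G.diam) {i : ℕ} (hi : i ≤ G.diam) :
    neighborSum G p (neighborSum G p (1 : ℕ → ℝ)) i = (p 0 1 1 : ℝ) ^ 2 := by
  have hone : ∀ i ≤ G.diam, neighborSum G p (1 : ℕ → ℝ) i = ((p 0 1 1 : ℝ) • (1 : ℕ → ℝ)) i := by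
    intro i hi
    simp [neighborSum_apply, ← bNum_add_cNum hG hbip hD hi]
  rw [neighborSum_congr hone, map_smul, Pi.smul_apply, hone i hi]
  simp [sq]

namespace IsCosine

variable {θ : ℝ} {u : ℕ → ℝ}

lemma apply_mul_apply_add_two_nonpos [DecidableEq X] (hu : IsCosine G p θ u)
    (hG : IsDistanceRegularWith G p) (hbip : G.IsBipartite)
    (hθ : ∀ s ∈ eigenvalueSet G, θ ^ 2 ≤ s ^ 2) {j : ℕ} (hj : j + 2 ≤ G.diam) :
    u j * u (j + 2) ≤ 0 := by
  obtain ⟨x⟩ := hG.connected.nonempty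
  have hsquare : sphericalMap ℝ G x (neighborSum G p (neighborSum G p u)) =
      θ ^ 2 • sphericalMap ℝ G x u := by
    ext y
    exact hu.neighborSum_neighborSum_eq (dist_le_diam hG.connected x y)
  have hrayleigh := le_mulVec_dotProduct_self (distMatrix_isHermitian 1)
    (fun s w hw hs => hθ s (mem_eigenvalueSet.2 ⟨w, hw, hs⟩))
    (sphericalMap ℝ G x ((parityIic j).indicator u))
  rw [mulVec_sphericalMap_indicator_dotProduct_self hG hbip x (by omega), hsquare,
    dotProduct_smul, sphericalMap_indicator_dotProduct, smul_eq_mul] at hrayleigh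
  have hcoeff : (0 : ℝ) < p 0 j j * (bNum G p j * bNum G p (j + 1)) := by
    have := card_dist_eq_pos hG (j := j) (by omega)
    have := bNum_pos hG (i := j) (by omega)
    have := bNum_pos hG (i := j + 1) (by omega)
    positivity
  exact nonpos_of_mul_nonpos_right (by linarith) hcoeff

lemma apply_ne_apply_add_two_of_sq_le [DecidableEq X] (hu : IsCosine G p θ u)
    (hG : IsDistanceRegularWith G p) (hbip : G.IsBipartite) (hθ0 : θ ≠ 0)
    (hθ : ∀ s ∈ eigenvalueSet G, θ ^ 2 ≤ s ^ 2) {j : ℕ} (hj : j + 2 ≤ G.diam) :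
    u j ≠ u (j + 2) := by
  intro heq
  have hnonpos := hu.apply_mul_apply_add_two_nonpos hG hbip hθ hj
  rw [← heq] at hnonpos
  exact (mul_self_pos.2 (hu.apply_ne_zero_of_apply_add_two_eq hG hθ0 hj heq)).not_ge hnonpos

end IsCosine

lemma signVec_dotProduct_sphericalMap_indicator (x : X) (j : ℕ) (g : ℕ → ℝ) :
    signVec G x ⬝ᵥ sphericalMap ℝ G x ((parityIic j).indicator g) =
      (-1) ^ j * (1 ⬝ᵥ sphericalMap ℝ G x ((parityIic j).indicator g)) := by
  simp only [dotProduct, Finset.mul_sum, sphericalMap_apply]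
  refine Finset.sum_congr rfl fun y _ => ?_
  by_cases hy : G.dist x y ∈ parityIic j
  · have hsign : signVec G x y = (-1) ^ j :=
      neg_one_pow_congr (by rw [Nat.even_iff, Nat.even_iff, hy.2])
    rw [hsign, Pi.one_apply, one_mul]
  · rw [Set.indicator_of_notMem hy, mul_zero, mul_zero, mul_zero]

/-- Half of the vertices are at distance `≡ j` from `x`, but not all of these at distance `≤ j`. -/
lemma two_mul_card_parityIic_lt (hG : IsDistanceRegularWith G p) (hbip : G.IsBipartite) (x : X)
    {j : ℕ} (hj : j + 2 ≤ G.diam) :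
    2 * (1 ⬝ᵥ sphericalMap ℝ G x ((parityIic j).indicator 1)) < Fintype.card X := by
  have hsum : (Fintype.card X : ℝ) = ∑ y, (1 + (-1) ^ j * signVec G x y) := by
    have h := one_dotProduct_signVec hG hbip (by omega) x
    simp only [dotProduct, Pi.one_apply, one_mul] at h
    simp [Finset.sum_add_distrib, ← Finset.mul_sum, h]
  have hsign {i : ℕ} (hi : i % 2 = j % 2) : (-1 : ℝ) ^ j * (-1) ^ i = 1 := by
    rw [← pow_add, Even.neg_one_pow (Nat.even_iff.2 (by omega))]
  obtain ⟨z, hz⟩ := exists_dist_eq hG x hj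
  rw [hsum, dotProduct, Finset.mul_sum]
  refine Finset.sum_lt_sum (fun y _ => ?_) ⟨z, Finset.mem_univ z, ?_⟩
  · rw [Pi.one_apply, one_mul, sphericalMap_apply, signVec]
    by_cases hy : G.dist x y ∈ parityIic j
    · rw [Set.indicator_of_mem hy, hsign hy.2, Pi.one_apply]
      norm_num
    · rw [Set.indicator_of_notMem hy, mul_zero, ← pow_add]
      rcases neg_one_pow_eq_or ℝ (j + G.dist x y) with h | h <;> rw [h] <;> norm_num
  · have hz' : G.dist x z ∉ parityIic j := fun h => by have := h.1; omega
    rw [Pi.one_apply, one_mul, sphericalMap_apply, signVec, Set.indicator_of_notMem hz',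
      hsign (by omega)]
    norm_num

lemma one_dotProduct_sphericalMap_indicator_pos (hG : IsDistanceRegularWith G p) (x : X) {j : ℕ}
    (hj : j ≤ G.diam) : 0 < 1 ⬝ᵥ sphericalMap ℝ G x ((parityIic j).indicator 1) := by
  obtain ⟨z, hz⟩ := exists_dist_eq hG x hj
  refine Finset.sum_pos' (fun y _ => ?_) ⟨z, Finset.mem_univ z, ?_⟩ <;>
    rw [Pi.one_apply, one_mul, sphericalMap_apply]
  · exact Set.indicator_nonneg (fun _ _ => zero_le_one) _
  · rw [hz, Set.indicator_of_mem (by exact ⟨le_rfl, rfl⟩)]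
    exact one_pos

namespace IsCosine

variable {θ : ℝ} {u : ℕ → ℝ}

lemma neighborSum_neighborSum_sub (hu : IsCosine G p θ u) (hG : IsDistanceRegularWith G p)
    (hbip : G.IsBipartite) (hD : 1 ≤ G.diam) (c : ℝ) {i : ℕ} (hi : i ≤ G.diam) :
    neighborSum G p (neighborSum G p (u - c • 1)) i =
      θ ^ 2 * (u - c • 1) i - ((p 0 1 1 : ℝ) ^ 2 - θ ^ 2) * c := by
  simp only [map_sub, map_smul, Pi.sub_apply, Pi.smul_apply, hu.neighborSum_neighborSum_eq hi,
    neighborSum_neighborSum_one hG hbip hD hi, Pi.one_apply, smul_eq_mul]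
  ring

lemma one_dotProduct_sphericalMap_indicator_sub (hu : IsCosine G p θ u)
    (hG : IsDistanceRegularWith G p) (hbip : G.IsBipartite) (hθ : θ ^ 2 < (p 0 1 1 : ℝ) ^ 2)
    (x : X) {j : ℕ} (hj : j + 2 ≤ G.diam) (heq : u j = u (j + 2)) :
    1 ⬝ᵥ sphericalMap ℝ G x ((parityIic j).indicator (u - u j • 1)) =
      -(u j * (1 ⬝ᵥ sphericalMap ℝ G x ((parityIic j).indicator 1))) := by
  have hsquare : sphericalMap ℝ G x
      (neighborSum G p (neighborSum G p ((parityIic j).indicator (u - u j • 1)))) =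
        θ ^ 2 • sphericalMap ℝ G x ((parityIic j).indicator (u - u j • 1)) -
          (((p 0 1 1 : ℝ) ^ 2 - θ ^ 2) * u j) •
            sphericalMap ℝ G x ((parityIic j).indicator 1) := by
    ext y
    have hd := dist_le_diam hG.connected x y
    simp only [sphericalMap_apply, neighborSum_neighborSum_indicator, Pi.sub_apply, Pi.smul_apply,
      ← heq, Pi.one_apply, smul_eq_mul, mul_one, sub_self, mul_zero, ite_self, sub_zero, add_zero]
    by_cases hy : G.dist x y ∈ parityIic j
    · simp only [Set.indicator_of_mem hy, Pi.one_apply,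
        hu.neighborSum_neighborSum_sub hG hbip (by omega) _ hd]
      ring
    · simp only [Set.indicator_of_notMem hy]
      ring
  have hsum := congrArg (1 ⬝ᵥ ·) hsquare
  simp only [← distMatrix_one_mulVec_sphericalMap hG hbip, one_dotProduct_mulVec hG
    (by omega : 1 ≤ G.diam), dotProduct_sub, dotProduct_smul, smul_eq_mul] at hsum
  refine mul_left_cancel₀ (sub_pos.2 hθ).ne' ?_
  linear_combination hsum

/-- If `u j = u (j + 2)`, then `u - u j` vanishes at `j` and `j + 2`, so that `A²` commutes with its
truncation at `j`, which then violates Rayleigh's principle. -/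
lemma apply_ne_apply_add_two_of_le_sq [DecidableEq X] (hu : IsCosine G p θ u)
    (hG : IsDistanceRegularWith G p) (hbip : G.IsBipartite) (hθ0 : θ ≠ 0)
    (hθ : θ ^ 2 < (p 0 1 1 : ℝ) ^ 2)
    (hmax : ∀ s ∈ eigenvalueSet G, s ^ 2 ≠ (p 0 1 1 : ℝ) ^ 2 → s ^ 2 ≤ θ ^ 2)
    {j : ℕ} (hj : j + 2 ≤ G.diam) : u j ≠ u (j + 2) := by
  intro heq
  obtain ⟨x⟩ := hG.connected.nonempty
  have hj0 : (u - u j • 1) j = 0 := by simp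
  have hsquare : sphericalMap ℝ G x (neighborSum G p (neighborSum G p (u - u j • 1))) =
      θ ^ 2 • sphericalMap ℝ G x (u - u j • 1) - (((p 0 1 1 : ℝ) ^ 2 - θ ^ 2) * u j) • 1 := by
    ext y
    rw [sphericalMap_apply, hu.neighborSum_neighborSum_sub hG hbip (by omega) _
      (dist_le_diam hG.connected x y)]
    simp [sphericalMap_apply]
  have hrayleigh := card_mul_mulVec_dotProduct_self_sub_le hG hbip (by omega) hmax x
    (sphericalMap ℝ G x ((parityIic j).indicator (u - u j • 1)))
  rw [mulVec_sphericalMap_indicator_dotProduct_self hG hbip x (by omega), hsquare, hj0,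
    signVec_dotProduct_sphericalMap_indicator, mul_pow, ← pow_mul, mul_comm j, pow_mul,
    neg_one_sq, one_pow, one_mul, dotProduct_sub, dotProduct_smul, dotProduct_smul,
    sphericalMap_indicator_dotProduct, dotProduct_comm _ 1,
    hu.one_dotProduct_sphericalMap_indicator_sub hG hbip hθ x hj heq] at hrayleigh
  have hlt := two_mul_card_parityIic_lt hG hbip x hj
  have hpos := one_dotProduct_sphericalMap_indicator_pos hG x (j := j) (by omega)
  set L := 1 ⬝ᵥ sphericalMap ℝ G x ((parityIic j).indicator 1)
  have hcoeff : 0 < ((p 0 1 1 : ℝ) ^ 2 - θ ^ 2) * u j ^ 2 * L :=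
    mul_pos (mul_pos (sub_pos.2 hθ)
      (sq_pos_of_ne_zero (hu.apply_ne_zero_of_apply_add_two_eq hG hθ0 hj heq))) hpos
  refine hlt.not_ge (le_of_mul_le_mul_left ?_ hcoeff)
  simp only [smul_eq_mul] at hrayleigh
  linarith

lemma bNum_two_mul_bNum_three_mul_sub (hu : IsCosine G p θ u) (hG : IsDistanceRegularWith G p)
    (hbip : G.IsBipartite) (hD : 4 ≤ G.diam) :
    (p 2 1 3 : ℝ) * p 3 1 4 * (u 4 - u 2) = (u 2 - 1) * (θ ^ 2 - p 2 1 3) := by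
  have hb2 : bNum G p 2 = p 2 1 3 := by rw [bNum, if_pos (by omega)]
  have hb3 : bNum G p 3 = p 3 1 4 := by rw [bNum, if_pos (by omega)]
  have hc1 := cNum_one hG (by omega)
  have hsum (i : ℕ) (hi : i ≤ G.diam) : (cNum G p i : ℝ) + bNum G p i = p 0 1 1 := by
    exact_mod_cast bNum_add_cNum hG hbip (by omega) hi
  have hsq0 := hu.neighborSum_neighborSum_eq (Nat.zero_le _)
  have hsq2 := hu.neighborSum_neighborSum_eq (i := 2) (by omega)
  have hk0 := hsum 0 (by omega)
  have hk1 := hsum 1 (by omega)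
  have hk2 := hsum 2 (by omega)
  have hk3 := hsum 3 (by omega)
  simp only [neighborSum_neighborSum_apply, cNum_zero, hc1, hu.zero, hb2, hb3, Nat.cast_zero,
    Nat.cast_one, Nat.reduceAdd, Nat.reduceSub] at hsq0 hsq2 hk0 hk1 hk2 hk3
  linear_combination hsq2 - hsq0 + (1 + bNum G p 1 * u 2) * (hk0 - hk2) +
    p 2 1 3 * u 2 * (hk1 - hk3)

lemma sq_ne_of_apply_two_ne (hu : IsCosine G p θ u) (hG : IsDistanceRegularWith G p)
    (hbip : G.IsBipartite) (hD : 4 ≤ G.diam) (h : u 2 ≠ u 4) : θ ^ 2 ≠ p 2 1 3 := by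
  intro hsq
  have hkey := hu.bNum_two_mul_bNum_three_mul_sub hG hbip hD
  have hb2 := bNum_pos hG (i := 2) (by omega)
  have hb3 := bNum_pos hG (i := 3) (by omega)
  rw [bNum, if_pos (by omega)] at hb2 hb3
  rw [hsq, sub_self, mul_zero, mul_eq_zero, mul_eq_zero, Nat.cast_eq_zero, Nat.cast_eq_zero,
    sub_eq_zero] at hkey
  rcases hkey with (h2 | h3) | h24
  · exact hb2.ne' h2
  · exact hb3.ne' h3
  · exact h h24.symm

lemma tilde_identity (hu : IsCosine G p θ u) (hG : IsDistanceRegularWith G p)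
    (hbip : G.IsBipartite) (hD : 4 ≤ G.diam) (h : u 2 ≠ u 4) :
    1 + tilde p θ * u 2 - (1 + tilde p θ) * u 4 = 0 := by
  have hne := sub_ne_zero.2 (hu.sq_ne_of_apply_two_ne hG hbip hD h)
  rw [tilde]
  field_simp
  linear_combination hu.bNum_two_mul_bNum_three_mul_sub hG hbip hD

end IsCosine

lemma exists_isCosine_eigenvalue [DecidableEq X] (hG : IsDistanceRegularWith G p)
    (hbip : G.IsBipartite) (hD : 3 ≤ G.diam) {n : ℕ}
    (hn : n = 1 ∨ (Odd G.diam ∧ n = G.diam / 2)) :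
    ∃ u, IsCosine G p (eigenvalue G n) u ∧ ∀ j, j + 2 ≤ G.diam → u j ≠ u (j + 2) := by
  rcases hn with rfl | ⟨hodd, rfl⟩
  · have hpos : 0 < eigenvalue G 1 := eigenvalue_pos hG hbip (by omega)
    obtain ⟨u, hu⟩ := exists_isCosine hG hbip (eigenvalue_mem hG hbip (i := 1) (by omega))
    have hlt : eigenvalue G 1 ^ 2 < (p 0 1 1 : ℝ) ^ 2 :=
      pow_lt_pow_left₀ (eigenvalue_one_lt_valency hG hbip (by omega)) hpos.le two_ne_zero
    exact ⟨u, hu, fun j hj => hu.apply_ne_apply_add_two_of_le_sq hG hbip hpos.ne' hlt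
      (fun s hs => sq_le_eigenvalue_one_sq hG hbip (by omega) hs) hj⟩
  · have hpos : 0 < eigenvalue G (G.diam / 2) := eigenvalue_pos hG hbip (by
      obtain ⟨d, hd⟩ := hodd
      omega)
    obtain ⟨u, hu⟩ := exists_isCosine hG hbip (eigenvalue_mem hG hbip (Nat.div_le_self _ 2))
    exact ⟨u, hu, fun j hj => hu.apply_ne_apply_add_two_of_sq_le hG hbip hpos.ne'
      (fun s hs => eigenvalue_half_sq_le hG hbip hodd hs) hj⟩

end Extremal

/-! ### The Hermitian form and complete reducibility -/

lemma iSup_cons {α : Type*} [CompleteLattice α] {m : ℕ} (a : α) (f : Fin m → α) :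
    ⨆ i, (Fin.cons a f : Fin (m + 1) → α) i = a ⊔ ⨆ i, f i := by
  rw [← (finSuccEquiv m).symm.iSup_comp, iSup_option]
  rfl

section Hermitian

variable {X : Type*} [Fintype X]

lemma hermitian_add_left (u v w : X → ℂ) : hermitian (u + v) w = hermitian u w + hermitian v w :=
  add_dotProduct _ _ _

lemma hermitian_smul_left (a : ℂ) (u w : X → ℂ) : hermitian (a • u) w = a * hermitian u w :=
  smul_dotProduct _ _ _

lemma hermitian_smul_right (a : ℂ) (u w : X → ℂ) :
    hermitian u (a • w) = star a * hermitian u w := by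
  simp [hermitian]

lemma hermitian_zero_left (w : X → ℂ) : hermitian 0 w = 0 := zero_dotProduct _

lemma hermitian_zero_right (w : X → ℂ) : hermitian w 0 = 0 := by simp [hermitian]

lemma star_hermitian (u v : X → ℂ) : star (hermitian u v) = hermitian v u := by
  simp [hermitian, dotProduct, mul_comm]

lemma hermitian_eq_zero_symm {u v : X → ℂ} (h : hermitian u v = 0) : hermitian v u = 0 := by
  rw [← star_hermitian, h, star_zero]

lemma hermitian_self_eq_zero {u : X → ℂ} : hermitian u u = 0 ↔ u = 0 := by
  open scoped ComplexOrder in exact dotProduct_self_star_eq_zero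

lemma hermitian_mulVec_left (B : Matrix X X ℂ) (u v : X → ℂ) :
    hermitian (B *ᵥ u) v = hermitian u (Bᴴ *ᵥ v) := by
  rw [hermitian, hermitian, star_mulVec, conjTranspose_conjTranspose, dotProduct_comm,
    dotProduct_mulVec, dotProduct_comm]

/-- The orthogonal complement of `W` in the standard module, with respect to `hermitian`. -/
def perp (W : Submodule ℂ (X → ℂ)) : Submodule ℂ (X → ℂ) where
  carrier := {v | ∀ w ∈ W, hermitian v w = 0}
  add_mem' := fun hu hv w hw => by rw [hermitian_add_left, hu w hw, hv w hw, add_zero]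
  zero_mem' := fun w _ => hermitian_zero_left w
  smul_mem' := fun c _ hv w hw => by rw [hermitian_smul_left, hv w hw, mul_zero]

lemma le_perp_symm {V W : Submodule ℂ (X → ℂ)} (h : V ≤ perp W) : W ≤ perp V :=
  fun w hw _ hv => hermitian_eq_zero_symm (h hv w hw)

lemma inf_perp_eq_bot (W : Submodule ℂ (X → ℂ)) : W ⊓ perp W = ⊥ := by
  rw [eq_bot_iff]
  rintro w ⟨hw, hperp⟩
  exact hermitian_self_eq_zero.1 (hperp w hw)

lemma exists_sub_mem_perp (W : Submodule ℂ (X → ℂ)) (v : X → ℂ) :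
    ∃ w ∈ W, v - w ∈ perp W := by
  let e : (X → ℂ) ≃ₗ[ℂ] EuclideanSpace ℂ X := (WithLp.linearEquiv 2 ℂ (X → ℂ)).symm
  obtain ⟨-, ⟨w, hw, rfl⟩, z, hz, hvwz⟩ :=
    (W.map e.toLinearMap).exists_add_mem_mem_orthogonal (e v)
  refine ⟨w, hw, fun u hu => ?_⟩
  have hvw : e (v - w) = z := by
    rw [map_sub]
    exact sub_eq_of_eq_add' hvwz
  have hinner : inner ℂ (e u) (e (v - w)) = 0 := by
    rw [hvw]
    exact (Submodule.mem_orthogonal _ _).1 hz (e u) ⟨u, hu, rfl⟩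
  rw [← hinner]
  exact (EuclideanSpace.inner_eq_star_dotProduct (e u) (e (v - w))).symm

lemma sup_inf_perp_eq {V W : Submodule ℂ (X → ℂ)} (h : W ≤ V) : W ⊔ V ⊓ perp W = V := by
  refine le_antisymm (sup_le h inf_le_left) fun v hv => ?_
  obtain ⟨w, hw, hvw⟩ := exists_sub_mem_perp W v
  exact Submodule.mem_sup.2 ⟨w, hw, v - w, ⟨V.sub_mem hv (h hw), hvw⟩, add_sub_cancel w v⟩

lemma pairwise_le_perp_cons {m : ℕ} {W : Submodule ℂ (X → ℂ)} {Z : Fin m → Submodule ℂ (X → ℂ)}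
    (hZ : Pairwise fun i j => Z i ≤ perp (Z j)) (hZW : ∀ i, Z i ≤ perp W) :
    Pairwise fun i j : Fin (m + 1) => (Fin.cons W Z : Fin (m + 1) → _) i ≤
      perp ((Fin.cons W Z : Fin (m + 1) → _) j) := by
  intro i j hij
  cases i using Fin.cases <;> cases j using Fin.cases
  · exact absurd rfl hij
  · simpa only [Fin.cons_zero, Fin.cons_succ] using le_perp_symm (hZW _)
  · simpa only [Fin.cons_zero, Fin.cons_succ] using hZW _
  · simpa only [Fin.cons_succ] using hZ (fun h => hij (congrArg Fin.succ h))

lemma iSupIndep_of_pairwise_le_perp {m : ℕ} {Z : Fin m → Submodule ℂ (X → ℂ)}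
    (h : Pairwise fun i j => Z i ≤ perp (Z j)) : iSupIndep Z := by
  intro i
  rw [disjoint_iff, eq_bot_iff, ← inf_perp_eq_bot (Z i)]
  exact inf_le_inf_left _ (iSup₂_le fun j hj => h hj)

end Hermitian

section Generators

variable {X : Type*} {G : SimpleGraph X} {p : ℕ → ℕ → ℕ → ℕ} {x : X}

lemma distMatrix_conjTranspose (i : ℕ) : (distMatrix ℂ G i)ᴴ = distMatrix ℂ G i := by
  ext y z
  simp [distMatrix, G.dist_comm (u := z)]

lemma dualIdempotent_conjTranspose [DecidableEq X] (i : ℕ) :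
    (dualIdempotent G x i)ᴴ = dualIdempotent G x i := by
  rw [dualIdempotent, diagonal_conjTranspose]
  congr 1
  ext y
  simp [apply_ite]

lemma distMatrix_one_mul_distMatrix_succ [Fintype X] (hG : IsDistanceRegularWith G p)
    (hbip : G.IsBipartite) (i : ℕ) : distMatrix ℂ G 1 * distMatrix ℂ G (i + 1) =
      (bNum G p i : ℂ) • distMatrix ℂ G i + (cNum G p (i + 2) : ℂ) • distMatrix ℂ G (i + 2) := by
  rw [distMatrix_eq_radial (i + 1), distMatrix_one_mul_radial hG hbip]
  ext y z
  have hsub : G.dist y z - 1 = i + 1 ↔ G.dist y z = i + 2 := by omega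
  have hadd : G.dist y z + 1 = i + 1 ↔ G.dist y z = i := by omega
  simp only [radial_apply, neighborSum_apply, hsub, hadd, Matrix.add_apply, Matrix.smul_apply,
    distMatrix, of_apply, smul_eq_mul, mul_ite, mul_one, mul_zero]
  split_ifs <;> simp_all

end Generators

section TModule

variable {X : Type*} [Fintype X] [DecidableEq X] {G : SimpleGraph X} {p : ℕ → ℕ → ℕ → ℕ} {x : X}

lemma dualIdempotent_mulVec_apply (i : ℕ) (v : X → ℂ) (y : X) :
    (dualIdempotent G x i *ᵥ v) y = if G.dist x y = i then v y else 0 := by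
  simp [dualIdempotent, mulVec_diagonal]

lemma dualIdempotent_mulVec_eq_self {i : ℕ} {v : X → ℂ} (hv : ∀ y, G.dist x y ≠ i → v y = 0) :
    dualIdempotent G x i *ᵥ v = v := by
  ext y
  rw [dualIdempotent_mulVec_apply]
  exact ite_eq_left_iff.2 fun h => (hv y h).symm

lemma subconstituentAlgebra_eq_adjoin : subconstituentAlgebra G x =
    Algebra.adjoin ℂ ({distMatrix ℂ G 1} ∪ {B | ∃ i ≤ G.diam, B = dualIdempotent G x i}) :=
  (Algebra.adjoin_union _ _).symm

lemma distMatrix_one_mem : distMatrix ℂ G 1 ∈ subconstituentAlgebra G x := by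
  rw [subconstituentAlgebra_eq_adjoin]
  exact Algebra.subset_adjoin (Or.inl rfl)

lemma dualIdempotent_mem (hc : G.Connected) (i : ℕ) :
    dualIdempotent G x i ∈ subconstituentAlgebra G x := by
  by_cases hi : i ≤ G.diam
  · rw [subconstituentAlgebra_eq_adjoin]
    exact Algebra.subset_adjoin (Or.inr ⟨i, hi, rfl⟩)
  · have hzero : dualIdempotent G x i = 0 := diagonal_eq_zero.2 <| funext fun y =>
      if_neg ((dist_le_diam hc x y).trans_lt (not_le.1 hi)).ne
    rw [hzero]
    exact zero_mem _

lemma conjTranspose_mem {B : Matrix X X ℂ} (hB : B ∈ subconstituentAlgebra G x) :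
    Bᴴ ∈ subconstituentAlgebra G x := by
  rw [subconstituentAlgebra_eq_adjoin] at hB ⊢
  induction hB using Algebra.adjoin_induction with
  | mem B hB =>
    have hself : Bᴴ = B := by
      rcases hB with rfl | ⟨i, -, rfl⟩
      · exact distMatrix_conjTranspose 1
      · exact dualIdempotent_conjTranspose i
    rw [hself]
    exact Algebra.subset_adjoin hB
  | algebraMap r =>
    rw [Algebra.algebraMap_eq_smul_one, conjTranspose_smul, conjTranspose_one]
    exact Subalgebra.smul_mem _ (one_mem _) _
  | add a b _ _ ha hb => rw [conjTranspose_add]; exact add_mem ha hb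
  | mul a b _ _ ha hb => rw [conjTranspose_mul]; exact mul_mem hb ha

lemma isTModule_of_generators {W : Submodule ℂ (X → ℂ)}
    (hA : ∀ w ∈ W, distMatrix ℂ G 1 *ᵥ w ∈ W)
    (hE : ∀ i, ∀ w ∈ W, dualIdempotent G x i *ᵥ w ∈ W) : IsTModule G x W := by
  intro B hB
  rw [subconstituentAlgebra_eq_adjoin] at hB
  induction hB using Algebra.adjoin_induction with
  | mem B hB =>
    rcases hB with rfl | ⟨i, -, rfl⟩
    · exact hA
    · exact hE i
  | algebraMap r =>
    intro w hw
    rw [Algebra.algebraMap_eq_smul_one, smul_mulVec, one_mulVec]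
    exact W.smul_mem _ hw
  | add a b _ _ ha hb => intro w hw; rw [add_mulVec]; exact W.add_mem (ha w hw) (hb w hw)
  | mul a b _ _ ha hb => intro w hw; rw [← mulVec_mulVec]; exact ha _ (hb w hw)

lemma isTModule_top : IsTModule G x ⊤ := fun _ _ _ _ => trivial

lemma isTModule_perp {W : Submodule ℂ (X → ℂ)} (hW : IsTModule G x W) :
    IsTModule G x (perp W) := by
  intro B hB v hv w hw
  rw [hermitian_mulVec_left]
  exact hv _ (hW _ (conjTranspose_mem hB) w hw)

lemma IsTModule.inf {V W : Submodule ℂ (X → ℂ)} (hV : IsTModule G x V) (hW : IsTModule G x W) :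
    IsTModule G x (V ⊓ W) :=
  fun B hB v hv => ⟨hV B hB v hv.1, hW B hB v hv.2⟩

lemma IsTModule.exists_irreducible_le {V : Submodule ℂ (X → ℂ)} (hV : IsTModule G x V)
    (hV0 : V ≠ ⊥) : ∃ W ≤ V, IsIrreducibleTModule G x W := by
  obtain ⟨W, hWV, ⟨hW, hW0⟩, hmin⟩ :=
    exists_minimal_le_of_wellFoundedLT (fun W => IsTModule G x W ∧ W ≠ ⊥) V ⟨hV, hV0⟩
  refine ⟨W, hWV, hW, hW0, fun W' hle hW' => or_iff_not_imp_left.2 fun hW'0 => ?_⟩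
  exact le_antisymm hle (hmin ⟨hW', hW'0⟩ hle)

lemma IsTModule.exists_orthogonal_irreducible {V : Submodule ℂ (X → ℂ)} (hV : IsTModule G x V) :
    ∃ (m : ℕ) (Z : Fin m → Submodule ℂ (X → ℂ)), (∀ i, IsIrreducibleTModule G x (Z i)) ∧
      (Pairwise fun i j => Z i ≤ perp (Z j)) ∧ ⨆ i, Z i = V := by
  induction V using WellFoundedLT.induction with
  | ind V ih =>
    by_cases hV0 : V = ⊥
    · exact ⟨0, Fin.elim0, fun i => i.elim0, fun i => i.elim0, by simp [hV0]⟩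
    obtain ⟨W, hWV, hW⟩ := hV.exists_irreducible_le hV0
    have hlt : V ⊓ perp W < V := by
      refine lt_of_le_of_ne inf_le_left fun h => hW.2.1 ?_
      rw [← inf_perp_eq_bot W]
      exact (inf_eq_left.2 (hWV.trans (inf_eq_left.1 h))).symm
    obtain ⟨m, Z, hirr, horth, hsup⟩ := ih _ hlt (hV.inf (isTModule_perp hW.1))
    have hZW (i : Fin m) : Z i ≤ perp W :=
      (le_iSup Z i).trans (hsup.le.trans inf_le_right)
    exact ⟨m + 1, Fin.cons W Z, Fin.cases hW hirr, pairwise_le_perp_cons horth hZW,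
      by rw [iSup_cons, hsup, sup_inf_perp_eq hWV]⟩

lemma exists_isOrthogonalDecomposition (G : SimpleGraph X) (x : X) :
    ∃ (m : ℕ) (Z : Fin m → Submodule ℂ (X → ℂ)), IsOrthogonalDecomposition G x Z := by
  obtain ⟨m, Z, hirr, horth, hsup⟩ :=
    (isTModule_top (G := G) (x := x)).exists_orthogonal_irreducible
  exact ⟨m, Z, hirr, fun i j hij u hu v hv => horth hij hu v hv,
    (DirectSum.isInternal_submodule_iff_iSupIndep_and_iSup_eq_top _).2
      ⟨iSupIndep_of_pairwise_le_perp horth, hsup⟩⟩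

lemma mem_image_dualIdempotent (hc : G.Connected) {W : Submodule ℂ (X → ℂ)}
    (hW : IsTModule G x W) {i : ℕ} {w : X → ℂ} :
    w ∈ image (dualIdempotent G x i) W ↔ w ∈ W ∧ ∀ y, G.dist x y ≠ i → w y = 0 := by
  constructor
  · rintro ⟨v, hv, rfl⟩
    refine ⟨hW _ (dualIdempotent_mem hc i) v hv, fun y hy => ?_⟩
    rw [mulVecLin_apply, dualIdempotent_mulVec_apply, if_neg hy]
  · rintro ⟨hw, hsupp⟩
    exact ⟨w, hw, dualIdempotent_mulVec_eq_self hsupp⟩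

lemma image_dualIdempotent_ne_bot {W : Submodule ℂ (X → ℂ)} {w : X → ℂ} (hw : w ∈ W) {y : X}
    (hy : w y ≠ 0) : image (dualIdempotent G x (G.dist x y)) W ≠ ⊥ := by
  intro h
  have hmem : dualIdempotent G x (G.dist x y) *ᵥ w ∈ image (dualIdempotent G x (G.dist x y)) W :=
    ⟨w, hw, rfl⟩
  rw [h, Submodule.mem_bot] at hmem
  have hzero := congrFun hmem y
  rw [dualIdempotent_mulVec_apply, if_pos rfl] at hzero
  exact hy hzero

lemma image_dualIdempotent_endpoint_ne_bot (hc : G.Connected) {W : Submodule ℂ (X → ℂ)}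
    (hW0 : W ≠ ⊥) : image (dualIdempotent G x (endpoint G x W)) W ≠ ⊥ := by
  obtain ⟨w, hw, hw0⟩ := Submodule.exists_mem_ne_zero_of_ne_bot hW0
  obtain ⟨y, hy⟩ := Function.ne_iff.1 hw0
  exact (Nat.sInf_mem (s := {i | i ≤ G.diam ∧ image (dualIdempotent G x i) W ≠ ⊥})
    ⟨G.dist x y, dist_le_diam hc x y, image_dualIdempotent_ne_bot hw hy⟩).2

lemma endpoint_le {W : Submodule ℂ (X → ℂ)} {i : ℕ} (hi : i ≤ G.diam)
    (h : image (dualIdempotent G x i) W ≠ ⊥) : endpoint G x W ≤ i :=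
  Nat.sInf_le ⟨hi, h⟩

lemma apply_eq_zero_of_lt_endpoint (hc : G.Connected) {W : Submodule ℂ (X → ℂ)} {w : X → ℂ}
    (hw : w ∈ W) {y : X} (hy : G.dist x y < endpoint G x W) : w y = 0 := by
  by_contra h
  exact hy.not_ge (endpoint_le (dist_le_diam hc x y) (image_dualIdempotent_ne_bot hw h))

lemma distMatrix_mem_boseMesner (hG : IsDistanceRegularWith G p) (hbip : G.IsBipartite) (i : ℕ) :
    distMatrix ℂ G i ∈ boseMesner G := by
  have hA : distMatrix ℂ G 1 ∈ boseMesner G := Algebra.subset_adjoin rfl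
  induction i using Nat.twoStepInduction with
  | zero => rw [distMatrix_zero hG.connected]; exact one_mem _
  | one => exact hA
  | more i hi hi1 =>
    by_cases hD : i + 2 ≤ G.diam
    · have hcNum : (cNum G p (i + 2) : ℂ) ≠ 0 := by exact_mod_cast (cNum_succ_pos hG hD).ne'
      have hrec := distMatrix_one_mul_distMatrix_succ hG hbip i
      rw [← sub_eq_iff_eq_add', ← inv_smul_eq_iff₀ hcNum] at hrec
      rw [← hrec]
      exact Subalgebra.smul_mem _ (sub_mem (mul_mem hA hi1) (Subalgebra.smul_mem _ hi _)) _
    · have hzero : distMatrix ℂ G (i + 2) = 0 := by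
        ext y z
        exact if_neg ((dist_le_diam hG.connected y z).trans_lt (not_le.1 hD)).ne
      exact hzero ▸ zero_mem _

lemma radial_mem_boseMesner (hG : IsDistanceRegularWith G p) (hbip : G.IsBipartite)
    (g : ℕ → ℂ) : radial G g ∈ boseMesner G := by
  have hsum : radial G g = ∑ i ∈ Finset.range (G.diam + 1), g i • distMatrix ℂ G i := by
    ext y z
    rw [Matrix.sum_apply]
    simp [radial_apply, distMatrix, Nat.lt_succ_iff.2 (dist_le_diam hG.connected y z)]
  rw [hsum]
  exact sum_mem fun i _ => Subalgebra.smul_mem _ (distMatrix_mem_boseMesner hG hbip i) _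

lemma distMatrix_mem (hG : IsDistanceRegularWith G p) (hbip : G.IsBipartite) (i : ℕ) :
    distMatrix ℂ G i ∈ subconstituentAlgebra G x :=
  (le_sup_left : boseMesner G ≤ _) (distMatrix_mem_boseMesner hG hbip i)

lemma localMatrix_mem (hG : IsDistanceRegularWith G p) (hbip : G.IsBipartite) :
    localMatrix G x ∈ subconstituentAlgebra G x :=
  mul_mem (mul_mem (dualIdempotent_mem hG.connected 2) (distMatrix_mem hG hbip 2))
    (dualIdempotent_mem hG.connected 2)

end TModule

/-! ### Modules generated by a vector supported in one layer -/

section LayerSums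

variable {X : Type*} [Fintype X] {G : SimpleGraph X} {p : ℕ → ℕ → ℕ → ℕ} {x : X} {r : ℕ}

/-- The vector which agrees with `A_{j-r} E*_r v` in each layer `j`: at `y`, the sum of `v z` over
the `z` in the layer `r` at the least possible distance from `y`. -/
def lowerSum (G : SimpleGraph X) (x : X) (r : ℕ) (v : X → ℂ) (y : X) : ℂ :=
  ∑ z with G.dist x z = r ∧ G.dist y z + r = G.dist x y, v z

/-- The vector which agrees with `A_{j+r} E*_r v` in each layer `j`: at `y`, the sum of `v z` over
the `z` in the layer `r` at the greatest possible distance from `y`. -/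
def upperSum (G : SimpleGraph X) (x : X) (r : ℕ) (v : X → ℂ) (y : X) : ℂ :=
  ∑ z with G.dist x z = r ∧ G.dist y z = G.dist x y + r, v z

/-- `v` is supported in the layer `r`, and in each layer its lower and upper sums are multiples of
each other. These are the vectors for which the lower sums span a `T`-module. -/
structure IsLadder (G : SimpleGraph X) (x : X) (r : ℕ) (v : X → ℂ) : Prop where
  supp : ∀ y, G.dist x y ≠ r → v y = 0
  coeff : ∃ τ κ : ℕ → ℂ, ∀ y, lowerSum G x r v y = τ (G.dist x y) * upperSum G x r v y ∧
    upperSum G x r v y = κ (G.dist x y) * lowerSum G x r v y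

/-- The space of all vectors that are, in each layer, multiples of the lower sums of `v`. -/
def ladder (G : SimpleGraph X) (x : X) (r : ℕ) (v : X → ℂ) : Submodule ℂ (X → ℂ) where
  carrier := {f | ∃ a : ℕ → ℂ, f = fun y => a (G.dist x y) * lowerSum G x r v y}
  add_mem' := by
    rintro _ _ ⟨a, rfl⟩ ⟨b, rfl⟩
    exact ⟨a + b, by ext y; simp [add_mul]⟩
  zero_mem' := ⟨0, by ext y; simp⟩
  smul_mem' := by
    rintro c _ ⟨a, rfl⟩
    exact ⟨c • a, by ext y; simp [mul_assoc]⟩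

lemma lowerSum_eq_zero_of_lt (v : X → ℂ) {y : X} (hy : G.dist x y < r) :
    lowerSum G x r v y = 0 := by
  rw [lowerSum, Finset.filter_eq_empty_iff.2 fun z _ hz => by omega, Finset.sum_empty]

lemma lowerSum_of_dist_eq (hc : G.Connected) (v : X → ℂ) {y : X} (hy : G.dist x y = r) :
    lowerSum G x r v y = v y := by
  have hsingleton :
      ({z | G.dist x z = r ∧ G.dist y z + r = G.dist x y} : Finset X) = {y} := by
    ext z
    simp only [Finset.mem_filter, Finset.mem_univ, true_and, Finset.mem_singleton]
    constructor
    · rintro ⟨-, hz⟩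
      exact (hc.dist_eq_zero_iff.1 (by omega)).symm
    · rintro rfl
      simp [hy]
  rw [lowerSum, hsingleton, Finset.sum_singleton]

lemma sum_closer_lowerSum (hG : IsDistanceRegularWith G p) (v : X → ℂ) (y : X) :
    ∑ w with G.dist y w = 1 ∧ G.dist w x + 1 = G.dist y x, lowerSum G x r v w =
      cNum G p (G.dist x y - r) * lowerSum G x r v y := by
  have hc := hG.connected
  simp only [lowerSum]
  rw [Finset.sum_comm' (t' := {z | G.dist x z = r ∧ G.dist y z + r = G.dist x y})
    (s' := fun z => {w | G.dist y w = 1 ∧ G.dist w z + 1 = G.dist y z}), Finset.mul_sum]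
  · refine Finset.sum_congr rfl fun z hz => ?_
    have hyz : G.dist x y - r = G.dist y z := by
      have := (Finset.mem_filter.1 hz).2.2
      omega
    rw [Finset.sum_const, nsmul_eq_mul, hyz, card_neighbors_closer hG]
  · intro w z
    simp only [Finset.mem_filter, Finset.mem_univ, true_and]
    have hyxz := hc.dist_triangle (u := y) (v := z) (w := x)
    have hwxz := hc.dist_triangle (u := w) (v := z) (w := x)
    have hywz := hc.dist_triangle (u := y) (v := w) (w := z)
    have hywx := hc.dist_triangle (u := y) (v := w) (w := x)
    rw [G.dist_comm (u := x) (v := y), G.dist_comm (u := x) (v := w), G.dist_comm (u := x) (v := z)]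
    omega

lemma sum_farther_upperSum (hG : IsDistanceRegularWith G p) (v : X → ℂ) (y : X) :
    ∑ w with G.dist y w = 1 ∧ G.dist w x = G.dist y x + 1, upperSum G x r v w =
      bNum G p (G.dist x y + r) * upperSum G x r v y := by
  have hc := hG.connected
  simp only [upperSum]
  rw [Finset.sum_comm' (t' := {z | G.dist x z = r ∧ G.dist y z = G.dist x y + r})
    (s' := fun z => {w | G.dist y w = 1 ∧ G.dist w z = G.dist y z + 1}), Finset.mul_sum]
  · refine Finset.sum_congr rfl fun z hz => ?_
    rw [Finset.sum_const, nsmul_eq_mul, ← (Finset.mem_filter.1 hz).2.2, card_neighbors_farther hG]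
  · intro w z
    simp only [Finset.mem_filter, Finset.mem_univ, true_and]
    have hyxz := hc.dist_triangle (u := y) (v := x) (w := z)
    have hwxz := hc.dist_triangle (u := w) (v := x) (w := z)
    have hwyz := hc.dist_triangle (u := w) (v := y) (w := z)
    have hwyx := hc.dist_triangle (u := w) (v := y) (w := x)
    rw [G.dist_comm (u := w) (v := y)] at hwyz hwyx
    rw [G.dist_comm (u := x) (v := y), G.dist_comm (u := x) (v := w)]
    omega

lemma apply_eq_zero_of_mem_ladder {v f : X → ℂ} (hf : f ∈ ladder G x r v) {y : X}
    (hy : G.dist x y < r) : f y = 0 := by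
  obtain ⟨a, rfl⟩ := hf
  dsimp only
  rw [lowerSum_eq_zero_of_lt v hy, mul_zero]

lemma self_mem_ladder (hc : G.Connected) {v : X → ℂ} (hv : ∀ y, G.dist x y ≠ r → v y = 0) :
    v ∈ ladder G x r v := by
  refine ⟨fun j => if j = r then 1 else 0, funext fun y => ?_⟩
  by_cases h : G.dist x y = r
  · simp [h, lowerSum_of_dist_eq hc v h]
  · simp [h, hv y h]

lemma IsLadder.ladder_ne_bot {v : X → ℂ} (hv : IsLadder G x r v) (hc : G.Connected)
    (hv0 : v ≠ 0) : ladder G x r v ≠ ⊥ :=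
  (Submodule.ne_bot_iff _).2 ⟨v, self_mem_ladder hc hv.supp, hv0⟩

variable [DecidableEq X]

lemma dualIdempotent_mulVec_eq_smul_of_mem_ladder (hc : G.Connected) {v f : X → ℂ}
    (hv : ∀ y, G.dist x y ≠ r → v y = 0) (hf : f ∈ ladder G x r v) :
    ∃ c : ℂ, dualIdempotent G x r *ᵥ f = c • v := by
  obtain ⟨a, rfl⟩ := hf
  refine ⟨a r, funext fun y => ?_⟩
  rw [dualIdempotent_mulVec_apply]
  by_cases h : G.dist x y = r
  · simp [h, lowerSum_of_dist_eq hc v h]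
  · simp [h, hv y h]

lemma ladder_le (hG : IsDistanceRegularWith G p) (hbip : G.IsBipartite)
    {W : Submodule ℂ (X → ℂ)} (hW : IsTModule G x W) {v : X → ℂ} (hvW : v ∈ W) :
    ladder G x r v ≤ W := by
  rintro _ ⟨a, rfl⟩
  have hE := dualIdempotent_mem (x := x) hG.connected
  have hsum : (fun y => a (G.dist x y) * lowerSum G x r v y) = ∑ j ∈ Finset.range (G.diam + 1),
      a j • (dualIdempotent G x j *ᵥ ((if r ≤ j then distMatrix ℂ G (j - r) else 0) *ᵥ
        (dualIdempotent G x r *ᵥ v))) := by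
    ext y
    have hy := dist_le_diam hG.connected x y
    simp only [Finset.sum_apply, Pi.smul_apply, dualIdempotent_mulVec_apply, smul_eq_mul]
    rw [Finset.sum_eq_single_of_mem (G.dist x y) (by simpa [Nat.lt_succ_iff] using hy)
      fun j _ hj => by rw [if_neg hj.symm, mul_zero], if_pos rfl]
    congr 1
    split_ifs with hr
    · simp only [distMatrix_mulVec_apply, dualIdempotent_mulVec_apply, lowerSum, Finset.sum_filter]
      refine Finset.sum_congr rfl fun z _ => ?_
      simp only [eq_tsub_iff_add_eq_of_le hr, ite_and]
      split_ifs <;> rfl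
    · rw [zero_mulVec, lowerSum_eq_zero_of_lt v (not_le.1 hr), Pi.zero_apply]
  rw [hsum]
  refine Submodule.sum_mem _ fun j _ => W.smul_mem _ (hW _ (hE j) _ (hW _ ?_ _ (hW _ (hE r) _ hvW)))
  split_ifs
  · exact distMatrix_mem hG hbip _
  · exact zero_mem _

lemma isThin_ladder (v : X → ℂ) : IsThin G x (ladder G x r v) := by
  intro i _
  have hle : image (dualIdempotent G x i) (ladder G x r v) ≤
      Submodule.span ℂ {dualIdempotent G x i *ᵥ lowerSum G x r v} := by
    rintro _ ⟨_, ⟨a, rfl⟩, rfl⟩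
    refine Submodule.mem_span_singleton.2 ⟨a i, funext fun y => ?_⟩
    rw [mulVecLin_apply, Pi.smul_apply, dualIdempotent_mulVec_apply, dualIdempotent_mulVec_apply]
    by_cases h : G.dist x y = i <;> simp [h]
  refine (Submodule.finrank_mono hle).trans ?_
  simpa using finrank_span_le_card (R := ℂ) {dualIdempotent G x i *ᵥ lowerSum G x r v}

end LayerSums

lemma IsIrreducibleTModule.eq_of_le {X : Type*} [Fintype X] [DecidableEq X] {G : SimpleGraph X}
    {x : X} {V W : Submodule ℂ (X → ℂ)} (hW : IsIrreducibleTModule G x W)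
    (hV : IsTModule G x V) (hV0 : V ≠ ⊥) (hle : V ≤ W) : V = W :=
  (hW.2.2 V hle hV).resolve_left hV0

namespace IsLadder

variable {X : Type*} [Fintype X] [DecidableEq X] {G : SimpleGraph X} {p : ℕ → ℕ → ℕ → ℕ} {x : X}
  {r : ℕ} {v : X → ℂ}

lemma isTModule (hv : IsLadder G x r v) (hG : IsDistanceRegularWith G p)
    (hbip : G.IsBipartite) : IsTModule G x (ladder G x r v) := by
  apply isTModule_of_generators
  · rintro _ ⟨a, rfl⟩
    obtain ⟨τ, κ, hτκ⟩ := hv.coeff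
    refine ⟨fun j => a (j - 1) * cNum G p (j - r) +
      a (j + 1) * τ (j + 1) * bNum G p (j + r) * κ j, funext fun y => ?_⟩
    have hcloser : ∑ w with G.dist y w = 1 ∧ G.dist w x + 1 = G.dist y x,
        a (G.dist x w) * lowerSum G x r v w =
          a (G.dist x y - 1) * (cNum G p (G.dist x y - r) * lowerSum G x r v y) := by
      rw [← sum_closer_lowerSum hG, Finset.mul_sum]
      refine Finset.sum_congr rfl fun w hw => ?_
      have := (Finset.mem_filter.1 hw).2.2
      rw [G.dist_comm (u := x) (v := y), ← this, Nat.add_sub_cancel, G.dist_comm]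
    have hfarther : ∑ w with G.dist y w = 1 ∧ G.dist w x = G.dist y x + 1,
        a (G.dist x w) * lowerSum G x r v w = a (G.dist x y + 1) * τ (G.dist x y + 1) *
          (bNum G p (G.dist x y + r) * upperSum G x r v y) := by
      rw [← sum_farther_upperSum hG, Finset.mul_sum]
      refine Finset.sum_congr rfl fun w hw => ?_
      rw [(hτκ w).1, G.dist_comm (u := x) (v := y), ← (Finset.mem_filter.1 hw).2.2,
        G.dist_comm (u := x), mul_assoc]
    rw [distMatrix_mulVec_apply, sum_neighbors_eq_add hG.connected hbip _ y x, hcloser, hfarther,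
      (hτκ y).2]
    ring
  · rintro i _ ⟨a, rfl⟩
    refine ⟨fun j => if j = i then a j else 0, funext fun y => ?_⟩
    rw [dualIdempotent_mulVec_apply, ite_mul, zero_mul]

lemma isIrreducible (hv : IsLadder G x r v) (hG : IsDistanceRegularWith G p)
    (hbip : G.IsBipartite) (hv0 : v ≠ 0) : IsIrreducibleTModule G x (ladder G x r v) := by
  have hc := hG.connected
  refine ⟨hv.isTModule hG hbip, hv.ladder_ne_bot hc hv0, fun W hle hW => ?_⟩
  by_cases h : ∃ w ∈ W, dualIdempotent G x r *ᵥ w ≠ 0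
  · right
    obtain ⟨w, hw, hne⟩ := h
    obtain ⟨c, hcv⟩ := dualIdempotent_mulVec_eq_smul_of_mem_ladder hc hv.supp (hle hw)
    have hc0 : c ≠ 0 := by
      rintro rfl
      exact hne (by rw [hcv, zero_smul])
    have hvW : v ∈ W := by
      have hmem := hW _ (dualIdempotent_mem hc r) w hw
      rwa [hcv, W.smul_mem_iff hc0] at hmem
    exact le_antisymm hle (ladder_le hG hbip hW hvW)
  · left
    push Not at h
    have hv_perp : v ∈ perp W := by
      intro w hw
      rw [← dualIdempotent_mulVec_eq_self hv.supp, hermitian_mulVec_left,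
        dualIdempotent_conjTranspose, h w hw, hermitian_zero_right]
    rw [eq_bot_iff, ← inf_perp_eq_bot W]
    exact le_inf le_rfl (hle.trans (ladder_le hG hbip (isTModule_perp hW) hv_perp))

lemma ladder_eq (hv : IsLadder G x r v) (hG : IsDistanceRegularWith G p) (hbip : G.IsBipartite)
    (hv0 : v ≠ 0) {W : Submodule ℂ (X → ℂ)} (hW : IsIrreducibleTModule G x W) (hvW : v ∈ W) :
    ladder G x r v = W :=
  hW.eq_of_le (hv.isTModule hG hbip) (hv.ladder_ne_bot hG.connected hv0)
    (ladder_le hG hbip hW.1 hvW)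

lemma endpoint_eq (hv : IsLadder G x r v) (hG : IsDistanceRegularWith G p)
    (hbip : G.IsBipartite) (hr : r ≤ G.diam) (hv0 : v ≠ 0) :
    endpoint G x (ladder G x r v) = r := by
  have hc := hG.connected
  have hT := hv.isTModule hG hbip
  apply le_antisymm
  · exact endpoint_le hr <| (Submodule.ne_bot_iff _).2 ⟨v,
      (mem_image_dualIdempotent hc hT).2 ⟨self_mem_ladder hc hv.supp, hv.supp⟩, hv0⟩
  · by_contra! hlt
    refine image_dualIdempotent_endpoint_ne_bot hc (x := x) (hv.ladder_ne_bot hc hv0) ?_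
    refine (Submodule.eq_bot_iff _).2 fun w hw => funext fun y => ?_
    obtain ⟨hw, hsupp⟩ := (mem_image_dualIdempotent hc hT).1 hw
    by_cases hy : G.dist x y = endpoint G x (ladder G x r v)
    · exact apply_eq_zero_of_mem_ladder hw (hy ▸ hlt)
    · exact hsupp y hy

end IsLadder

/-! ### Modules with endpoint zero or one, and the space `U` -/

section Endpoint

variable {X : Type*} [Fintype X] {G : SimpleGraph X} {p : ℕ → ℕ → ℕ → ℕ} {x : X}

lemma hermitian_congr_right {v f g : X → ℂ} (h : ∀ y, v y ≠ 0 → f y = g y) :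
    hermitian v f = hermitian v g := by
  refine Finset.sum_congr rfl fun y _ => ?_
  by_cases hy : v y = 0
  · rw [hy, zero_mul, zero_mul]
  · rw [Pi.star_apply, Pi.star_apply, h y hy]

lemma isLadder_zero {v : X → ℂ} (hv : ∀ y, G.dist x y ≠ 0 → v y = 0) : IsLadder G x 0 v where
  supp := hv
  coeff := ⟨1, 1, fun y => by simp [lowerSum, upperSum]⟩

lemma isLadder_one (hc : G.Connected) (hbip : G.IsBipartite) {v : X → ℂ}
    (hv : ∀ y, G.dist x y ≠ 1 → v y = 0) (hsum : ∑ y, v y = 0) : IsLadder G x 1 v where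
  supp := hv
  coeff := by
    have hadd (y : X) : lowerSum G x 1 v y + upperSum G x 1 v y = 0 := by
      rw [lowerSum, upperSum, Finset.sum_filter, Finset.sum_filter, ← Finset.sum_add_distrib]
      refine (Finset.sum_congr rfl fun z _ => ?_).trans hsum
      by_cases hz : G.dist x z = 1
      · have hstep := dist_eq_succ_or_succ_eq_of_dist_eq_one hc hbip hz y
        rw [G.dist_comm (u := z)] at hstep
        rcases hstep with h | h
        · simp [hz, h, add_assoc]
        · simp [hz, ← h, add_assoc]
      · simp [hv z hz]
    refine ⟨-1, -1, fun y => ?_⟩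
    simp only [Pi.neg_apply, Pi.one_apply, neg_one_mul]
    exact ⟨eq_neg_of_add_eq_zero_left (hadd y), eq_neg_of_add_eq_zero_right (hadd y)⟩

lemma lowerSum_eq_distMatrix_mulVec {r i : ℕ} {v : X → ℂ} (hv : ∀ y, G.dist x y ≠ r → v y = 0)
    {y : X} (hy : G.dist x y = i + r) : lowerSum G x r v y = (distMatrix ℂ G i *ᵥ v) y := by
  rw [lowerSum, distMatrix_mulVec_apply, Finset.sum_filter, Finset.sum_filter]
  refine Finset.sum_congr rfl fun z _ => ?_
  by_cases hz : G.dist x z = r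
  · simp [hz, hy]
  · simp [hv z hz]

lemma hermitian_eq_zero_of_mem_ladder {r i : ℕ} {u v w : X → ℂ}
    (hu : ∀ y, G.dist x y ≠ r → u y = 0) (hv : ∀ y, G.dist x y ≠ i + r → v y = 0)
    (hann : ∀ y, G.dist x y = r → (distMatrix ℂ G i *ᵥ v) y = 0) (hw : w ∈ ladder G x r u) :
    hermitian v w = 0 := by
  obtain ⟨a, rfl⟩ := hw
  rw [hermitian_congr_right (g := a (i + r) • (distMatrix ℂ G i *ᵥ u)), hermitian_smul_right,
    ← distMatrix_conjTranspose, ← hermitian_mulVec_left]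
  · refine mul_eq_zero_of_right _ (Finset.sum_eq_zero fun y _ => ?_)
    by_cases hy : G.dist x y = r
    · rw [hann y hy, zero_mul]
    · rw [Pi.star_apply, hu y hy, star_zero, mul_zero]
  · intro y hy
    have hdist : G.dist x y = i + r := not_imp_comm.1 (hv y) hy
    rw [Pi.smul_apply, smul_eq_mul, hdist, lowerSum_eq_distMatrix_mulVec hu hdist]

/-- The vectors supported in the second layer and annihilated by `E*_1 A`. These turn out to be
the vectors of `U`. -/
structure IsPrimitive (G : SimpleGraph X) (x : X) (v : X → ℂ) : Prop where
  supp : ∀ y, G.dist x y ≠ 2 → v y = 0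
  ann : ∀ y, G.dist x y = 1 → (distMatrix ℂ G 1 *ᵥ v) y = 0

lemma IsPrimitive.distMatrix_two_mulVec_apply_self {v : X → ℂ} (hv : IsPrimitive G x v)
    (hG : IsDistanceRegularWith G p) (hbip : G.IsBipartite) (hD : 2 ≤ G.diam) :
    (distMatrix ℂ G 2 *ᵥ v) x = 0 := by
  have hzero : (distMatrix ℂ G 0 *ᵥ v) x = 0 := by
    rw [distMatrix_mulVec_apply]
    exact Finset.sum_eq_zero fun z hz => hv.supp z (by simp [(Finset.mem_filter.1 hz).2])
  have hone : (distMatrix ℂ G 1 *ᵥ (distMatrix ℂ G 1 *ᵥ v)) x = 0 := by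
    rw [distMatrix_mulVec_apply]
    exact Finset.sum_eq_zero fun y hy => hv.ann y (Finset.mem_filter.1 hy).2
  rw [mulVec_mulVec, distMatrix_one_mul_distMatrix_succ hG hbip 0, add_mulVec, smul_mulVec,
    smul_mulVec, Pi.add_apply, Pi.smul_apply, Pi.smul_apply, hzero, smul_zero, zero_add,
    smul_eq_mul, mul_eq_zero, Nat.cast_eq_zero] at hone
  exact hone.resolve_left (cNum_succ_pos hG (by omega)).ne'

lemma IsPrimitive.sum_eq_zero {v : X → ℂ} (hv : IsPrimitive G x v)
    (hG : IsDistanceRegularWith G p) (hbip : G.IsBipartite) (hD : 2 ≤ G.diam) :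
    ∑ z, v z = 0 := by
  rw [← hv.distMatrix_two_mulVec_apply_self hG hbip hD, distMatrix_mulVec_apply]
  exact (Finset.sum_filter_of_ne fun z _ hz => not_imp_comm.1 (hv.supp z) hz).symm

variable [DecidableEq X]

lemma hermitian_dualIdempotent_mulVec_right {i : ℕ} {v : X → ℂ}
    (hv : ∀ y, G.dist x y ≠ i → v y = 0) (w : X → ℂ) :
    hermitian v (dualIdempotent G x i *ᵥ w) = hermitian v w := by
  rw [← dualIdempotent_conjTranspose, ← hermitian_mulVec_left, dualIdempotent_mulVec_eq_self hv]

lemma isTModule_sSup {S : Set (Submodule ℂ (X → ℂ))} (hS : ∀ W ∈ S, IsTModule G x W) :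
    IsTModule G x (sSup S) := by
  intro B hB w hw
  have hle : sSup S ≤ (sSup S).comap B.mulVecLin :=
    sSup_le fun W hW w hw => (le_sSup hW : W ≤ sSup S) (hS W hW B hB w hw)
  exact hle hw

lemma sSup_irreducible_eq_top (G : SimpleGraph X) (x : X) :
    sSup {W | IsIrreducibleTModule G x W} = ⊤ := by
  obtain ⟨m, Z, hirr, -, hsup⟩ := (isTModule_top (G := G) (x := x)).exists_orthogonal_irreducible
  rw [eq_top_iff, ← hsup]
  exact iSup_le fun i => le_sSup (hirr i)

lemma IsIrreducibleTModule.exists_mem_layer_endpoint {W : Submodule ℂ (X → ℂ)}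
    (hW : IsIrreducibleTModule G x W) (hc : G.Connected) :
    ∃ u ∈ W, u ≠ 0 ∧ ∀ y, G.dist x y ≠ endpoint G x W → u y = 0 := by
  obtain ⟨u, hu, hu0⟩ := Submodule.exists_mem_ne_zero_of_ne_bot
    (image_dualIdempotent_endpoint_ne_bot hc (x := x) hW.2.1)
  obtain ⟨huW, hsupp⟩ := (mem_image_dualIdempotent hc hW.1).1 hu
  exact ⟨u, huW, hu0, hsupp⟩

lemma dualIdempotent_mulVec_mem_sSup (hc : G.Connected) {i : ℕ} (hi : i ≤ G.diam) (f : X → ℂ) :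
    dualIdempotent G x i *ᵥ f ∈ sSup {W | IsIrreducibleTModule G x W ∧ endpoint G x W ≤ i} := by
  suffices hle : ⊤ ≤ (sSup {W | IsIrreducibleTModule G x W ∧ endpoint G x W ≤ i}).comap
      (dualIdempotent G x i).mulVecLin from hle Submodule.mem_top
  rw [← sSup_irreducible_eq_top G x]
  refine sSup_le fun W hW w hw => ?_
  by_cases h : image (dualIdempotent G x i) W = ⊥
  · rw [Submodule.mem_comap, (Submodule.eq_bot_iff _).1 h _ ⟨w, hw, rfl⟩]
    exact zero_mem _
  · have hmem : W ∈ {W | IsIrreducibleTModule G x W ∧ endpoint G x W ≤ i} := ⟨hW, endpoint_le hi h⟩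
    exact Submodule.mem_sSup_of_mem hmem (hW.1 _ (dualIdempotent_mem hc i) w hw)

lemma endpointSpan_zero_sup_endpointSpan_one : endpointSpan G x 0 ⊔ endpointSpan G x 1 =
    sSup {W | IsIrreducibleTModule G x W ∧ endpoint G x W ≤ 1} := by
  rw [endpointSpan, endpointSpan, ← sSup_union]
  congr 1
  ext W
  simp only [Set.mem_union, Set.mem_ofPred_eq, Nat.le_one_iff_eq_zero_or_eq_one, and_or_left]

lemma mem_spaceU_iff_forall_hermitian_eq_zero (hc : G.Connected) {v : X → ℂ} :
    v ∈ spaceU G x ↔ (∀ y, G.dist x y ≠ 2 → v y = 0) ∧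
      ∀ w ∈ sSup {W | IsIrreducibleTModule G x W ∧ endpoint G x W ≤ 1}, hermitian v w = 0 := by
  have hmem : v ∈ image (dualIdempotent G x 2) ⊤ ↔ ∀ y, G.dist x y ≠ 2 → v y = 0 := by
    rw [mem_image_dualIdempotent hc isTModule_top]
    simp
  change _ ∧ _ ↔ _
  rw [hmem, image, image, ← Submodule.map_sup, endpointSpan_zero_sup_endpointSpan_one]
  refine and_congr_right fun hv => ⟨fun h w hw => ?_, ?_⟩
  · rw [← hermitian_dualIdempotent_mulVec_right hv]
    exact h _ ⟨w, hw, rfl⟩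
  · rintro h _ ⟨w, hw, rfl⟩
    rw [mulVecLin_apply, hermitian_dualIdempotent_mulVec_right hv]
    exact h w hw

lemma isPrimitive_of_mem_spaceU (hc : G.Connected) (hD : 1 ≤ G.diam) {v : X → ℂ}
    (hv : v ∈ spaceU G x) : IsPrimitive G x v := by
  obtain ⟨hsupp, hperp⟩ := (mem_spaceU_iff_forall_hermitian_eq_zero hc).1 hv
  refine ⟨hsupp, fun y hy => ?_⟩
  have hzero := hperp _ <| isTModule_sSup (fun W hW => hW.1.1) _ distMatrix_one_mem _
    (dualIdempotent_mulVec_mem_sSup hc hD (Pi.single y 1))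
  rw [← distMatrix_conjTranspose, ← hermitian_mulVec_left, ← dualIdempotent_conjTranspose,
    ← hermitian_mulVec_left] at hzero
  simpa [hermitian, dotProduct, Pi.single_apply, dualIdempotent_mulVec_apply, hy] using hzero

lemma IsPrimitive.hermitian_eq_zero {v : X → ℂ} (hv : IsPrimitive G x v)
    (hG : IsDistanceRegularWith G p) (hbip : G.IsBipartite) (hD : 2 ≤ G.diam)
    {W : Submodule ℂ (X → ℂ)} (hW : IsIrreducibleTModule G x W) (hend : endpoint G x W ≤ 1)
    {w : X → ℂ} (hw : w ∈ W) : hermitian v w = 0 := by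
  have hc := hG.connected
  obtain ⟨u, hu, hu0, hsupp⟩ := hW.exists_mem_layer_endpoint hc
  rcases Nat.le_one_iff_eq_zero_or_eq_one.1 hend with h | h <;> rw [h] at hsupp
  · rw [← (isLadder_zero hsupp).ladder_eq hG hbip hu0 hW hu] at hw
    refine hermitian_eq_zero_of_mem_ladder hsupp hv.supp (fun y hy => ?_) hw
    rw [← hc.dist_eq_zero_iff.1 hy]
    exact hv.distMatrix_two_mulVec_apply_self hG hbip hD
  · have hsum : ∑ y, u y = 0 := by
      have hAu := apply_eq_zero_of_lt_endpoint hc (x := x)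
        (hW.1 _ distMatrix_one_mem u hu) (y := x) (by simp [h])
      rw [distMatrix_mulVec_apply] at hAu
      rw [← hAu]
      exact (Finset.sum_filter_of_ne fun y _ hy => not_imp_comm.1 (hsupp y) hy).symm
    rw [← (isLadder_one hc hbip hsupp hsum).ladder_eq hG hbip hu0 hW hu] at hw
    exact hermitian_eq_zero_of_mem_ladder hsupp hv.supp hv.ann hw

lemma mem_spaceU_iff (hG : IsDistanceRegularWith G p) (hbip : G.IsBipartite) (hD : 2 ≤ G.diam)
    {v : X → ℂ} : v ∈ spaceU G x ↔ IsPrimitive G x v := by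
  refine ⟨isPrimitive_of_mem_spaceU hG.connected (by omega), fun hv =>
    (mem_spaceU_iff_forall_hermitian_eq_zero hG.connected).2 ⟨hv.supp, fun w hw => ?_⟩⟩
  have hle : sSup {W | IsIrreducibleTModule G x W ∧ endpoint G x W ≤ 1} ≤
      perp (Submodule.span ℂ {v}) := by
    refine sSup_le fun W hW => le_perp_symm ?_
    rw [Submodule.span_singleton_le_iff_mem]
    exact fun w hw => hv.hermitian_eq_zero hG hbip hD hW.1 hW.2 hw
  exact hermitian_eq_zero_symm (hle hw v (Submodule.mem_span_singleton_self v))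

lemma mem_eigenspaceU_iff (hG : IsDistanceRegularWith G p) (hbip : G.IsBipartite)
    (hD : 2 ≤ G.diam) {η : ℝ} {v : X → ℂ} :
    v ∈ eigenspaceU G x η ↔ IsPrimitive G x v ∧ localMatrix G x *ᵥ v = (η : ℂ) • v := by
  rw [eigenspaceU, Submodule.mem_inf, mem_spaceU_iff hG hbip hD, Module.End.mem_eigenspace_iff,
    mulVecLin_apply]

end Endpoint

/-! ### Vectors of `U` with an extremal local eigenvalue -/

section Extremal

open Polynomial

variable {X : Type*} [Fintype X] {G : SimpleGraph X} {p : ℕ → ℕ → ℕ → ℕ} {x : X}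

lemma radial_mulVec_apply (hc : G.Connected) (hbip : G.IsBipartite) {v : X → ℂ}
    (hv : ∀ y, G.dist x y ≠ 2 → v y = 0) (g : ℕ → ℂ) (y : X) :
    (radial G g *ᵥ v) y = g (G.dist x y - 2) * lowerSum G x 2 v y +
      g (G.dist x y) * (distMatrix ℂ G (G.dist x y) *ᵥ v) y +
      g (G.dist x y + 2) * upperSum G x 2 v y := by
  rw [lowerSum, distMatrix_mulVec_apply, upperSum, Finset.sum_filter, Finset.sum_filter,
    Finset.sum_filter, Finset.mul_sum, Finset.mul_sum, Finset.mul_sum, ← Finset.sum_add_distrib,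
    ← Finset.sum_add_distrib]
  refine Finset.sum_congr rfl fun z _ => ?_
  change g (G.dist y z) * v z = _
  by_cases hz : G.dist x z = 2
  · obtain ⟨r, hr⟩ := even_dist_add_dist_add_dist hc hbip x y z
    have hyxz := hc.dist_triangle (u := y) (v := x) (w := z)
    have hxzy := hc.dist_triangle (u := x) (v := z) (w := y)
    rw [G.dist_comm (u := y) (v := x)] at hyxz
    rw [G.dist_comm (u := z) (v := y)] at hxzy
    have hcases : G.dist y z + 2 = G.dist x y ∨ G.dist y z = G.dist x y ∨
        G.dist y z = G.dist x y + 2 := by omega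
    rcases hcases with h | h | h
    · simp [hz, ← h, add_assoc]
    · simp [hz, h]
    · simp [hz, h, add_assoc]
  · simp [hv z hz]

lemma IsPrimitive.lowerSum_add_add_upperSum {v : X → ℂ} (hv : IsPrimitive G x v)
    (hG : IsDistanceRegularWith G p) (hbip : G.IsBipartite) (hD : 2 ≤ G.diam) (y : X) :
    lowerSum G x 2 v y + (distMatrix ℂ G (G.dist x y) *ᵥ v) y + upperSum G x 2 v y = 0 := by
  have hone := radial_mulVec_apply hG.connected hbip hv.supp 1 y
  simp only [Pi.one_apply, one_mul] at hone
  rw [← hone, ← hv.sum_eq_zero hG hbip hD, mulVec, dotProduct]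
  simp only [radial_apply, Pi.one_apply, one_mul]

lemma IsPrimitive.upperSum_eq_zero_of_lt {v : X → ℂ} (hv : IsPrimitive G x v)
    (hG : IsDistanceRegularWith G p) (hbip : G.IsBipartite) (hD : 2 ≤ G.diam) {y : X}
    (hy : G.dist x y < 2) : upperSum G x 2 v y = 0 := by
  have hadd := hv.lowerSum_add_add_upperSum hG hbip hD y
  have hmiddle : (distMatrix ℂ G (G.dist x y) *ᵥ v) y = 0 := by
    obtain h | h : G.dist x y = 0 ∨ G.dist x y = 1 := by omega
    · obtain rfl := hG.connected.dist_eq_zero_iff.1 h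
      rw [h, distMatrix_mulVec_apply]
      exact Finset.sum_eq_zero fun z hz => hv.supp z (by simp [(Finset.mem_filter.1 hz).2])
    · rw [h, hv.ann y h]
  rwa [lowerSum_eq_zero_of_lt v hy, hmiddle, zero_add, zero_add] at hadd

lemma upperSum_eq_zero_of_diam_lt (hc : G.Connected) {r : ℕ} (v : X → ℂ) {y : X}
    (hy : G.diam < G.dist x y + r) : upperSum G x r v y = 0 := by
  refine Finset.sum_eq_zero fun z hz => ?_
  have hdist := (Finset.mem_filter.1 hz).2.2
  have hle := dist_le_diam hc y z
  omega

lemma IsCosine.distMatrix_one_mul_radial {θ : ℝ} {u : ℕ → ℝ} (hu : IsCosine G p θ u)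
    (hG : IsDistanceRegularWith G p) (hbip : G.IsBipartite) :
    distMatrix ℂ G 1 * radial G (fun i => (u i : ℂ)) =
      (θ : ℂ) • radial G (fun i => (u i : ℂ)) := by
  rw [Subconstituent.distMatrix_one_mul_radial hG hbip]
  ext y z
  rw [Matrix.smul_apply, radial_apply, radial_apply, smul_eq_mul, ← Complex.ofReal_mul,
    ← hu.neighborSum_eq _ (dist_le_diam hG.connected y z)]
  simp [neighborSum_apply]

lemma IsCosine.exists_radial_mulVec_radial_mulVec_eq_smul {θ : ℝ} {u : ℕ → ℝ}
    (hu : IsCosine G p θ u) (hG : IsDistanceRegularWith G p) (hbip : G.IsBipartite) (v : X → ℂ) :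
    ∃ c : ℂ, radial G (fun i => (u i : ℂ)) *ᵥ (radial G (fun i => (u i : ℂ)) *ᵥ v) =
      c • (radial G (fun i => (u i : ℂ)) *ᵥ v) := by
  classical
  obtain ⟨q, hq⟩ : ∃ q : ℂ[X], aeval (distMatrix ℂ G 1) q = radial G (fun i => (u i : ℂ)) := by
    have hmem := radial_mem_boseMesner hG hbip (fun i => (u i : ℂ))
    rwa [boseMesner, Algebra.adjoin_singleton_eq_range_aeval] at hmem
  have heig : distMatrix ℂ G 1 *ᵥ (radial G (fun i => (u i : ℂ)) *ᵥ v) =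
      (θ : ℂ) • (radial G (fun i => (u i : ℂ)) *ᵥ v) := by
    rw [mulVec_mulVec, hu.distMatrix_one_mul_radial hG hbip, smul_mulVec]
  have hmul := aeval_mulVec_of_mulVec_eq_smul heig q
  rw [hq] at hmul
  exact ⟨_, hmul⟩

lemma IsPrimitive.sub_mul_lowerSum_eq {v : X → ℂ} (hv : IsPrimitive G x v)
    (hG : IsDistanceRegularWith G p) (hbip : G.IsBipartite) (hD : 2 ≤ G.diam) {g : ℕ → ℂ}
    (hg : radial G g *ᵥ v = 0) (y : X) :
    (g (G.dist x y - 2) - g (G.dist x y)) * lowerSum G x 2 v y =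
      (g (G.dist x y) - g (G.dist x y + 2)) * upperSum G x 2 v y := by
  have hexpand := radial_mulVec_apply hG.connected hbip hv.supp g y
  rw [hg, Pi.zero_apply] at hexpand
  linear_combination -hexpand - g (G.dist x y) * hv.lowerSum_add_add_upperSum hG hbip hD y

lemma IsPrimitive.isLadder_of_radial_mulVec_eq_zero {v : X → ℂ} (hv : IsPrimitive G x v)
    (hG : IsDistanceRegularWith G p) (hbip : G.IsBipartite) (hD : 2 ≤ G.diam) {g : ℕ → ℂ}
    (hne : ∀ j, j + 2 ≤ G.diam → g j ≠ g (j + 2)) (hg : radial G g *ᵥ v = 0) :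
    IsLadder G x 2 v := by
  refine ⟨hv.supp, fun j => (g j - g (j + 2)) / (g (j - 2) - g j),
    fun j => if j + 2 ≤ G.diam then (g (j - 2) - g j) / (g j - g (j + 2)) else 0, fun y => ?_⟩
  have hrel := hv.sub_mul_lowerSum_eq hG hbip hD hg y
  have hle := dist_le_diam hG.connected x y
  rcases Nat.lt_or_ge (G.dist x y) 2 with h | h
  · rw [lowerSum_eq_zero_of_lt v h, hv.upperSum_eq_zero_of_lt hG hbip hD h, mul_zero, mul_zero]
    exact ⟨rfl, rfl⟩
  have hlower := sub_ne_zero.2 (hne (G.dist x y - 2) (by omega))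
  rw [Nat.sub_add_cancel h] at hlower
  refine ⟨by field_simp; linear_combination hrel, ?_⟩
  dsimp only
  split_ifs with hle'
  · have hupper := sub_ne_zero.2 (hne _ hle')
    field_simp
    linear_combination -hrel
  · rw [upperSum_eq_zero_of_diam_lt hG.connected v (not_le.1 hle'), zero_mul]

variable [DecidableEq X]

lemma distMatrix_two_mulVec_apply_of_localMatrix_mulVec_eq_smul {v : X → ℂ}
    (hv : ∀ y, G.dist x y ≠ 2 → v y = 0) {η : ℂ} (hη : localMatrix G x *ᵥ v = η • v) {y : X}
    (hy : G.dist x y = 2) : (distMatrix ℂ G 2 *ᵥ v) y = η * v y := by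
  rw [localMatrix, ← mulVec_mulVec, dualIdempotent_mulVec_eq_self hv, ← mulVec_mulVec] at hη
  have hηy := congrFun hη y
  rwa [dualIdempotent_mulVec_apply, if_pos hy] at hηy

lemma IsPrimitive.radial_mulVec_apply_eq_zero {v : X → ℂ} (hv : IsPrimitive G x v)
    (hG : IsDistanceRegularWith G p) (hbip : G.IsBipartite) (hD : 2 ≤ G.diam) {g : ℕ → ℂ} {η : ℂ}
    (hid : g 0 + η * g 2 - (1 + η) * g 4 = 0) (hη : localMatrix G x *ᵥ v = η • v) {y : X}
    (hy : G.dist x y = 2) : (radial G g *ᵥ v) y = 0 := by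
  have hadd := hv.lowerSum_add_add_upperSum hG hbip hD y
  have hlocal := distMatrix_two_mulVec_apply_of_localMatrix_mulVec_eq_smul hv.supp hη hy
  rw [lowerSum_of_dist_eq hG.connected v hy, hy, hlocal] at hadd
  rw [radial_mulVec_apply hG.connected hbip hv.supp, lowerSum_of_dist_eq hG.connected v hy, hy,
    hlocal]
  linear_combination g 4 * hadd + v y * hid

lemma IsPrimitive.radial_cosine_mulVec_eq_zero {v : X → ℂ} (hv : IsPrimitive G x v)
    (hG : IsDistanceRegularWith G p) (hbip : G.IsBipartite) (hD : 2 ≤ G.diam) {θ η : ℝ}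
    {u : ℕ → ℝ} (hu : IsCosine G p θ u) (hid : 1 + η * u 2 - (1 + η) * u 4 = 0)
    (hη : localMatrix G x *ᵥ v = (η : ℂ) • v) : radial G (fun i => (u i : ℂ)) *ᵥ v = 0 := by
  have hidC : (u 0 : ℂ) + η * u 2 - (1 + η) * u 4 = 0 := by
    rw [hu.zero]
    exact_mod_cast hid
  have hherm : (radial G fun i => (u i : ℂ))ᴴ = radial G fun i => (u i : ℂ) := by
    ext y z
    simp [radial_apply, G.dist_comm (u := z)]
  have horth : hermitian v (radial G (fun i => (u i : ℂ)) *ᵥ v) = 0 := by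
    rw [hermitian_congr_right (g := 0), hermitian_zero_right]
    exact fun y hy => hv.radial_mulVec_apply_eq_zero hG hbip hD hidC hη
      (not_imp_comm.1 (hv.supp y) hy)
  obtain ⟨c, hsq⟩ := hu.exists_radial_mulVec_radial_mulVec_eq_smul hG hbip v
  rw [← hermitian_self_eq_zero, hermitian_mulVec_left, hherm, hsq, hermitian_smul_right, horth,
    mul_zero]

lemma IsPrimitive.isLadder {v : X → ℂ} (hv : IsPrimitive G x v)
    (hG : IsDistanceRegularWith G p) (hbip : G.IsBipartite) (hD : 2 ≤ G.diam) {θ η : ℝ}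
    {u : ℕ → ℝ} (hu : IsCosine G p θ u) (hne : ∀ j, j + 2 ≤ G.diam → u j ≠ u (j + 2))
    (hid : 1 + η * u 2 - (1 + η) * u 4 = 0) (hη : localMatrix G x *ᵥ v = (η : ℂ) • v) :
    IsLadder G x 2 v :=
  hv.isLadder_of_radial_mulVec_eq_zero hG hbip hD (fun j hj => by exact_mod_cast hne j hj)
    (hv.radial_cosine_mulVec_eq_zero hG hbip hD hu hid hη)

end Extremal

/-! ### Multiplicities of modules -/

section Multiplicity

variable {X : Type*} [Fintype X] [DecidableEq X] {G : SimpleGraph X} {p : ℕ → ℕ → ℕ → ℕ} {x : X}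

lemma isPrimitive_iff {v : X → ℂ} : IsPrimitive G x v ↔
    (1 - dualIdempotent G x 2) *ᵥ v = 0 ∧ (dualIdempotent G x 1 * distMatrix ℂ G 1) *ᵥ v = 0 := by
  have hsupp : (1 - dualIdempotent G x 2) *ᵥ v = 0 ↔ ∀ y, G.dist x y ≠ 2 → v y = 0 := by
    rw [funext_iff]
    refine forall_congr' fun y => ?_
    rw [sub_mulVec, one_mulVec, Pi.sub_apply, dualIdempotent_mulVec_apply]
    by_cases hy : G.dist x y = 2 <;> simp [hy]
  have hann : (dualIdempotent G x 1 * distMatrix ℂ G 1) *ᵥ v = 0 ↔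
      ∀ y, G.dist x y = 1 → (distMatrix ℂ G 1 *ᵥ v) y = 0 := by
    rw [funext_iff]
    refine forall_congr' fun y => ?_
    rw [← mulVec_mulVec, dualIdempotent_mulVec_apply]
    by_cases hy : G.dist x y = 1 <;> simp [hy]
  rw [hsupp, hann]
  exact ⟨fun h => ⟨h.supp, h.ann⟩, fun h => ⟨h.1, h.2⟩⟩

lemma mem_eigenspaceU_of_annihilator_le (hG : IsDistanceRegularWith G p) (hbip : G.IsBipartite)
    (hD : 2 ≤ G.diam) {η : ℝ} {v w : X → ℂ} (hv : v ∈ eigenspaceU G x η)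
    (h : ∀ B ∈ subconstituentAlgebra G x, B *ᵥ v = 0 → B *ᵥ w = 0) : w ∈ eigenspaceU G x η := by
  have hE := dualIdempotent_mem (x := x) hG.connected
  have heig (u : X → ℂ) : (localMatrix G x - (η : ℂ) • 1) *ᵥ u = 0 ↔
      localMatrix G x *ᵥ u = (η : ℂ) • u := by
    rw [sub_mulVec, smul_mulVec, one_mulVec, sub_eq_zero]
  rw [mem_eigenspaceU_iff hG hbip hD, isPrimitive_iff, ← heig] at hv ⊢
  obtain ⟨⟨hsupp, hann⟩, heta⟩ := hv
  exact ⟨⟨h _ (sub_mem (one_mem _) (hE 2)) hsupp, h _ (mul_mem (hE 1) distMatrix_one_mem) hann⟩,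
    h _ (sub_mem (localMatrix_mem hG hbip) (Subalgebra.smul_mem _ (one_mem _) _)) heta⟩

section LadderSpace

variable {r : ℕ} {M : Submodule ℂ (X → ℂ)}

/- A linear endomorphism having every vector as an eigenvector is a homothety. -/
lemma exists_forall_dualIdempotent_mulVec_eq_smul (hG : IsDistanceRegularWith G p)
    (hbip : G.IsBipartite) (hM : ∀ v ∈ M, IsLadder G x r v) {B : Matrix X X ℂ}
    (hB : B ∈ subconstituentAlgebra G x) :
    ∃ c : ℂ, ∀ v ∈ M, dualIdempotent G x r *ᵥ (B *ᵥ v) = c • v := by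
  have hsmul (v : X → ℂ) (hv : v ∈ M) : ∃ c : ℂ, dualIdempotent G x r *ᵥ (B *ᵥ v) = c • v :=
    dualIdempotent_mulVec_eq_smul_of_mem_ladder hG.connected (hM v hv).supp
      ((hM v hv).isTModule hG hbip B hB v (self_mem_ladder hG.connected (hM v hv).supp))
  let f : M →ₗ[ℂ] M := ((dualIdempotent G x r).mulVecLin ∘ₗ B.mulVecLin).restrict fun v hv => by
    obtain ⟨c, hc⟩ := hsmul v hv
    rw [LinearMap.comp_apply, mulVecLin_apply, mulVecLin_apply, hc]
    exact M.smul_mem c hv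
  obtain ⟨c, hc⟩ : ∃ c : ℂ, f = c • 1 := by
    refine LinearMap.exists_eq_smul_id_of_forall_notLinearIndependent fun v hind => ?_
    obtain ⟨c, hc⟩ := hsmul v v.2
    have hfv : f v = c • v := Subtype.ext hc
    have hzero := LinearIndependent.pair_iff.1 hind c (-1)
      (by rw [hfv, neg_one_smul, add_neg_cancel])
    exact neg_ne_zero.2 one_ne_zero hzero.2
  exact ⟨c, fun v hv => congrArg Subtype.val (LinearMap.congr_fun hc ⟨v, hv⟩)⟩

lemma mulVec_eq_zero_of_mulVec_eq_zero (hG : IsDistanceRegularWith G p) (hbip : G.IsBipartite)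
    (hM : ∀ v ∈ M, IsLadder G x r v) {v w : X → ℂ} (hv : v ∈ M) (hw : w ∈ M) (hv0 : v ≠ 0)
    {B : Matrix X X ℂ} (hB : B ∈ subconstituentAlgebra G x) (h : B *ᵥ v = 0) : B *ᵥ w = 0 := by
  obtain ⟨c, hc⟩ := exists_forall_dualIdempotent_mulVec_eq_smul hG hbip hM
    (mul_mem (conjTranspose_mem hB) hB)
  have hc0 : c = 0 := by
    have hcv := hc v hv
    rw [← mulVec_mulVec, h, mulVec_zero, mulVec_zero] at hcv
    exact (smul_eq_zero.1 hcv.symm).resolve_right hv0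
  rw [← hermitian_self_eq_zero]
  calc hermitian (B *ᵥ w) (B *ᵥ w)
    _ = hermitian (dualIdempotent G x r *ᵥ w) ((Bᴴ * B) *ᵥ w) := by
        rw [hermitian_mulVec_left, mulVec_mulVec, dualIdempotent_mulVec_eq_self (hM w hw).supp]
    _ = 0 := by
        rw [hermitian_mulVec_left, dualIdempotent_conjTranspose, hc w hw, hc0, zero_smul,
          hermitian_zero_right]

lemma IsIrreducibleTModule.exists_eq_smul {W : Submodule ℂ (X → ℂ)}
    (hW : IsIrreducibleTModule G x W) (hG : IsDistanceRegularWith G p) (hbip : G.IsBipartite)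
    {v w : X → ℂ} (hv : IsLadder G x r v) (hv0 : v ≠ 0) (hvW : v ∈ W)
    (hw : ∀ y, G.dist x y ≠ r → w y = 0) (hwW : w ∈ W) : ∃ c : ℂ, w = c • v := by
  rw [← hv.ladder_eq hG hbip hv0 hW hvW] at hwW
  obtain ⟨c, hc⟩ := dualIdempotent_mulVec_eq_smul_of_mem_ladder hG.connected hv.supp hwW
  exact ⟨c, by rw [← hc, dualIdempotent_mulVec_eq_self hw]⟩

end LadderSpace

/-- The map `B ↦ B v` on the algebra `T`, whose range is the `T`-module generated by `v`. -/
def orbitMap (G : SimpleGraph X) (x : X) (v : X → ℂ) :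
    subconstituentAlgebra G x →ₗ[ℂ] (X → ℂ) where
  toFun B := (B : Matrix X X ℂ) *ᵥ v
  map_add' _ _ := add_mulVec _ _ _
  map_smul' _ _ := smul_mulVec _ _ _

lemma range_orbitMap {W : Submodule ℂ (X → ℂ)} (hW : IsIrreducibleTModule G x W) {v : X → ℂ}
    (hv : v ∈ W) (hv0 : v ≠ 0) : LinearMap.range (orbitMap G x v) = W := by
  refine hW.eq_of_le ?_ ((Submodule.ne_bot_iff _).2 ⟨v, ⟨1, one_mulVec v⟩, hv0⟩) ?_
  · rintro B hB _ ⟨C, rfl⟩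
    exact ⟨⟨B, hB⟩ * C, (mulVec_mulVec _ _ _).symm⟩
  · rintro _ ⟨B, rfl⟩
    exact hW.1 _ B.2 v hv

lemma exists_linearEquiv_of_annihilator_eq {W W' : Submodule ℂ (X → ℂ)}
    (hW : IsIrreducibleTModule G x W) (hW' : IsIrreducibleTModule G x W') {v v' : X → ℂ}
    (hv : v ∈ W) (hv' : v' ∈ W') (hv0 : v ≠ 0) (hv0' : v' ≠ 0)
    (h : ∀ B ∈ subconstituentAlgebra G x, B *ᵥ v = 0 ↔ B *ᵥ v' = 0) :
    ∃ σ : W ≃ₗ[ℂ] W', ∀ B ∈ subconstituentAlgebra G x, ∀ w : W,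
      (w : X → ℂ) = B *ᵥ v → (σ w : X → ℂ) = B *ᵥ v' := by
  have hker : LinearMap.ker (orbitMap G x v) = LinearMap.ker (orbitMap G x v') :=
    Submodule.ext fun B => h _ B.2
  have hrange := range_orbitMap hW hv hv0
  refine ⟨LinearEquiv.ofEq _ _ hrange.symm ≪≫ₗ (orbitMap G x v).quotKerEquivRange.symm ≪≫ₗ
    Submodule.quotEquivOfEq _ _ hker ≪≫ₗ (orbitMap G x v').quotKerEquivRange ≪≫ₗ
    LinearEquiv.ofEq _ _ (range_orbitMap hW' hv' hv0'), fun B hB w hw => ?_⟩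
  have hsymm : (orbitMap G x v).quotKerEquivRange.symm (LinearEquiv.ofEq _ _ hrange.symm w) =
      Submodule.Quotient.mk ⟨B, hB⟩ := by
    rw [LinearEquiv.symm_apply_eq]
    exact Subtype.ext hw
  simp only [LinearEquiv.trans_apply]
  rw [hsymm, Submodule.quotEquivOfEq_mk, LinearEquiv.coe_ofEq_apply,
    LinearMap.quotKerEquivRange_apply_mk]
  rfl

lemma tIsomorphic_of_annihilator_eq {W W' : Submodule ℂ (X → ℂ)}
    (hW : IsIrreducibleTModule G x W) (hW' : IsIrreducibleTModule G x W') {v v' : X → ℂ}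
    (hv : v ∈ W) (hv' : v' ∈ W') (hv0 : v ≠ 0) (hv0' : v' ≠ 0)
    (h : ∀ B ∈ subconstituentAlgebra G x, B *ᵥ v = 0 ↔ B *ᵥ v' = 0) : TIsomorphic G x W W' := by
  obtain ⟨σ, hσ⟩ := exists_linearEquiv_of_annihilator_eq hW hW' hv hv' hv0 hv0' h
  refine ⟨σ, fun B hB w w₁ hw => ?_⟩
  obtain ⟨⟨C, hC⟩, hCw⟩ : (w : X → ℂ) ∈ LinearMap.range (orbitMap G x v) :=
    range_orbitMap hW hv hv0 ▸ w.2
  have hCw : C *ᵥ v = w := hCw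
  rw [hσ C hC w hCw.symm, hσ (B * C) (mul_mem hB hC) w₁ (by rw [hw, ← hCw, mulVec_mulVec]),
    mulVec_mulVec]

lemma exists_annihilator_le_of_tIsomorphic {Z W : Submodule ℂ (X → ℂ)} (hZ : IsTModule G x Z)
    (h : TIsomorphic G x Z W) {w : X → ℂ} (hw : w ∈ W) (hw0 : w ≠ 0) :
    ∃ z ∈ Z, z ≠ 0 ∧ ∀ B ∈ subconstituentAlgebra G x, B *ᵥ w = 0 → B *ᵥ z = 0 := by
  obtain ⟨σ, hσ⟩ := h
  obtain ⟨z, hz⟩ := σ.surjective ⟨w, hw⟩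
  have hzw : (σ z : X → ℂ) = w := congrArg Subtype.val hz
  refine ⟨z, z.2, fun hz0 => hw0 ?_, fun B hB hBw => ?_⟩
  · have hz0 : z = 0 := Subtype.ext hz0
    rw [← hzw, hz0, map_zero, Submodule.coe_zero]
  · have hσBz := hσ B hB z ⟨B *ᵥ z, hZ B hB _ z.2⟩ rfl
    rw [hzw, hBw] at hσBz
    exact congrArg Subtype.val ((LinearEquiv.map_eq_zero_iff σ).1 (Subtype.ext hσBz))

namespace IsOrthogonalDecomposition

variable {m : ℕ} {Z : Fin m → Submodule ℂ (X → ℂ)}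

lemma exists_eq_sum (hZ : IsOrthogonalDecomposition G x Z) (v : X → ℂ) :
    ∃ f : Fin m → X → ℂ, (∀ i, f i ∈ Z i) ∧ ∑ i, f i = v := by
  have hv : v ∈ ⨆ i, Z i := hZ.direct_sum.submodule_iSup_eq_top ▸ Submodule.mem_top
  obtain ⟨f, hf, hfv⟩ := (Submodule.mem_iSup_iff_exists_finsupp Z v).1 hv
  exact ⟨f, hf, by rwa [Finsupp.sum_fintype _ _ fun _ => rfl] at hfv⟩

lemma mulVec_component_eq_zero (hZ : IsOrthogonalDecomposition G x Z) {f : Fin m → X → ℂ}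
    (hf : ∀ i, f i ∈ Z i) {B : Matrix X X ℂ} (hB : B ∈ subconstituentAlgebra G x)
    (h : B *ᵥ ∑ i, f i = 0) (i : Fin m) : B *ᵥ f i = 0 := by
  rw [← mulVecLin_apply, map_sum] at h
  exact (iSupIndep_iff_finsetSum_eq_zero_imp_eq_zero Z).1 hZ.direct_sum.submodule_iSupIndep
    Finset.univ (fun i => B *ᵥ f i) (fun i _ => (hZ.irreducible i).1 B hB _ (hf i)) h i
    (Finset.mem_univ i)

open Classical in
lemma card_eq_finrank_eigenspaceU (hZ : IsOrthogonalDecomposition G x Z)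
    (hG : IsDistanceRegularWith G p) (hbip : G.IsBipartite) (hD : 2 ≤ G.diam) {η : ℝ}
    (hL : ∀ v ∈ eigenspaceU G x η, IsLadder G x 2 v) :
    #{i | ∃ z ∈ Z i, z ≠ 0 ∧ z ∈ eigenspaceU G x η} = Module.finrank ℂ (eigenspaceU G x η) := by
  let N := {i // ∃ z ∈ Z i, z ≠ 0 ∧ z ∈ eigenspaceU G x η}
  choose z hzZ hz0 hzU using fun i : N => i.2
  have hlin : LinearIndependent ℂ z :=
    (hZ.direct_sum.submodule_iSupIndep.comp Subtype.val_injective).linearIndependent _ hzZ hz0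
  have hspan : Submodule.span ℂ (Set.range z) = eigenspaceU G x η := by
    refine le_antisymm (Submodule.span_le.2 (Set.range_subset_iff.2 hzU)) fun v hv => ?_
    obtain ⟨f, hf, rfl⟩ := hZ.exists_eq_sum v
    refine Submodule.sum_mem _ fun i _ => ?_
    have hfU : f i ∈ eigenspaceU G x η := mem_eigenspaceU_of_annihilator_le hG hbip hD hv
      fun B hB hBv => hZ.mulVec_component_eq_zero hf hB hBv i
    by_cases hfi : f i = 0
    · exact hfi ▸ zero_mem _
    · let j : N := ⟨i, f i, hf i, hfi, hfU⟩
      obtain ⟨c, hc⟩ := (hZ.irreducible i).exists_eq_smul hG hbip (hL _ (hzU j)) (hz0 j) (hzZ j)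
        (hL _ hfU).supp (hf i)
      exact hc ▸ Submodule.smul_mem _ _ (Submodule.subset_span ⟨j, rfl⟩)
  have hcard := finrank_span_eq_card hlin
  rw [hspan, Fintype.card_subtype] at hcard
  exact hcard.symm

end IsOrthogonalDecomposition

lemma IsThinWithLocalEigenvalue.exists_mem_eigenspaceU {η : ℝ} {W : Submodule ℂ (X → ℂ)}
    (hW : IsThinWithLocalEigenvalue G x η W) (hG : IsDistanceRegularWith G p)
    (hbip : G.IsBipartite) (hD : 2 ≤ G.diam) : ∃ w ∈ W, w ≠ 0 ∧ w ∈ eigenspaceU G x η := by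
  have hc := hG.connected
  have hT := hW.irreducible.1
  obtain ⟨w, hw, hw0, hsupp⟩ := hW.irreducible.exists_mem_layer_endpoint hc
  rw [hW.endpoint_eq] at hsupp
  refine ⟨w, hw, hw0, (mem_eigenspaceU_iff hG hbip hD).2 ⟨⟨hsupp, fun y hy => ?_⟩,
    hW.local_eigenvalue w ((mem_image_dualIdempotent hc hT).2 ⟨hw, hsupp⟩)⟩⟩
  exact apply_eq_zero_of_lt_endpoint hc (x := x) (hT _ distMatrix_one_mem w hw)
    (by rw [hW.endpoint_eq, hy]; exact one_lt_two)

lemma IsLadder.isThinWithLocalEigenvalue {η : ℝ} {v : X → ℂ} (hv : IsLadder G x 2 v)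
    (hG : IsDistanceRegularWith G p) (hbip : G.IsBipartite) (hD : 2 ≤ G.diam) (hv0 : v ≠ 0)
    (hη : localMatrix G x *ᵥ v = (η : ℂ) • v) :
    IsThinWithLocalEigenvalue G x η (ladder G x 2 v) where
  irreducible := hv.isIrreducible hG hbip hv0
  thin := isThin_ladder v
  endpoint_eq := hv.endpoint_eq hG hbip hD hv0
  local_eigenvalue := by
    rintro _ ⟨w, hw, rfl⟩
    obtain ⟨c, hc⟩ := dualIdempotent_mulVec_eq_smul_of_mem_ladder hG.connected hv.supp hw
    rw [mulVecLin_apply, hc, mulVec_smul, hη, smul_comm]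

lemma IsThinWithLocalEigenvalue.tIsomorphic_iff {η : ℝ} {W Z : Submodule ℂ (X → ℂ)}
    (hW : IsThinWithLocalEigenvalue G x η W) (hG : IsDistanceRegularWith G p)
    (hbip : G.IsBipartite) (hD : 2 ≤ G.diam) (hL : ∀ v ∈ eigenspaceU G x η, IsLadder G x 2 v)
    (hZ : IsIrreducibleTModule G x Z) :
    TIsomorphic G x Z W ↔ ∃ z ∈ Z, z ≠ 0 ∧ z ∈ eigenspaceU G x η := by
  obtain ⟨w, hw, hw0, hwU⟩ := hW.exists_mem_eigenspaceU hG hbip hD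
  constructor
  · intro h
    obtain ⟨z, hz, hz0, hann⟩ := exists_annihilator_le_of_tIsomorphic hZ.1 h hw hw0
    exact ⟨z, hz, hz0, mem_eigenspaceU_of_annihilator_le hG hbip hD hwU hann⟩
  · rintro ⟨z, hz, hz0, hzU⟩
    exact tIsomorphic_of_annihilator_eq hZ hW.irreducible hz hw hz0 hw0 fun B hB =>
      ⟨mulVec_eq_zero_of_mulVec_eq_zero hG hbip hL hzU hwU hz0 hB,
        mulVec_eq_zero_of_mulVec_eq_zero hG hbip hL hwU hzU hw0 hB⟩

lemma isMu_finrank_eigenspaceU (hG : IsDistanceRegularWith G p) (hbip : G.IsBipartite)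
    (hD : 2 ≤ G.diam) {η : ℝ} (hL : ∀ v ∈ eigenspaceU G x η, IsLadder G x 2 v) :
    IsMu G x η (Module.finrank ℂ (eigenspaceU G x η)) := by
  classical
  refine ⟨fun W hW => ⟨exists_isOrthogonalDecomposition G x, fun m Z hZ => ?_⟩, fun h => ?_⟩
  · rw [← hZ.card_eq_finrank_eigenspaceU hG hbip hD hL]
    exact congrArg Finset.card <| Finset.filter_congr fun i _ =>
      hW.tIsomorphic_iff hG hbip hD hL (hZ.irreducible i)
  · rw [Submodule.finrank_eq_zero]
    by_contra hbot
    obtain ⟨v, hv, hv0⟩ := Submodule.exists_mem_ne_zero_of_ne_bot hbot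
    exact h ⟨_, (hL v hv).isThinWithLocalEigenvalue hG hbip hD hv0
      ((mem_eigenspaceU_iff hG hbip hD).1 hv).2⟩

end Multiplicity

/-! ### Multiplicities of local eigenvalues -/

section LocalSpectrum

lemma isSemisimple_mulVecLin {n : Type*} [Fintype n] {H : Matrix n n ℂ} (hH : H.IsHermitian) :
    Module.End.IsSemisimple H.mulVecLin := by
  refine Module.End.isSemisimple_iff.2 fun W hW => ⟨perp W, fun v hv w hw => ?_, ?_, ?_⟩
  · rw [mulVecLin_apply, hermitian_mulVec_left, hH.eq]
    exact hv _ (hW hw)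
  · exact disjoint_iff.2 (inf_perp_eq_bot W)
  · rw [codisjoint_iff, ← top_inf_eq (perp W), sup_inf_perp_eq le_top]

lemma rootMultiplicity_charpoly_eq_finrank_eigenspace {n : Type*} [Fintype n] [DecidableEq n]
    {H : Matrix n n ℂ} (hH : H.IsHermitian) (t : ℂ) :
    H.charpoly.rootMultiplicity t =
      Module.finrank ℂ (Module.End.eigenspace H.mulVecLin t) := by
  rw [← charpoly_mulVecLin, ← LinearMap.finrank_maxGenEigenspace_eq,
    Module.End.IsFinitelySemisimple.maxGenEigenspace_eq_eigenspace
      (isSemisimple_mulVecLin hH).isFinitelySemisimple]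

lemma finrank_map_add_finrank_inf_ker {K V W : Type*} [DivisionRing K] [AddCommGroup V] [Module K V]
    [FiniteDimensional K V] [AddCommGroup W] [Module K W] (f : V →ₗ[K] W) (S : Submodule K V) :
    Module.finrank K (S.map f) + Module.finrank K ↥(S ⊓ LinearMap.ker f) = Module.finrank K S := by
  rw [← LinearMap.range_domRestrict, ← LinearMap.finrank_range_add_finrank_ker (f.domRestrict S),
    LinearMap.ker_domRestrict, ← Submodule.map_comap_subtype, Submodule.finrank_map_subtype_eq]

variable {X : Type*} [Fintype X] [DecidableEq X] {G : SimpleGraph X} {p : ℕ → ℕ → ℕ → ℕ} {x : X}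

/-- The space `E*_i V` of the vectors supported on the vertices at distance `i` from `x`. -/
def layer (G : SimpleGraph X) (x : X) (i : ℕ) : Submodule ℂ (X → ℂ) :=
  image (dualIdempotent G x i) ⊤

lemma mem_layer (hc : G.Connected) {i : ℕ} {v : X → ℂ} :
    v ∈ layer G x i ↔ ∀ y, G.dist x y ≠ i → v y = 0 := by
  rw [layer, mem_image_dualIdempotent hc isTModule_top]
  exact and_iff_right Submodule.mem_top

lemma finrank_layer (hG : IsDistanceRegularWith G p) {i : ℕ} (hi : i ≤ G.diam) :
    Module.finrank ℂ (layer G x i) = p 0 i i := by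
  have hrank : Module.finrank ℂ (layer G x i) = (dualIdempotent G x i).rank := by
    rw [layer, image, Submodule.map_top, rank]
  rw [hrank, dualIdempotent, rank_diagonal, ← card_dist_eq hG hi x, Fintype.card_subtype]
  simp

/-- The eigenspace of `E*_2 A_2 E*_2` on `E*_2 V`. -/
def localEigenspace (G : SimpleGraph X) (x : X) (t : ℝ) : Submodule ℂ (X → ℂ) :=
  layer G x 2 ⊓ Module.End.eigenspace (localMatrix G x).mulVecLin (t : ℂ)

lemma mem_localEigenspace {t : ℝ} {v : X → ℂ} : v ∈ localEigenspace G x t ↔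
    v ∈ layer G x 2 ∧ localMatrix G x *ᵥ v = (t : ℂ) • v := by
  rw [localEigenspace, Submodule.mem_inf, Module.End.mem_eigenspace_iff, mulVecLin_apply]

lemma localMatrix_mulVec_of_mem_layer (hc : G.Connected) {v : X → ℂ} (hv : v ∈ layer G x 2) :
    localMatrix G x *ᵥ v = dualIdempotent G x 2 *ᵥ (distMatrix ℂ G 2 *ᵥ v) := by
  rw [localMatrix, ← mulVec_mulVec, dualIdempotent_mulVec_eq_self ((mem_layer hc).1 hv),
    mulVec_mulVec]

lemma localMatrix_mulVec_mem_layer (hc : G.Connected) (v : X → ℂ) :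
    localMatrix G x *ᵥ v ∈ layer G x 2 := by
  rw [mem_layer hc]
  intro y hy
  rw [localMatrix, mul_assoc, ← mulVec_mulVec, dualIdempotent_mulVec_apply, if_neg hy]

open Classical in
lemma adjMatrix_localGraph_mulVec_restrict (hc : G.Connected) {v : X → ℂ} (hv : v ∈ layer G x 2) :
    (localGraph G x).adjMatrix ℂ *ᵥ (v ∘ Subtype.val) =
      (localMatrix G x *ᵥ v) ∘ Subtype.val := by
  ext ⟨y, hy⟩
  rw [localMatrix_mulVec_of_mem_layer hc hv, Function.comp_apply, dualIdempotent_mulVec_apply,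
    if_pos hy, distMatrix_mulVec_apply, SimpleGraph.adjMatrix_mulVec_apply,
    SimpleGraph.neighborFinset_eq_filter, Finset.sum_filter, Finset.sum_filter]
  refine Fintype.sum_of_injective Subtype.val Subtype.val_injective _ _ (fun z hz => ?_)
    fun z => if_congr Iff.rfl rfl rfl
  rw [(mem_layer hc).1 hv z fun h => hz ⟨⟨z, h⟩, rfl⟩, ite_self]

open Classical in
lemma map_restrict_localEigenspace (hc : G.Connected) (t : ℝ) :
    (localEigenspace G x t).map (LinearMap.funLeft ℂ ℂ Subtype.val) =
      Module.End.eigenspace ((localGraph G x).adjMatrix ℂ).mulVecLin (t : ℂ) := by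
  ext f
  rw [Module.End.mem_eigenspace_iff, mulVecLin_apply]
  constructor
  · rintro ⟨v, hv, rfl⟩
    obtain ⟨hlayer, heig⟩ := mem_localEigenspace.1 hv
    change _ *ᵥ (v ∘ Subtype.val) = _
    rw [adjMatrix_localGraph_mulVec_restrict hc hlayer, heig]
    rfl
  · intro hf
    set v : X → ℂ := Function.extend Subtype.val f 0
    have hrestrict : v ∘ Subtype.val = f := Function.extend_comp Subtype.val_injective f 0
    have hlayer : v ∈ layer G x 2 := (mem_layer hc).2 fun y hy =>
      Function.extend_apply' _ _ _ fun ⟨z, hz⟩ => hy (hz ▸ z.2)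
    refine ⟨v, mem_localEigenspace.2 ⟨hlayer, funext fun y => ?_⟩, hrestrict⟩
    by_cases hy : G.dist x y = 2
    · have h := congrFun (adjMatrix_localGraph_mulVec_restrict hc hlayer) ⟨y, hy⟩
      rw [hrestrict, hf, ← hrestrict] at h
      exact h.symm
    · rw [(mem_layer hc).1 (localMatrix_mulVec_mem_layer hc v) y hy, Pi.smul_apply,
        (mem_layer hc).1 hlayer y hy, smul_zero]

lemma count_localSpectrum (hc : G.Connected) (t : ℝ) :
    (localSpectrum G x).count t = Module.finrank ℂ (localEigenspace G x t) := by
  classical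
  have hker : localEigenspace G x t ⊓
      LinearMap.ker (LinearMap.funLeft ℂ ℂ (Subtype.val : {y // G.dist x y = 2} → X)) = ⊥ := by
    refine eq_bot_iff.2 fun v ⟨hv, hker⟩ => funext fun y => ?_
    by_cases hy : G.dist x y = 2
    · exact congrFun hker ⟨y, hy⟩
    · exact (mem_layer hc).1 (mem_localEigenspace.1 hv).1 y hy
  have hmap : ((localGraph G x).adjMatrix ℝ).map Complex.ofRealHom =
      (localGraph G x).adjMatrix ℂ := by
    ext y z
    simp only [map_apply, SimpleGraph.adjMatrix_apply]
    split_ifs <;> simp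
  rw [← finrank_map_add_finrank_inf_ker (LinearMap.funLeft ℂ ℂ Subtype.val)
      (localEigenspace G x t), hker, finrank_bot, add_zero, map_restrict_localEigenspace hc,
    ← rootMultiplicity_charpoly_eq_finrank_eigenspace (SimpleGraph.isHermitian_adjMatrix ..),
    ← hmap, charpoly_map, localSpectrum, Polynomial.count_roots]
  exact Polynomial.eq_rootMultiplicity_map Complex.ofReal_injective t

lemma card_localSpectrum (hG : IsDistanceRegularWith G p) (hD : 2 ≤ G.diam) :
    (localSpectrum G x).card = p 0 2 2 := by
  classical
  have hN : ((localGraph G x).adjMatrix ℝ).IsHermitian := SimpleGraph.isHermitian_adjMatrix ..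
  rw [localSpectrum, ← hN.splits_charpoly.natDegree_eq_card_roots, charpoly_natDegree_eq_dim,
    ← card_dist_eq hG hD x, Fintype.card_subtype]

end LocalSpectrum

/-! ### The action of `A` and `A_2` on the layers one and two -/

section Layers

variable {X : Type*} {G : SimpleGraph X} {p : ℕ → ℕ → ℕ → ℕ} {x : X}

/-- The characteristic vector of the set of vertices at distance `i` from `x`. -/
def layerOnes (G : SimpleGraph X) (x : X) (i : ℕ) : X → ℂ :=
  sphericalMap ℂ G x fun j => if j = i then 1 else 0

lemma layerOnes_apply (i : ℕ) (y : X) :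
    layerOnes G x i y = if G.dist x y = i then 1 else 0 := rfl

lemma eq_or_dist_eq_two_of_dist_eq_one (hc : G.Connected) (hbip : G.IsBipartite) {y z : X}
    (hy : G.dist x y = 1) (hyz : G.dist y z = 1) : z = x ∨ G.dist x z = 2 := by
  have hstep := dist_eq_succ_or_succ_eq_of_dist_eq_one hc hbip hyz x
  rw [G.dist_comm (u := z), G.dist_comm (u := y), hy] at hstep
  rcases hstep with h | h
  · exact Or.inr h
  · exact Or.inl (hc.dist_eq_zero_iff.1 (by omega)).symm

variable [Fintype X]

lemma sum_layerOnes (hG : IsDistanceRegularWith G p) {i : ℕ} (hi : i ≤ G.diam) :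
    ∑ y, layerOnes G x i y = p 0 i i := by
  simp only [layerOnes_apply]
  rw [Finset.sum_boole, card_dist_eq hG hi]

lemma distMatrix_mulVec_apply_add_distMatrix_mulVec_apply {i j : ℕ} (hij : i ≠ j) {v : X → ℂ}
    {y : X} (h : ∀ z, v z ≠ 0 → G.dist y z = i ∨ G.dist y z = j) :
    (distMatrix ℂ G i *ᵥ v) y + (distMatrix ℂ G j *ᵥ v) y = ∑ z, v z := by
  rw [distMatrix_mulVec_apply, distMatrix_mulVec_apply, Finset.sum_filter, Finset.sum_filter,
    ← Finset.sum_add_distrib]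
  refine Finset.sum_congr rfl fun z _ => ?_
  by_cases hz : v z = 0
  · simp only [hz, ite_self, add_zero]
  · rcases h z hz with h | h
    · rw [if_pos h, if_neg (h.trans_ne hij), add_zero]
    · rw [if_neg (h.trans_ne hij.symm), if_pos h, zero_add]

variable [DecidableEq X]

lemma distMatrix_mulVec_apply_self_of_mem_layer (hc : G.Connected) {i : ℕ} {v : X → ℂ}
    (hv : v ∈ layer G x i) : (distMatrix ℂ G i *ᵥ v) x = ∑ y, v y := by
  rw [distMatrix_mulVec_apply, Finset.sum_filter]
  exact Finset.sum_congr rfl fun y _ => ite_eq_left_iff.2 fun h => ((mem_layer hc).1 hv y h).symm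

/-- The map `E*_1 A`. -/
def down (G : SimpleGraph X) (x : X) : (X → ℂ) →ₗ[ℂ] (X → ℂ) :=
  (dualIdempotent G x 1 * distMatrix ℂ G 1).mulVecLin

/-- The map `E*_2 A`. -/
def up (G : SimpleGraph X) (x : X) : (X → ℂ) →ₗ[ℂ] (X → ℂ) :=
  (dualIdempotent G x 2 * distMatrix ℂ G 1).mulVecLin

lemma down_apply (v : X → ℂ) (y : X) :
    down G x v y = if G.dist x y = 1 then (distMatrix ℂ G 1 *ᵥ v) y else 0 := by
  rw [down, mulVecLin_apply, ← mulVec_mulVec, dualIdempotent_mulVec_apply]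

lemma up_apply (v : X → ℂ) (y : X) :
    up G x v y = if G.dist x y = 2 then (distMatrix ℂ G 1 *ᵥ v) y else 0 := by
  rw [up, mulVecLin_apply, ← mulVec_mulVec, dualIdempotent_mulVec_apply]

lemma down_mem_layer (hc : G.Connected) (v : X → ℂ) : down G x v ∈ layer G x 1 :=
  (mem_layer hc).2 fun y hy => by rw [down_apply, if_neg hy]

lemma up_mem_layer (hc : G.Connected) (v : X → ℂ) : up G x v ∈ layer G x 2 :=
  (mem_layer hc).2 fun y hy => by rw [up_apply, if_neg hy]

lemma layerOnes_mem_layer (hc : G.Connected) (i : ℕ) : layerOnes G x i ∈ layer G x i :=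
  (mem_layer hc).2 fun y hy => by rw [layerOnes_apply, if_neg hy]

lemma down_dualIdempotent_mulVec (hc : G.Connected) (hbip : G.IsBipartite) (f : X → ℂ) :
    down G x (dualIdempotent G x 2 *ᵥ f) = down G x f - f x • layerOnes G x 1 := by
  ext y
  rw [Pi.sub_apply, Pi.smul_apply, down_apply, down_apply, layerOnes_apply]
  split_ifs with hy
  · have hx : f x = ∑ z with G.dist y z = 1, if z = x then f z else 0 := by
      rw [Finset.sum_ite_eq' _ x, if_pos]
      rw [Finset.mem_filter_univ, G.dist_comm, hy]
    rw [smul_eq_mul, mul_one, distMatrix_mulVec_apply, distMatrix_mulVec_apply, hx,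
      ← Finset.sum_sub_distrib]
    refine Finset.sum_congr rfl fun z hz => ?_
    rw [dualIdempotent_mulVec_apply]
    obtain rfl | hxz :=
      eq_or_dist_eq_two_of_dist_eq_one hc hbip hy ((Finset.mem_filter_univ z).1 hz)
    · rw [SimpleGraph.dist_self, if_neg (by decide), if_pos rfl, sub_self]
    · have hne : z ≠ x := by
        rintro rfl
        rw [SimpleGraph.dist_self] at hxz
        omega
      rw [if_pos hxz, if_neg hne, sub_zero]
  · rw [smul_zero, sub_zero]

-- For `i = 0` and `i = 1` this is the relation between `E*_1 A E*_2` and, respectively, its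
-- adjoint and `E*_2 A_2 E*_2`.
lemma down_dualIdempotent_mulVec_distMatrix_mulVec (hG : IsDistanceRegularWith G p)
    (hbip : G.IsBipartite) {i : ℕ} (hi : i + 2 ≤ G.diam) {v : X → ℂ} (hv : v ∈ layer G x (i + 1)) :
    down G x (dualIdempotent G x 2 *ᵥ (distMatrix ℂ G (i + 1) *ᵥ v)) =
      ((bNum G p (i + 2) : ℂ) - cNum G p i) • (dualIdempotent G x 1 *ᵥ (distMatrix ℂ G i *ᵥ v)) +
        (((cNum G p (i + 2) : ℂ) - 1) * ∑ y, v y) • layerOnes G x 1 := by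
  have hc := hG.connected
  have hvalency : (bNum G p i + cNum G p i : ℂ) = bNum G p (i + 2) + cNum G p (i + 2) := by
    have h := (bNum_add_cNum hG hbip (by omega) (i := i) (by omega)).trans
      (bNum_add_cNum hG hbip (by omega) hi).symm
    rw [add_comm, add_comm (cNum G p (i + 2))] at h
    exact_mod_cast h
  rw [down_dualIdempotent_mulVec hc hbip, distMatrix_mulVec_apply_self_of_mem_layer hc hv]
  ext y
  simp only [Pi.sub_apply, Pi.add_apply, Pi.smul_apply, smul_eq_mul, down_apply, layerOnes_apply,
    dualIdempotent_mulVec_apply]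
  split_ifs with hy
  · have hsum := distMatrix_mulVec_apply_add_distMatrix_mulVec_apply (G := G) (i := i)
      (j := i + 2) (by omega) (v := v) (y := y) fun z hz => by
        have hxz : G.dist x z = i + 1 := not_imp_comm.1 ((mem_layer hc).1 hv z) hz
        have hstep := dist_eq_succ_or_succ_eq_of_dist_eq_one hc hbip hy z
        omega
    rw [mulVec_mulVec, distMatrix_one_mul_distMatrix_succ hG hbip, add_mulVec, smul_mulVec,
      smul_mulVec, Pi.add_apply, Pi.smul_apply, Pi.smul_apply, smul_eq_mul, smul_eq_mul]
    linear_combination (distMatrix ℂ G i *ᵥ v) y * hvalency + (cNum G p (i + 2) : ℂ) * hsum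
  · ring

lemma down_up (hG : IsDistanceRegularWith G p) (hbip : G.IsBipartite) (hD : 2 ≤ G.diam)
    {u : X → ℂ} (hu : u ∈ layer G x 1) :
    down G x (up G x u) =
      (bNum G p 2 : ℂ) • u + (((cNum G p 2 : ℂ) - 1) * ∑ y, u y) • layerOnes G x 1 := by
  have h := down_dualIdempotent_mulVec_distMatrix_mulVec hG hbip (i := 0) hD hu
  rwa [cNum_zero, Nat.cast_zero, sub_zero, distMatrix_zero hG.connected, one_mulVec,
    dualIdempotent_mulVec_eq_self ((mem_layer hG.connected).1 hu), mulVec_mulVec] at h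

lemma down_localMatrix_mulVec (hG : IsDistanceRegularWith G p) (hbip : G.IsBipartite)
    (hD : 3 ≤ G.diam) {v : X → ℂ} (hv : v ∈ layer G x 2) :
    down G x (localMatrix G x *ᵥ v) = ((bNum G p 3 : ℂ) - 1) • down G x v +
      (((cNum G p 3 : ℂ) - 1) * ∑ y, v y) • layerOnes G x 1 := by
  have h := down_dualIdempotent_mulVec_distMatrix_mulVec hG hbip (i := 1) hD hv
  rwa [cNum_one hG (by omega), Nat.cast_one, ← localMatrix_mulVec_of_mem_layer hG.connected hv,
    mulVec_mulVec (M := dualIdempotent G x 1)] at h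

lemma up_eq_distMatrix_mulVec (hc : G.Connected) (hbip : G.IsBipartite) {u : X → ℂ}
    (hu : u ∈ layer G x 1) (hsum : ∑ y, u y = 0) : up G x u = distMatrix ℂ G 1 *ᵥ u := by
  ext y
  rw [up_apply]
  refine ite_eq_left_iff.2 fun hy => ?_
  by_cases hyx : y = x
  · rw [hyx, distMatrix_mulVec_apply_self_of_mem_layer hc hu, hsum]
  · rw [distMatrix_mulVec_apply]
    refine (Finset.sum_eq_zero fun z hz => (mem_layer hc).1 hu z fun hxz => ?_).symm
    rw [Finset.mem_filter_univ, G.dist_comm] at hz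
    exact (eq_or_dist_eq_two_of_dist_eq_one hc hbip hxz hz).elim hyx hy

lemma localMatrix_mulVec_up (hG : IsDistanceRegularWith G p) (hbip : G.IsBipartite)
    (hD : 3 ≤ G.diam) {u : X → ℂ} (hu : u ∈ layer G x 1) (hsum : ∑ y, u y = 0) :
    localMatrix G x *ᵥ up G x u = ((bNum G p 3 : ℂ) - 1) • up G x u := by
  have hc := hG.connected
  have hvalency : (bNum G p 1 : ℂ) + 1 = bNum G p 3 + cNum G p 3 := by
    have h := (bNum_add_cNum hG hbip (by omega) (i := 1) (by omega)).trans
      (bNum_add_cNum hG hbip (by omega) hD).symm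
    rw [cNum_one hG (by omega), add_comm, add_comm (cNum G p 3)] at h
    exact_mod_cast h
  have hcomm := (Algebra.commute_of_mem_adjoin_self (distMatrix_mem_boseMesner hG hbip 2)).eq
  ext y
  by_cases hy : G.dist x y = 2
  · have hadd := distMatrix_mulVec_apply_add_distMatrix_mulVec_apply (G := G) (i := 1) (j := 3)
      (by omega) (v := u) (y := y) fun z hz => by
        have hxz : G.dist x z = 1 := not_imp_comm.1 ((mem_layer hc).1 hu z) hz
        have hstep := dist_eq_succ_or_succ_eq_of_dist_eq_one hc hbip hxz y
        rw [G.dist_comm (u := z)] at hstep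
        omega
    rw [hsum] at hadd
    rw [localMatrix_mulVec_of_mem_layer hc (up_mem_layer hc u), dualIdempotent_mulVec_apply,
      if_pos hy, up_eq_distMatrix_mulVec hc hbip hu hsum, mulVec_mulVec, ← hcomm,
      distMatrix_one_mul_distMatrix_succ hG hbip, add_mulVec, smul_mulVec, smul_mulVec,
      Pi.add_apply, Pi.smul_apply, Pi.smul_apply, Pi.smul_apply, smul_eq_mul, smul_eq_mul,
      smul_eq_mul]
    linear_combination (distMatrix ℂ G 1 *ᵥ u) y * hvalency + (cNum G p 3 : ℂ) * hadd
  · rw [(mem_layer hc).1 (localMatrix_mulVec_mem_layer hc _) y hy, Pi.smul_apply,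
      (mem_layer hc).1 (up_mem_layer hc u) y hy, smul_zero]

lemma down_layerOnes_two (hG : IsDistanceRegularWith G p) (hbip : G.IsBipartite) :
    down G x (layerOnes G x 2) = (bNum G p 1 : ℂ) • layerOnes G x 1 := by
  ext y
  rw [down_apply, layerOnes, distMatrix_one_mulVec_sphericalMap hG hbip, sphericalMap_apply,
    Pi.smul_apply, layerOnes_apply]
  split_ifs with hy
  · simp [hy, neighborSum_apply]
  · rw [smul_zero]

lemma sum_down (hG : IsDistanceRegularWith G p) (hbip : G.IsBipartite) {v : X → ℂ}
    (hv : v ∈ layer G x 2) : ∑ y, down G x v y = cNum G p 2 * ∑ y, v y := by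
  have hadjoint : ∑ y, down G x v y = layerOnes G x 1 ⬝ᵥ (distMatrix ℂ G 1 *ᵥ v) :=
    Finset.sum_congr rfl fun y _ => by rw [down_apply, layerOnes_apply, ite_mul, one_mul, zero_mul]
  rw [hadjoint, ← mulVec_dotProduct_of_isSymm (distMatrix_isSymm 1), layerOnes,
    distMatrix_one_mulVec_sphericalMap hG hbip, dotProduct, Finset.mul_sum]
  refine Finset.sum_congr rfl fun y _ => ?_
  by_cases hy : G.dist x y = 2
  · simp [sphericalMap_apply, hy, neighborSum_apply]
  · rw [(mem_layer hG.connected).1 hv y hy, mul_zero, mul_zero]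

lemma localMatrix_mulVec_layerOnes (hG : IsDistanceRegularWith G p) (hD : 2 ≤ G.diam) :
    localMatrix G x *ᵥ layerOnes G x 2 = (p 2 2 2 : ℂ) • layerOnes G x 2 := by
  ext y
  rw [localMatrix_mulVec_of_mem_layer hG.connected (layerOnes_mem_layer hG.connected 2),
    dualIdempotent_mulVec_apply, Pi.smul_apply, layerOnes_apply]
  split_ifs with hy
  · simp only [distMatrix_mulVec_apply, layerOnes_apply]
    rw [Finset.sum_boole, Finset.filter_filter, ← hG.card_eq 2 2 2 hD hD hD y x
      (by rw [G.dist_comm, hy]), smul_eq_mul, mul_one]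
    simp only [G.dist_comm (v := x)]
  · rw [smul_zero]

lemma sum_localMatrix_mulVec (hG : IsDistanceRegularWith G p) (hD : 2 ≤ G.diam) {v : X → ℂ}
    (hv : v ∈ layer G x 2) : ∑ y, (localMatrix G x *ᵥ v) y = p 2 2 2 * ∑ y, v y := by
  have hc := hG.connected
  have hsymm : (localMatrix G x).IsSymm := by
    rw [IsSymm, localMatrix, transpose_mul, transpose_mul, (distMatrix_isSymm 2).eq,
      dualIdempotent, diagonal_transpose, mul_assoc]
  have hsum {w : X → ℂ} (hw : w ∈ layer G x 2) : ∑ y, w y = layerOnes G x 2 ⬝ᵥ w := by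
    refine Finset.sum_congr rfl fun y _ => ?_
    by_cases hy : G.dist x y = 2
    · rw [layerOnes_apply, if_pos hy, one_mul]
    · rw [(mem_layer hc).1 hw y hy, mul_zero]
  rw [hsum (localMatrix_mulVec_mem_layer hc v), hsum hv, ← mulVec_dotProduct_of_isSymm hsymm,
    localMatrix_mulVec_layerOnes hG hD, smul_dotProduct, smul_eq_mul]

end Layers

/-! ### The dimensions of the eigenspaces of `E*_2 A_2 E*_2` -/

section LocalEigenspace

variable {X : Type*} [Fintype X] {G : SimpleGraph X} {p : ℕ → ℕ → ℕ → ℕ} {x : X}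

lemma finrank_span_layerOnes (hG : IsDistanceRegularWith G p) (hbip : G.IsBipartite)
    (hD : 1 ≤ G.diam) : Module.finrank ℂ (ℂ ∙ layerOnes G x 1) = 1 := by
  refine finrank_span_singleton fun h => ?_
  have hsum := sum_layerOnes (x := x) hG hD
  rw [h, Pi.zero_def, Finset.sum_const_zero] at hsum
  exact (valency_pos hG hbip hD).ne (by exact_mod_cast hsum)

variable [DecidableEq X]

/-- The vectors supported on the neighbours of `x` whose entries add up to zero. -/
def sumZero (G : SimpleGraph X) (x : X) : Submodule ℂ (X → ℂ) :=
  layer G x 1 ⊓ LinearMap.ker (∑ y, LinearMap.proj y : (X → ℂ) →ₗ[ℂ] ℂ)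

lemma mem_sumZero {u : X → ℂ} : u ∈ sumZero G x ↔ u ∈ layer G x 1 ∧ ∑ y, u y = 0 := by
  rw [sumZero, Submodule.mem_inf, LinearMap.mem_ker, LinearMap.sum_apply]
  rfl

lemma sub_smul_layerOnes_mem_sumZero (hG : IsDistanceRegularWith G p) (hbip : G.IsBipartite)
    (hD : 1 ≤ G.diam) {u : X → ℂ} (hu : u ∈ layer G x 1) :
    u - ((∑ y, u y) / p 0 1 1) • layerOnes G x 1 ∈ sumZero G x := by
  have hk : (p 0 1 1 : ℂ) ≠ 0 := by exact_mod_cast (valency_pos hG hbip hD).ne'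
  refine mem_sumZero.2 ⟨sub_mem hu
    (Submodule.smul_mem _ _ (layerOnes_mem_layer hG.connected 1)), ?_⟩
  simp only [Pi.sub_apply, Pi.smul_apply, smul_eq_mul]
  rw [Finset.sum_sub_distrib, ← Finset.mul_sum, sum_layerOnes hG hD, div_mul_cancel₀ _ hk, sub_self]

lemma disjoint_span_layerOnes_sumZero (hG : IsDistanceRegularWith G p) (hbip : G.IsBipartite)
    (hD : 1 ≤ G.diam) : Disjoint (ℂ ∙ layerOnes G x 1) (sumZero G x) := by
  have hk : (p 0 1 1 : ℂ) ≠ 0 := by exact_mod_cast (valency_pos hG hbip hD).ne'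
  refine Submodule.disjoint_def.2 fun v hv hsum => ?_
  obtain ⟨c, rfl⟩ := Submodule.mem_span_singleton.1 hv
  have h := (mem_sumZero.1 hsum).2
  simp only [Pi.smul_apply, smul_eq_mul] at h
  rw [← Finset.mul_sum, sum_layerOnes hG hD] at h
  rw [(mul_eq_zero.1 h).resolve_right hk, zero_smul]

lemma finrank_sumZero (hG : IsDistanceRegularWith G p) (hbip : G.IsBipartite)
    (hD : 1 ≤ G.diam) : Module.finrank ℂ (sumZero G x) = p 0 1 1 - 1 := by
  have hsup : (ℂ ∙ layerOnes G x 1) ⊔ sumZero G x = layer G x 1 := by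
    refine le_antisymm (sup_le ?_ inf_le_left) fun u hu => ?_
    · exact (Submodule.span_singleton_le_iff_mem _ _).2 (layerOnes_mem_layer hG.connected 1)
    · rw [← add_sub_cancel (((∑ y, u y) / p 0 1 1) • layerOnes G x 1) u]
      exact Submodule.add_mem_sup
        (Submodule.smul_mem _ _ (Submodule.mem_span_singleton_self _))
        (sub_smul_layerOnes_mem_sumZero hG hbip hD hu)
  have h := Submodule.finrank_sup_add_finrank_inf_eq (ℂ ∙ layerOnes G x 1) (sumZero G x)
  rw [hsup, (disjoint_span_layerOnes_sumZero hG hbip hD).eq_bot, finrank_bot, finrank_layer hG hD,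
    finrank_span_layerOnes hG hbip hD] at h
  omega

lemma eigenspaceU_eq_localEigenspace_inf_ker_down (hG : IsDistanceRegularWith G p)
    (hbip : G.IsBipartite) (hD : 2 ≤ G.diam) (t : ℝ) :
    eigenspaceU G x t = localEigenspace G x t ⊓ LinearMap.ker (down G x) := by
  ext v
  have hprim : IsPrimitive G x v ↔ v ∈ layer G x 2 ∧ down G x v = 0 := by
    rw [mem_layer hG.connected, down, mulVecLin_apply]
    exact ⟨fun h => ⟨h.supp, (isPrimitive_iff.1 h).2⟩, fun h => ⟨h.1, fun y hy => by
      simpa [← mulVec_mulVec, dualIdempotent_mulVec_apply, hy] using congrFun h.2 y⟩⟩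
  rw [mem_eigenspaceU_iff hG hbip hD, hprim, Submodule.mem_inf, mem_localEigenspace,
    LinearMap.mem_ker, and_right_comm]

lemma map_down_localEigenspace_le (hG : IsDistanceRegularWith G p) (hbip : G.IsBipartite)
    (hD : 3 ≤ G.diam) (t : ℝ) :
    (localEigenspace G x t).map (down G x) ≤
      (if t = p 2 2 2 then ℂ ∙ layerOnes G x 1 else ⊥) ⊔
        if t = bNum G p 3 - 1 then sumZero G x else ⊥ := by
  have hc := hG.connected
  rintro _ ⟨v, hv, rfl⟩
  obtain ⟨hlayer, heig⟩ := mem_localEigenspace.1 hv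
  set a := (∑ y, down G x v y) / p 0 1 1 with ha
  have hsum : ((t : ℂ) - p 2 2 2) * ∑ y, v y = 0 := by
    have h := sum_localMatrix_mulVec hG (by omega) hlayer
    simp only [heig, Pi.smul_apply, smul_eq_mul, ← Finset.mul_sum] at h
    rw [sub_mul, ← h, sub_self]
  have hdown : ((t : ℂ) - (bNum G p 3 - 1)) • down G x v =
      (((cNum G p 3 : ℂ) - 1) * ∑ y, v y) • layerOnes G x 1 := by
    have h := down_localMatrix_mulVec hG hbip hD hlayer
    rw [heig, map_smul] at h
    rw [sub_smul, h, add_sub_cancel_left]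
  set w := down G x v - a • layerOnes G x 1 with hw
  have hw_mem : w ∈ sumZero G x :=
    sub_smul_layerOnes_mem_sumZero hG hbip (by omega) (down_mem_layer hc v)
  have hw_smul : ((t : ℂ) - (bNum G p 3 - 1)) • w = 0 := by
    refine Submodule.disjoint_def.1 (disjoint_span_layerOnes_sumZero hG hbip (by omega)) _ ?_
      (Submodule.smul_mem _ _ hw_mem)
    rw [hw, smul_sub, hdown, smul_smul, ← sub_smul]
    exact Submodule.smul_mem _ _ (Submodule.mem_span_singleton_self _)
  rw [← add_sub_cancel (a • layerOnes G x 1) (down G x v)]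
  refine Submodule.add_mem_sup ?_ ?_
  · split_ifs with ht
    · exact Submodule.smul_mem _ _ (Submodule.mem_span_singleton_self _)
    · have hs0 : ∑ y, v y = 0 :=
        (mul_eq_zero.1 hsum).resolve_left (sub_ne_zero.2 (by exact_mod_cast ht))
      rw [ha, sum_down hG hbip hlayer, hs0, mul_zero, zero_div, zero_smul]
      exact zero_mem _
  · split_ifs with ht
    · exact hw_mem
    · exact (smul_eq_zero.1 hw_smul).resolve_left (sub_ne_zero.2 (by exact_mod_cast ht))

lemma le_map_down_localEigenspace (hG : IsDistanceRegularWith G p) (hbip : G.IsBipartite)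
    (hD : 3 ≤ G.diam) (t : ℝ) :
    (if t = p 2 2 2 then ℂ ∙ layerOnes G x 1 else ⊥) ⊔
        (if t = bNum G p 3 - 1 then sumZero G x else ⊥) ≤
      (localEigenspace G x t).map (down G x) := by
  have hc := hG.connected
  refine sup_le ?_ ?_
  · split_ifs with ht
    · have hb : (bNum G p 1 : ℂ) ≠ 0 := by exact_mod_cast (bNum_pos hG (by omega)).ne'
      refine (Submodule.span_singleton_le_iff_mem _ _).2
        ⟨(bNum G p 1 : ℂ)⁻¹ • layerOnes G x 2, Submodule.smul_mem _ _ ?_, ?_⟩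
      · refine mem_localEigenspace.2 ⟨layerOnes_mem_layer hc 2, ?_⟩
        rw [localMatrix_mulVec_layerOnes hG (by omega), ht, Complex.ofReal_natCast]
      · rw [map_smul, down_layerOnes_two hG hbip, inv_smul_smul₀ hb]
    · exact bot_le
  · split_ifs with ht
    · intro u hu
      obtain ⟨hlayer, hsum⟩ := mem_sumZero.1 hu
      have hb : (bNum G p 2 : ℂ) ≠ 0 := by exact_mod_cast (bNum_pos hG (by omega)).ne'
      refine ⟨(bNum G p 2 : ℂ)⁻¹ • up G x u, Submodule.smul_mem _ _ ?_, ?_⟩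
      · refine mem_localEigenspace.2 ⟨up_mem_layer hc u, ?_⟩
        rw [localMatrix_mulVec_up hG hbip hD hlayer hsum, ht]
        norm_cast
      · rw [map_smul, down_up hG hbip (by omega) hlayer, hsum, mul_zero, zero_smul, add_zero,
          inv_smul_smul₀ hb]
    · exact bot_le

lemma finrank_localEigenspace (hG : IsDistanceRegularWith G p) (hbip : G.IsBipartite)
    (hD : 3 ≤ G.diam) (t : ℝ) :
    Module.finrank ℂ (localEigenspace G x t) = (if t = p 2 2 2 then 1 else 0) +
      (if t = bNum G p 3 - 1 then p 0 1 1 - 1 else 0) + Module.finrank ℂ (eigenspaceU G x t) := by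
  set P : Submodule ℂ (X → ℂ) := if t = p 2 2 2 then ℂ ∙ layerOnes G x 1 else ⊥ with hP
  set Q : Submodule ℂ (X → ℂ) := if t = bNum G p 3 - 1 then sumZero G x else ⊥ with hQ
  have hmap : (localEigenspace G x t).map (down G x) = P ⊔ Q :=
    (map_down_localEigenspace_le hG hbip hD t).antisymm (le_map_down_localEigenspace hG hbip hD t)
  have hPQ : P ⊓ Q = ⊥ := by
    refine ((disjoint_span_layerOnes_sumZero (x := x) hG hbip (by omega)).mono ?_ ?_).eq_bot
    · rw [hP]
      split_ifs <;> simp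
    · rw [hQ]
      split_ifs <;> simp
  have hfinrankP : Module.finrank ℂ P = if t = p 2 2 2 then 1 else 0 := by
    by_cases ht : t = p 2 2 2
    · rw [hP, if_pos ht, if_pos ht, finrank_span_layerOnes hG hbip (by omega)]
    · rw [hP, if_neg ht, if_neg ht, finrank_bot]
  have hfinrankQ : Module.finrank ℂ Q = if t = bNum G p 3 - 1 then p 0 1 1 - 1 else 0 := by
    by_cases ht : t = bNum G p 3 - 1
    · rw [hQ, if_pos ht, if_pos ht, finrank_sumZero hG hbip (by omega)]
    · rw [hQ, if_neg ht, if_neg ht, finrank_bot]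
  have hfinrank := Submodule.finrank_sup_add_finrank_inf_eq P Q
  rw [hPQ, finrank_bot, add_zero, hfinrankP, hfinrankQ] at hfinrank
  rw [← finrank_map_add_finrank_inf_ker (down G x), hmap, hfinrank,
    ← eigenspaceU_eq_localEigenspace_inf_ker_down hG hbip (by omega)]

end LocalEigenspace

/-! ### The local eigenvalues -/

lemma map_getD_Icc_one (l : List ℝ) :
    (Finset.Icc 1 l.length).val.map (fun i => l.getD (i - 1) 0) = l := by
  refine congrArg _ (?_ : (List.range' 1 (l.length + 1 - 1)).map (fun i => l.getD (i - 1) 0) = l)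
  refine List.ext_getElem (by simp) fun i h₁ h₂ => ?_
  rw [List.getElem_map, List.getElem_range', one_mul, Nat.add_sub_cancel_left,
    List.getD_eq_getElem _ _ h₂]

lemma exists_map_Icc_one_eq {l : List ℝ} {s : Multiset ℝ} (h : (l : Multiset ℝ) ≤ s) :
    ∃ e : ℕ → ℝ, (Finset.Icc 1 s.card).val.map e = s ∧
      ∀ i (hi : i < l.length), e (i + 1) = l[i] := by
  obtain ⟨r, rfl⟩ := Multiset.le_iff_exists_add.1 h
  obtain ⟨r, rfl⟩ := Quot.exists_rep r
  refine ⟨fun i => (l ++ r).getD (i - 1) 0, map_getD_Icc_one (l ++ r), fun i hi => ?_⟩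
  have hi' : i < (l ++ r).length := by
    rw [List.length_append]
    omega
  dsimp only
  rw [Nat.add_sub_cancel, List.getD_eq_getElem _ _ hi', List.getElem_append_left hi]

lemma count_map_finset_val (e : ℕ → ℝ) (s : Finset ℕ) (t : ℝ) :
    (s.val.map e).count t = #{i ∈ s | e i = t} := by
  rw [Multiset.count_map, Finset.card_def, Finset.filter_val]
  exact congrArg _ (Multiset.filter_congr fun i _ => eq_comm)

section LocalOrdering

variable {X : Type*} [Fintype X] [DecidableEq X] {G : SimpleGraph X} {p : ℕ → ℕ → ℕ → ℕ} {x : X}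

lemma IsLocalOrdering.count_localSpectrum {e : ℕ → ℝ} (he : IsLocalOrdering G x p e)
    (hk : 1 ≤ p 0 1 1) (hk₂ : p 0 1 1 ≤ p 0 2 2) (η : ℝ) :
    (localSpectrum G x).count η = (if η = p 2 2 2 then 1 else 0) +
      (if η = (p 3 1 4 : ℝ) - 1 then p 0 1 1 - 1 else 0) +
        #{i ∈ Finset.Icc (p 0 1 1 + 1) (p 0 2 2) | e i = η} := by
  have hsecond : ∑ i ∈ Finset.Ico 2 (p 0 1 1 + 1), (if e i = η then 1 else 0) =
      if η = (p 3 1 4 : ℝ) - 1 then p 0 1 1 - 1 else 0 := by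
    have h : ∀ i ∈ Finset.Ico 2 (p 0 1 1 + 1), (if e i = η then 1 else 0) =
        if η = (p 3 1 4 : ℝ) - 1 then 1 else 0 := fun i hi => by
      rw [he.second i (Finset.mem_Ico.1 hi).1 (Nat.lt_succ_iff.1 (Finset.mem_Ico.1 hi).2)]
      simp only [eq_comm]
    rw [Finset.sum_congr rfl h, Finset.sum_const, Nat.card_Ico, smul_eq_mul, mul_ite, mul_one,
      mul_zero]
    rfl
  rw [← he.eigenvalues, count_map_finset_val, Finset.card_filter, Finset.card_filter,
    ← Finset.Ico_add_one_right_eq_Icc, ← Finset.Ico_add_one_right_eq_Icc,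
    Finset.sum_eq_sum_Ico_succ_bot (by omega), he.first,
    ← Finset.sum_Ico_consecutive _ (m := 1 + 1) (n := p 0 1 1 + 1) (by omega) (by omega),
    hsecond, ← add_assoc]
  simp only [eq_comm]

lemma count_localSpectrum_eq (hG : IsDistanceRegularWith G p) (hbip : G.IsBipartite)
    (hD : 4 ≤ G.diam) (t : ℝ) :
    (localSpectrum G x).count t = (if t = p 2 2 2 then 1 else 0) +
      (if t = (p 3 1 4 : ℝ) - 1 then p 0 1 1 - 1 else 0) +
        Module.finrank ℂ (eigenspaceU G x t) := by
  have hb₃ : bNum G p 3 = p 3 1 4 := if_pos (by omega)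
  rw [count_localSpectrum hG.connected, finrank_localEigenspace hG hbip (by omega), hb₃]

lemma cons_replicate_le_localSpectrum (hG : IsDistanceRegularWith G p) (hbip : G.IsBipartite)
    (hD : 4 ≤ G.diam) :
    (((p 2 2 2 : ℝ) :: List.replicate (p 0 1 1 - 1) ((p 3 1 4 : ℝ) - 1) : List ℝ) :
      Multiset ℝ) ≤ localSpectrum G x := by
  refine Multiset.le_iff_count.2 fun t => ?_
  rw [count_localSpectrum_eq hG hbip hD, Multiset.coe_count, List.count_cons, List.count_replicate]
  simp only [beq_iff_eq, eq_comm (b := t)]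
  omega

lemma exists_isLocalOrdering (hG : IsDistanceRegularWith G p) (hbip : G.IsBipartite)
    (hD : 4 ≤ G.diam) : ∃ e, IsLocalOrdering G x p e := by
  obtain ⟨e, he, hprefix⟩ := exists_map_Icc_one_eq (cons_replicate_le_localSpectrum hG hbip hD)
  have hk := valency_pos hG hbip (by omega)
  rw [card_localSpectrum hG (by omega)] at he
  refine ⟨e, he, hprefix 0 (Nat.succ_pos _), fun i hi hik => ?_⟩
  obtain ⟨j, rfl⟩ := Nat.exists_eq_add_of_le' hi
  rw [hprefix (j + 1) (by rw [List.length_cons, List.length_replicate]; omega),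
    List.getElem_cons_succ, List.getElem_replicate]

lemma isMult_finrank_eigenspaceU (hG : IsDistanceRegularWith G p) (hbip : G.IsBipartite)
    (hD : 4 ≤ G.diam) (η : ℝ) :
    IsMult G x p η (Module.finrank ℂ (eigenspaceU G x η)) := by
  have hk := valency_pos hG hbip (by omega)
  have hk₂ : p 0 1 1 ≤ p 0 2 2 := by
    have h := Multiset.card_le_card (cons_replicate_le_localSpectrum (x := x) hG hbip hD)
    rw [Multiset.coe_card, List.length_cons, List.length_replicate,
      card_localSpectrum hG (by omega)] at h
    omega
  refine ⟨exists_isLocalOrdering hG hbip hD, fun e he => ?_⟩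
  have h := he.count_localSpectrum hk hk₂ η
  rw [count_localSpectrum_eq hG hbip hD] at h
  omega

end LocalOrdering

end Subconstituent

end

open Subconstituent in
theorem mainTheorem12 {X : Type*} [Fintype X] [DecidableEq X] (G : SimpleGraph X)
    (p : ℕ → ℕ → ℕ → ℕ) (hG : IsDistanceRegularWith G p) (hbip : G.IsBipartite)
    (hD : 4 ≤ G.diam) (hk : 3 ≤ p 0 1 1) (x : X)
    (n : ℕ) (hn : n = 1 ∨ (Odd G.diam ∧ n = G.diam / 2))
    (η : ℝ) (hη : η = tilde p (eigenvalue G n)) :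
    ∃ μ m : ℕ, IsMu G x η μ ∧ IsMult G x p η m ∧
      μ = Module.finrank ℂ (eigenspaceU G x η) ∧
      Module.finrank ℂ (eigenspaceU G x η) = m := by
  subst hη
  obtain ⟨u, hu, hne⟩ := exists_isCosine_eigenvalue hG hbip (by omega) hn
  have hid := hu.tilde_identity hG hbip hD (hne 2 (by omega))
  refine ⟨_, _, isMu_finrank_eigenspaceU hG hbip (by omega) fun v hv => ?_,
    isMult_finrank_eigenspaceU hG hbip hD _, rfl, rfl⟩
  obtain ⟨hprim, heig⟩ := (mem_eigenspaceU_iff hG hbip (by omega)).1 hv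
  exact hprim.isLadder hG hbip (by omega) hu hne hid heig
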